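/- Let $\mathfrak G$ be the real vector space generated by finite simple graphs (no multiple edges, no loops) with an ordering of the edge set, written as a wedge product of the edges, modulo the relations: isomorphic graphs with corresponding edge orderings are equal, and a permutation of the edges multiplies the graph by the sign of the permutation. (A graph with a symmetry that induces an odd permutation of its edges is therefore zero in $\mathfrak G$; it is called a zero graph.) For graphs $\gamma_1,\gamma_2$ let $\gamma_1\circ\gamma_2$ be the sum, over the vertices $v$ of $\gamma_2$, of all graphs obtained by replacing $v$ by the entire graph $\gamma_1$ and re-attaching the edges of $\gamma_2$ touching $v$ to vertices of $\gamma_1$ in all possible ways, with the edge ordering $E(\gamma_1)\wedge E(\gamma_2)$. Put $[\gamma_1,\gamma_2]=\gamma_1\circ\gamma_2-(-1)^{\#E(\gamma_1)\,\#E(\gamma_2)}\gamma_2\circ\gamma_1$, extended bilinearly, and $\mathrm d=[\bullet\!\!-\!\!\bullet,\,\cdot\,]$, where $\bullet\!\!-\!\!\bullet$ is the graph with two vertices and one edge. Let $\gamma_7\in\mathfrak G$ be the following sum of 46 graphs on the vertices $1,\dots,8$. Each line lists the 14 edges in their order ($ij$ is the edge between $i$ and $j$) and then the rational coefficient of the graph.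 16 17 18 23 25 28 34 38 46 48 57 58 68 78 : $1$ 12 13 18 25 26 37 38 45 46 47 56 57 68 78 : $-7$ 12 14 18 23 27 35 37 46 48 57 58 67 68 78 : $-\tfrac{21}{8}$ 12 14 16 23 25 36 37 45 48 57 58 67 68 78 : $\tfrac{77}{8}$ 13 14 18 23 25 28 37 46 48 56 57 67 68 78 : $-\tfrac{77}{4}$ 13 16 17 24 25 26 35 37 45 48 58 67 68 78 : $-7$ 12 13 15 24 27 35 36 46 48 57 58 67 68 78 : $-\tfrac{35}{8}$ 14 15 17 23 26 28 37 38 46 48 56 57 68 78 : $\tfrac{49}{4}$ 12 13 18 24 26 37 38 46 47 56 57 58 68 78 : $\tfrac{49}{8}$ 12 16 18 27 28 34 36 38 46 47 56 57 58 78 : $-\tfrac{147}{8}$ 14 17 18 23 25 26 35 37 46 48 56 58 67 78 : $\tfrac{77}{8}$ 12 15 16 27 28 35 36 38 45 46 47 57 68 78 : $-\tfrac{21}{8}$ 12 13 18 26 27 35 38 45 46 47 56 57 68 78 : $-\tfrac{105}{8}$ 12 14 18 23 27 35 36 45 46 57 58 67 68 78 : $-\tfrac{35}{8}$ 12 14 18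 23 27 36 38 46 48 56 57 58 67 78 : $\tfrac{7}{8}$ 14 15 16 23 26 28 37 38 46 48 57 58 67 78 : $-\tfrac{49}{4}$ 12 14 15 23 27 35 36 46 48 57 58 67 68 78 : $\tfrac{35}{8}$ 12 15 18 23 28 34 37 46 48 56 57 67 68 78 : $\tfrac{105}{8}$ 12 13 14 27 28 36 38 46 47 56 57 58 68 78 : $-\tfrac{49}{8}$ 12 14 17 23 26 37 38 46 48 56 57 58 68 78 : $-\tfrac{49}{8}$ 12 13 18 25 27 34 36 47 48 56 58 67 68 78 : $\tfrac{35}{4}$ 12 16 18 25 27 35 36 37 45 46 48 57 68 78 : $\tfrac{49}{16}$ 12 13 14 25 26 36 38 45 47 57 58 67 68 78 : $-\tfrac{119}{16}$ 12 13 18 25 27 35 36 46 47 48 56 57 68 78 : $7$ 12 13 15 24 28 36 38 47 48 56 57 67 68 78 : $\tfrac{49}{8}$ 12 14 18 25 28 34 36 38 47 57 58 67 68 78 : $-7$ 12 13 14 23 28 37 46 48 56 57 58 67 68 78 : $\tfrac{77}{4}$ 12 16 18 25 27 35 36 37 45 46 48 58 67 78 : $-\tfrac{77}{16}$ 12 15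 17 25 26 35 36 38 45 47 48 67 68 78 : $-\tfrac{49}{8}$ 12 14 18 23 27 35 38 46 47 57 58 67 68 78 : $\tfrac{77}{4}$ 13 15 18 24 26 28 37 38 46 47 56 57 68 78 : $-\tfrac{49}{4}$ 12 14 15 23 27 36 38 46 48 57 58 67 68 78 : $\tfrac{35}{2}$ 13 14 18 25 26 28 36 38 47 48 56 57 67 78 : $-\tfrac{49}{4}$ 12 13 18 25 27 34 36 46 48 57 58 67 68 78 : $-\tfrac{105}{8}$ 12 14 18 23 28 35 37 46 48 56 57 67 68 78 : $-7$ 12 15 16 25 27 35 36 38 46 47 48 57 68 78 : $-7$ 12 14 18 23 28 36 38 46 47 56 57 58 67 78 : $-7$ 12 13 16 25 28 34 37 47 48 57 58 67 68 78 : $-\tfrac{147}{16}$ 12 15 16 25 27 35 36 38 46 47 48 58 67 78 : $\tfrac{49}{8}$ 12 13 17 25 26 35 37 45 46 48 58 67 68 78 : $-\tfrac{77}{4}$ 12 14 18 23 28 36 37 46 47 56 57 58 68 78 : $\tfrac{49}{8}$ 12 14 17 23 27 35 38 46 48 57 58 67 68 78 : $-\tfrac{49}{8}$ 12 13 15 26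 27 35 36 45 47 48 58 67 68 78 : $-7$ 12 13 15 26 28 35 37 45 46 47 58 67 68 78 : $-\tfrac{7}{4}$ 12 13 18 24 28 35 38 46 47 57 58 67 68 78 : $7$ 12 14 18 23 26 36 38 47 48 56 57 58 67 78 : $-7$ Theorem. (1) The 46 graphs are connected, pairwise non-isomorphic, and none of them is a zero graph; all coefficients are nonzero. The first graph is the heptagon wheel (a 7-cycle together with an axis vertex joined to all its vertices), with coefficient $1$. (2) $\gamma_7$ is a cocycle: $\mathrm d(\gamma_7)=0$. It is not a coboundary: $\gamma_7\notin B$, where $B=\{\mathrm d(\delta)\}$ and $\delta$ runs over the linear combinations of connected graphs with 7 vertices and 13 edges (vertices of any valency are allowed). (3) $\gamma_7$ is unique modulo exact terms. Consider the linear combinations $x$ of connected graphs with 8 vertices and 14 edges (vertices of any valency are allowed) such that $\mathrm d(x)=0$ and the coefficient in $x$ of the heptagon wheel, with its edges ordered as in the first line, is $1$. These $x$ are exactly the elements of the affine space $\gamma_7+B$, and $\dim_{\mathbb R}B=35$; that is, the general solution has 35 free parameters, all of which are coboundaries. -/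

import Mathlib

/-!  Kontsevich's non-oriented graph complex and the heptagon-wheel sum of graphs. -/

noncomputable section

namespace GraphComplex

/-- A finite simple graph with `k` edges on the vertex set `V` (no multiple edges, no tadpoles),
together with an ordering `edge 0 ∧ edge 1 ∧ ⋯ ∧ edge (k - 1)` of its edge set. -/
@[ext]
structure OrderedGraph (V : Type) (k : ℕ) where
  edge : Fin k → Sym2 V
  injective : Function.Injective edge
  loopless : ∀ i, ¬ (edge i).IsDiag

namespace OrderedGraph

variable {V W V₁ V₂ : Type} {k k₁ k₂ : ℕ}

/-- Transport along a bijection of vertex sets. -/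
def map (e : V ≃ W) (g : OrderedGraph V k) : OrderedGraph W k where
  edge i := (g.edge i).map e
  injective := (Sym2.map.injective e.injective).comp g.injective
  loopless i := by
    rw [Sym2.isDiag_map e.injective]
    exact g.loopless i

/-- Change of the ordering of the edges by a permutation. -/
def reorder (τ : Equiv.Perm (Fin k)) (g : OrderedGraph V k) : OrderedGraph V k where
  edge i := g.edge (τ i)
  injective := g.injective.comp τ.injective
  loopless i := g.loopless (τ i)

/-- The underlying simple graph. -/
def toSimpleGraph (g : OrderedGraph V k) : SimpleGraph V :=
  SimpleGraph.fromEdgeSet (Set.range g.edge)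

/-- A zero graph: it has a symmetry that induces a parity-odd permutation of the edges. -/
def IsZeroGraph (g : OrderedGraph V k) : Prop :=
  ∃ (φ : Equiv.Perm V) (τ : Equiv.Perm (Fin k)),
    (g.map φ).reorder τ = g ∧ Equiv.Perm.sign τ = -1

end OrderedGraph

/-- Edge-ordered graphs on the vertex sets `Fin n`, for all numbers of vertices and edges. -/
abbrev Generator : Type := Σ n : ℕ, Σ k : ℕ, OrderedGraph (Fin n) k

/-- The relations: relabelling the vertices does not change a graph, and a permutation of the
edges multiplies it by the sign of the permutation. -/
def relations : Submodule ℝ (Generator →₀ ℝ) :=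
  Submodule.span ℝ {x | ∃ (n k : ℕ) (g : OrderedGraph (Fin n) k)
    (φ : Equiv.Perm (Fin n)) (τ : Equiv.Perm (Fin k)),
    x = Finsupp.single ⟨n, k, (g.map φ).reorder τ⟩ 1
      - ((Equiv.Perm.sign τ : ℤ) : ℝ) • Finsupp.single ⟨n, k, g⟩ 1}

/-- The real vector space `𝔊` of non-oriented graphs. -/
abbrev GraphSpace : Type := (Generator →₀ ℝ) ⧸ relations

namespace OrderedGraph

variable {V W V₁ V₂ W₁ W₂ : Type} {k k₁ k₂ : ℕ}

/-- The element of `𝔊` given by an edge-ordered graph on any finite vertex set; by `cls_eq` the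
numbering of the vertices is irrelevant. -/
def cls [Fintype V] (g : OrderedGraph V k) : GraphSpace :=
  relations.mkQ (Finsupp.single ⟨Fintype.card V, k, g.map (Fintype.equivFin V)⟩ 1)

theorem map_map {U : Type} (e : V ≃ W) (f : W ≃ U) (g : OrderedGraph V k) :
    (g.map e).map f = g.map (e.trans f) := by
  ext i : 2
  simp [map, Sym2.map_map]

theorem reorder_map (e : V ≃ W) (τ : Equiv.Perm (Fin k)) (g : OrderedGraph V k) :
    (g.reorder τ).map e = (g.map e).reorder τ := rfl

theorem mk_relation {n : ℕ} (g : OrderedGraph (Fin n) k) (φ : Equiv.Perm (Fin n))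
    (τ : Equiv.Perm (Fin k)) :
    relations.mkQ (Finsupp.single ⟨n, k, (g.map φ).reorder τ⟩ 1)
      = ((Equiv.Perm.sign τ : ℤ) : ℝ) • relations.mkQ (Finsupp.single ⟨n, k, g⟩ 1) := by
  rw [← map_smul, ← sub_eq_zero, ← map_sub, Submodule.mkQ_apply, Submodule.Quotient.mk_eq_zero]
  exact Submodule.subset_span ⟨n, k, g, φ, τ, rfl⟩

theorem cls_eq [Fintype V] {n : ℕ} (g : OrderedGraph V k) (e : V ≃ Fin n) :
    cls g = relations.mkQ (Finsupp.single ⟨n, k, g.map e⟩ 1) := by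
  obtain rfl : n = Fintype.card V := by simpa using (Fintype.card_congr e).symm
  have h := mk_relation (g.map e) (e.symm.trans (Fintype.equivFin V)) 1
  rw [map_map, ← Equiv.trans_assoc, Equiv.self_trans_symm, Equiv.refl_trans] at h
  simp only [Equiv.Perm.sign_one, Units.val_one, Int.cast_one, one_smul] at h
  exact h

theorem cls_map [Fintype V] [Fintype W] (g : OrderedGraph V k) (e : V ≃ W) :
    cls (g.map e) = cls g := by
  rw [cls_eq g (e.trans (Fintype.equivFin W)), ← map_map]
  rfl

theorem cls_reorder [Fintype V] (g : OrderedGraph V k) (τ : Equiv.Perm (Fin k)) :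
    cls (g.reorder τ) = ((Equiv.Perm.sign τ : ℤ) : ℝ) • cls g := by
  have h := mk_relation (g.map (Fintype.equivFin V)) (Equiv.refl _) τ
  rw [map_map, Equiv.trans_refl] at h
  exact h

/-- The vertices that remain when the vertex `v` is replaced by a graph on `V₁`. -/
abbrev InsVertex (V₁ : Type) (v : V₂) : Type := {w : V₂ // w ≠ v} ⊕ V₁

/-- The map that contracts the inserted graph back to the vertex `v`. -/
def collapse (V₁ : Type) (v : V₂) : InsVertex V₁ v → V₂ :=
  Sum.elim Subtype.val (fun _ => v)

/-- The ways to re-attach the edges of `g` touching `v` to the vertices in `V₁`: a lift of every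
edge of `g` along the contraction. An edge not touching `v` has exactly one lift; the lifts of
an edge between `v` and `w` are the edges between `w` and an arbitrary element of `V₁`. -/
abbrev Reattachment (V₁ : Type) (g : OrderedGraph V₂ k₂) (v : V₂) : Type :=
  {h : Fin k₂ → Sym2 (InsVertex V₁ v) // ∀ i, (h i).map (collapse V₁ v) = g.edge i}

/-- The graph `g₂` with `v` replaced by the entire graph `g₁` and the edges touching `v`
re-attached as prescribed by `h`; the edge ordering is `E(g₁) ∧ E(g₂)`. -/
def insertAt (g₁ : OrderedGraph V₁ k₁) (g₂ : OrderedGraph V₂ k₂) (v : V₂)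
    (h : Reattachment V₁ g₂ v) : OrderedGraph (InsVertex V₁ v) (k₁ + k₂) where
  edge := Fin.append (fun i => (g₁.edge i).map Sum.inr) h.1
  injective := by
    have key : ∀ i, ((g₁.edge i).map (Sum.inr : V₁ → InsVertex V₁ v)).map (collapse V₁ v)
        = s(v, v) := by
      intro i
      induction g₁.edge i with | _ a b => rfl
    rw [Fin.append_injective_iff]
    refine ⟨(Sym2.map.injective Sum.inr_injective).comp g₁.injective, ?_, ?_⟩
    · intro i j hij
      apply g₂.injective
      rw [← h.2 i, ← h.2 j, hij]
    · intro i j hij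
      apply g₂.loopless j
      rw [← h.2 j, ← hij, key i]
      simp
  loopless i := by
    refine Fin.addCases (fun i => ?_) (fun i => ?_) i
    · rw [Fin.append_left, Sym2.isDiag_map Sum.inr_injective]
      exact g₁.loopless i
    · rw [Fin.append_right]
      intro hd
      apply g₂.loopless i
      rw [← h.2 i]
      revert hd
      induction h.1 i with | _ a b =>
      intro hab
      simp only [Sym2.mk_isDiag_iff, Sym2.map_mk] at hab ⊢
      rw [hab]

/-- The bijection of vertex sets induced by relabelling both graphs. -/
def insVertexEquiv (e₁ : V₁ ≃ W₁) (e₂ : V₂ ≃ W₂) (v : V₂) :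
    InsVertex V₁ v ≃ InsVertex W₁ (e₂ v) :=
  Equiv.sumCongr (e₂.subtypeEquiv fun w => by simp) e₁

theorem collapse_insVertexEquiv (e₁ : V₁ ≃ W₁) (e₂ : V₂ ≃ W₂) (v : V₂) :
    collapse W₁ (e₂ v) ∘ insVertexEquiv e₁ e₂ v = e₂ ∘ collapse V₁ v := by
  funext x
  rcases x with x | x <;> rfl

/-- The bijection of unordered pairs induced by a bijection. -/
def sym2Map (e : V ≃ W) : Sym2 V ≃ Sym2 W where
  toFun := Sym2.map e
  invFun := Sym2.map e.symm
  left_inv x := by simp [Sym2.map_map]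
  right_inv x := by simp [Sym2.map_map]

/-- Relabelling both graphs carries re-attachments to re-attachments. -/
def reattachmentMap (g₂ : OrderedGraph V₂ k₂) (e₁ : V₁ ≃ W₁) (e₂ : V₂ ≃ W₂) (v : V₂) :
    Reattachment V₁ g₂ v ≃ Reattachment W₁ (g₂.map e₂) (e₂ v) :=
  Equiv.subtypeEquiv (Equiv.arrowCongr (Equiv.refl _) (sym2Map (insVertexEquiv e₁ e₂ v)))
    fun h => by
      refine forall_congr' fun i => ?_
      have : ((h i).map (insVertexEquiv e₁ e₂ v)).map (collapse W₁ (e₂ v))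
          = ((h i).map (collapse V₁ v)).map e₂ := by
        rw [Sym2.map_map, Sym2.map_map, collapse_insVertexEquiv]
      change _ ↔ ((h i).map (insVertexEquiv e₁ e₂ v)).map (collapse W₁ (e₂ v))
        = (g₂.edge i).map e₂
      rw [this]
      exact (Sym2.map.injective e₂.injective).eq_iff.symm

variable [Fintype V₁] [Fintype V₂] [DecidableEq V₂] [Fintype W₁] [Fintype W₂] [DecidableEq W₂]

/-- The insertion `g₁ ∘ g₂` of `g₁` into the vertices of `g₂`. -/
def insertion (g₁ : OrderedGraph V₁ k₁) (g₂ : OrderedGraph V₂ k₂) : GraphSpace :=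
  ∑ v : V₂, ∑ h : Reattachment V₁ g₂ v, (insertAt g₁ g₂ v h).cls

theorem insertion_map (g₁ : OrderedGraph V₁ k₁) (g₂ : OrderedGraph V₂ k₂)
    (e₁ : V₁ ≃ W₁) (e₂ : V₂ ≃ W₂) :
    insertion (g₁.map e₁) (g₂.map e₂) = insertion g₁ g₂ := by
  symm
  refine Fintype.sum_equiv e₂ _ _ fun v => ?_
  refine Fintype.sum_equiv (reattachmentMap g₂ e₁ e₂ v) _ _ fun h => ?_
  rw [← cls_map (insertAt g₁ g₂ v h) (insVertexEquiv e₁ e₂ v)]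
  congr 1
  ext i : 2
  refine Fin.addCases (fun i => ?_) (fun i => ?_) i
  · simp only [map, insertAt, Fin.append_left, Sym2.map_map]
    rfl
  · simp only [map, insertAt, Fin.append_right]
    rfl

theorem insertion_reorder (g₁ : OrderedGraph V₁ k₁) (g₂ : OrderedGraph V₂ k₂)
    (τ₁ : Equiv.Perm (Fin k₁)) (τ₂ : Equiv.Perm (Fin k₂)) :
    insertion (g₁.reorder τ₁) (g₂.reorder τ₂)
      = (((Equiv.Perm.sign τ₁ * Equiv.Perm.sign τ₂ : ℤˣ) : ℤ) : ℝ) • insertion g₁ g₂ := by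
  unfold insertion
  rw [Finset.smul_sum]
  refine Finset.sum_congr rfl fun v _ => ?_
  rw [Finset.smul_sum]
  symm
  refine Fintype.sum_equiv (Equiv.subtypeEquiv (Equiv.arrowCongr τ₂.symm (Equiv.refl _))
    fun h => ?_) _ _ fun h => ?_
  · exact (τ₂.forall_congr fun i => Iff.rfl).symm
  · have hs : Equiv.Perm.sign (finSumFinEquiv.permCongr (Equiv.sumCongr τ₁ τ₂))
        = Equiv.Perm.sign τ₁ * Equiv.Perm.sign τ₂ := by
      rw [Equiv.Perm.sign_permCongr, Equiv.Perm.sign_sumCongr]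
    rw [← hs, ← cls_reorder]
    congr 1
    ext i : 2
    refine Fin.addCases (fun i => ?_) (fun i => ?_) i
    · simp [reorder, insertAt, Equiv.permCongr_apply]
    · simp only [reorder, insertAt, Equiv.permCongr_apply, finSumFinEquiv_symm_apply_natAdd,
        Equiv.sumCongr_apply, Sum.map_inr, finSumFinEquiv_apply_right, Fin.append_right]
      rfl

end OrderedGraph

open OrderedGraph

/-- The bracket `[g₁, g₂] = g₁ ∘ g₂ - (-1)^(#E(g₁) #E(g₂)) g₂ ∘ g₁` of two edge-ordered graphs. -/
def bracketGen (a b : Generator) : GraphSpace :=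
  insertion a.2.2 b.2.2 - (-1 : ℝ) ^ (a.2.1 * b.2.1) • insertion b.2.2 a.2.2

theorem bracketGen_right (a : Generator) {n k : ℕ} (g : OrderedGraph (Fin n) k)
    (φ : Equiv.Perm (Fin n)) (τ : Equiv.Perm (Fin k)) :
    bracketGen a ⟨n, k, (g.map φ).reorder τ⟩
      = ((Equiv.Perm.sign τ : ℤ) : ℝ) • bracketGen a ⟨n, k, g⟩ := by
  have h₁ := insertion_reorder a.2.2 (g.map φ) 1 τ
  have h₂ := insertion_reorder (g.map φ) a.2.2 τ 1
  have h₃ := insertion_map a.2.2 g (Equiv.refl _) φ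
  have h₄ := insertion_map g a.2.2 φ (Equiv.refl _)
  have e₁ : a.2.2.reorder 1 = a.2.2 := rfl
  have e₂ : a.2.2.map (Equiv.refl _) = a.2.2 := by
    ext i : 2
    simp [OrderedGraph.map]
  rw [e₁] at h₁ h₂
  rw [e₂] at h₃ h₄
  simp only [Equiv.Perm.sign_one, one_mul, mul_one] at h₁ h₂
  simp only [bracketGen]
  rw [h₁, h₂, h₃, h₄, smul_sub, smul_comm]

theorem bracketGen_swap (a b : Generator) :
    bracketGen a b = -(-1 : ℝ) ^ (a.2.1 * b.2.1) • bracketGen b a := by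
  have h : (-1 : ℝ) ^ (a.2.1 * b.2.1) * (-1 : ℝ) ^ (a.2.1 * b.2.1) = 1 := by
    rw [← mul_pow]
    simp
  simp only [bracketGen]
  rw [mul_comm b.2.1 a.2.1, smul_sub, smul_smul, neg_mul, h]
  module

theorem bracketGen_left (b : Generator) {n k : ℕ} (g : OrderedGraph (Fin n) k)
    (φ : Equiv.Perm (Fin n)) (τ : Equiv.Perm (Fin k)) :
    bracketGen ⟨n, k, (g.map φ).reorder τ⟩ b
      = ((Equiv.Perm.sign τ : ℤ) : ℝ) • bracketGen ⟨n, k, g⟩ b := by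
  rw [bracketGen_swap, bracketGen_right, bracketGen_swap ⟨n, k, g⟩ b, smul_comm]

/-- A linear map that respects the relations vanishes on their span. -/
theorem relations_le_ker {M : Type*} [AddCommGroup M] [Module ℝ M] (f : Generator → M)
    (hf : ∀ {n k : ℕ} (g : OrderedGraph (Fin n) k) (φ : Equiv.Perm (Fin n))
      (τ : Equiv.Perm (Fin k)), f ⟨n, k, (g.map φ).reorder τ⟩
        = ((Equiv.Perm.sign τ : ℤ) : ℝ) • f ⟨n, k, g⟩) :
    relations ≤ LinearMap.ker (Finsupp.linearCombination ℝ f) := by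
  refine Submodule.span_le.2 ?_
  rintro _ ⟨n, k, g, φ, τ, rfl⟩
  simp [hf]

/-- The bracket with a fixed edge-ordered graph, on `𝔊`. -/
def bracketLeft (a : Generator) : GraphSpace →ₗ[ℝ] GraphSpace :=
  relations.liftQ (Finsupp.linearCombination ℝ (bracketGen a))
    (relations_le_ker _ (bracketGen_right a))

theorem bracketLeft_relabel {n k : ℕ} (g : OrderedGraph (Fin n) k)
    (φ : Equiv.Perm (Fin n)) (τ : Equiv.Perm (Fin k)) :
    bracketLeft ⟨n, k, (g.map φ).reorder τ⟩
      = ((Equiv.Perm.sign τ : ℤ) : ℝ) • bracketLeft ⟨n, k, g⟩ := by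
  apply Submodule.linearMap_qext
  apply Finsupp.lhom_ext
  intro b r
  change Finsupp.linearCombination ℝ (bracketGen _) (Finsupp.single b r)
    = ((Equiv.Perm.sign τ : ℤ) : ℝ) • Finsupp.linearCombination ℝ (bracketGen _)
      (Finsupp.single b r)
  rw [Finsupp.linearCombination_single, Finsupp.linearCombination_single, bracketGen_left,
    smul_comm]

/-- The bilinear bracket `[·, ·]` on `𝔊`. -/
def bracket : GraphSpace →ₗ[ℝ] GraphSpace →ₗ[ℝ] GraphSpace :=
  relations.liftQ (Finsupp.linearCombination ℝ bracketLeft)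
    (relations_le_ker _ bracketLeft_relabel)

/-- The graph `•–•` with two vertices and one edge. -/
def singleEdge : OrderedGraph (Fin 2) 1 where
  edge _ := s(0, 1)
  injective _ _ _ := Subsingleton.elim _ _
  loopless _ := by simp

/-- The differential `d = [•–•, ·]` of the graph complex. -/
def d : GraphSpace →ₗ[ℝ] GraphSpace := bracket singleEdge.cls

/-- The subspace of `𝔊` spanned by the connected graphs with `n` vertices and `k` edges. -/
def connectedPart (n k : ℕ) : Submodule ℝ GraphSpace :=
  Submodule.span ℝ {x | ∃ g : OrderedGraph (Fin n) k, g.toSimpleGraph.Connected ∧ x = g.cls}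

/-- The coboundaries of the connected graphs with `n` vertices and `k` edges. -/
def coboundaries (n k : ℕ) : Submodule ℝ GraphSpace := (connectedPart n k).map d

/-- The `m`-wheel: a cycle on `m` vertices and an axis vertex `none` joined to all of them. -/
def wheel (m : ℕ) : SimpleGraph (Option (Fin m)) where
  Adj
    | some i, some j => (SimpleGraph.cycleGraph m).Adj i j
    | none, none => False
    | _, _ => True
  symm := ⟨by
    rintro (_ | i) (_ | j) h
    · exact h
    · trivial
    · trivial
    · exact SimpleGraph.Adj.symm h⟩
  loopless := ⟨by
    rintro (_ | i) h
    · exact h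
    · exact SimpleGraph.irrefl _ h⟩

/-- The subspace of `𝔊` spanned by the connected graphs with 8 vertices and 14 edges that are not
isomorphic to the heptagon wheel. -/
def nonWheelPart : Submodule ℝ GraphSpace :=
  Submodule.span ℝ {x | ∃ g : OrderedGraph (Fin 8) 14, g.toSimpleGraph.Connected ∧
    IsEmpty (g.toSimpleGraph ≃g wheel 7) ∧ x = g.cls}

/-- Edge lists and coefficients. The two-digit number with the digits `i` and `j` denotes the edge
between the vertices `i` and `j`, where the vertices are labelled from 1 to 8. -/
def gamma7Table : Fin 46 → (Fin 14 → ℕ) × ℚ :=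
  ![
    (![16, 17, 18, 23, 25, 28, 34, 38, 46, 48, 57, 58, 68, 78], 1),
    (![12, 13, 18, 25, 26, 37, 38, 45, 46, 47, 56, 57, 68, 78], -7),
    (![12, 14, 18, 23, 27, 35, 37, 46, 48, 57, 58, 67, 68, 78], -21 / 8),
    (![12, 14, 16, 23, 25, 36, 37, 45, 48, 57, 58, 67, 68, 78], 77 / 8),
    (![13, 14, 18, 23, 25, 28, 37, 46, 48, 56, 57, 67, 68, 78], -77 / 4),
    (![13, 16, 17, 24, 25, 26, 35, 37, 45, 48, 58, 67, 68, 78], -7),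
    (![12, 13, 15, 24, 27, 35, 36, 46, 48, 57, 58, 67, 68, 78], -35 / 8),
    (![14, 15, 17, 23, 26, 28, 37, 38, 46, 48, 56, 57, 68, 78], 49 / 4),
    (![12, 13, 18, 24, 26, 37, 38, 46, 47, 56, 57, 58, 68, 78], 49 / 8),
    (![12, 16, 18, 27, 28, 34, 36, 38, 46, 47, 56, 57, 58, 78], -147 / 8),
    (![14, 17, 18, 23, 25, 26, 35, 37, 46, 48, 56, 58, 67, 78], 77 / 8),
    (![12, 15, 16, 27, 28, 35, 36, 38, 45, 46, 47, 57, 68, 78], -21 / 8),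
    (![12, 13, 18, 26, 27, 35, 38, 45, 46, 47, 56, 57, 68, 78], -105 / 8),
    (![12, 14, 18, 23, 27, 35, 36, 45, 46, 57, 58, 67, 68, 78], -35 / 8),
    (![12, 14, 18, 23, 27, 36, 38, 46, 48, 56, 57, 58, 67, 78], 7 / 8),
    (![14, 15, 16, 23, 26, 28, 37, 38, 46, 48, 57, 58, 67, 78], -49 / 4),
    (![12, 14, 15, 23, 27, 35, 36, 46, 48, 57, 58, 67, 68, 78], 35 / 8),
    (![12, 15, 18, 23, 28, 34, 37, 46, 48, 56, 57, 67, 68, 78], 105 / 8),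
    (![12, 13, 14, 27, 28, 36, 38, 46, 47, 56, 57, 58, 68, 78], -49 / 8),
    (![12, 14, 17, 23, 26, 37, 38, 46, 48, 56, 57, 58, 68, 78], -49 / 8),
    (![12, 13, 18, 25, 27, 34, 36, 47, 48, 56, 58, 67, 68, 78], 35 / 4),
    (![12, 16, 18, 25, 27, 35, 36, 37, 45, 46, 48, 57, 68, 78], 49 / 16),
    (![12, 13, 14, 25, 26, 36, 38, 45, 47, 57, 58, 67, 68, 78], -119 / 16),
    (![12, 13, 18, 25, 27, 35, 36, 46, 47, 48, 56, 57, 68, 78], 7),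
    (![12, 13, 15, 24, 28, 36, 38, 47, 48, 56, 57, 67, 68, 78], 49 / 8),
    (![12, 14, 18, 25, 28, 34, 36, 38, 47, 57, 58, 67, 68, 78], -7),
    (![12, 13, 14, 23, 28, 37, 46, 48, 56, 57, 58, 67, 68, 78], 77 / 4),
    (![12, 16, 18, 25, 27, 35, 36, 37, 45, 46, 48, 58, 67, 78], -77 / 16),
    (![12, 15, 17, 25, 26, 35, 36, 38, 45, 47, 48, 67, 68, 78], -49 / 8),
    (![12, 14, 18, 23, 27, 35, 38, 46, 47, 57, 58, 67, 68, 78], 77 / 4),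
    (![13, 15, 18, 24, 26, 28, 37, 38, 46, 47, 56, 57, 68, 78], -49 / 4),
    (![12, 14, 15, 23, 27, 36, 38, 46, 48, 57, 58, 67, 68, 78], 35 / 2),
    (![13, 14, 18, 25, 26, 28, 36, 38, 47, 48, 56, 57, 67, 78], -49 / 4),
    (![12, 13, 18, 25, 27, 34, 36, 46, 48, 57, 58, 67, 68, 78], -105 / 8),
    (![12, 14, 18, 23, 28, 35, 37, 46, 48, 56, 57, 67, 68, 78], -7),
    (![12, 15, 16, 25, 27, 35, 36, 38, 46, 47, 48, 57, 68, 78], -7),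
    (![12, 14, 18, 23, 28, 36, 38, 46, 47, 56, 57, 58, 67, 78], -7),
    (![12, 13, 16, 25, 28, 34, 37, 47, 48, 57, 58, 67, 68, 78], -147 / 16),
    (![12, 15, 16, 25, 27, 35, 36, 38, 46, 47, 48, 58, 67, 78], 49 / 8),
    (![12, 13, 17, 25, 26, 35, 37, 45, 46, 48, 58, 67, 68, 78], -77 / 4),
    (![12, 14, 18, 23, 28, 36, 37, 46, 47, 56, 57, 58, 68, 78], 49 / 8),
    (![12, 14, 17, 23, 27, 35, 38, 46, 48, 57, 58, 67, 68, 78], -49 / 8),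
    (![12, 13, 15, 26, 27, 35, 36, 45, 47, 48, 58, 67, 68, 78], -7),
    (![12, 13, 15, 26, 28, 35, 37, 45, 46, 47, 58, 67, 68, 78], -7 / 4),
    (![12, 13, 18, 24, 28, 35, 38, 46, 47, 57, 58, 67, 68, 78], 7),
    (![12, 14, 18, 23, 26, 36, 38, 47, 48, 56, 57, 58, 67, 78], -7)]

/-- The edge denoted by a two-digit number (the vertex with label `i` is `i - 1` in `Fin 8`). -/
def decodeEdge (c : ℕ) : Sym2 (Fin 8) :=
  s(Fin.ofNat 8 (c / 10 - 1), Fin.ofNat 8 (c % 10 - 1))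

/-- The graphs of the table, with the edges ordered as listed. -/
def gamma7Graph (r : Fin 46) : OrderedGraph (Fin 8) 14 where
  edge i := decodeEdge ((gamma7Table r).1 i)
  injective := by
    revert r
    decide +kernel
  loopless := by
    revert r
    decide +kernel

/-- The coefficients of the table. -/
def gamma7Coeff (r : Fin 46) : ℚ := (gamma7Table r).2

/-- The sum of graphs `γ₇`. -/
def gamma7 : GraphSpace := ∑ r, (gamma7Coeff r : ℝ) • (gamma7Graph r).cls

end GraphComplex

end

open GraphComplex

/-! The proof turns every claim into finite linear algebra over explicit graphs, by means of linear
functionals that play the role of coefficients.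

For a list `l` of edges, `coeff x l` counts with signs the isomorphisms from `l` to the graphs in
`x`. The sign of a matching of edges is a determinant (`matchSign`), so the count respects the
relations. At a graph without odd symmetries it is the coefficient times the number of symmetries.
Averaging over all edge-ordered graphs recovers `x` from these numbers (`homogeneousPart_cls`), so
they separate points and decide membership in spans of graphs (`mem_of_coeff`).

The differential is dual to edge contraction (`coeff_d`): the coefficient of `d x` at `l` is the
alternating sum over the edges `e` of `2 * (1 - freeEnds e)` times the coefficient of `x` at `l`
with `e` contracted. The summand 1 comes from inserting the edge into vertices, and the number of
free ends from inserting the graph into an end of the edge. Hence the contraction of a leaf edge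
does not count. This formula gives `d ∘ d = 0`, since two edges can be contracted in either order
with opposite signs. It also shows that `d` preserves connectedness.

Upper bound. In a connected cocycle, the coefficients at graphs with a leaf are governed by those at
graphs with an antenna of length two, and the coefficients at graphs with a bivalent vertex by those
with two adjacent bivalent vertices (`eq_zero_of_cocycle`). With 8 vertices and 14 edges the
remaining graphs are enumerated up to isomorphism by deleting vertices of minimal valency. Apart
from graphs with odd symmetries, they are the 104 graphs of `table8`. The cocycle condition at 144
graphs with 9 vertices and 15 edges then expresses everything in terms of 36 coefficients, those at
`freeIndices8`, one of which belongs to the heptagon wheel (`eq_zero_of_coeff_free`).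

The cocycle. A graph at which `d gamma7` could be nonzero has a contraction isomorphic to one of the
46 graphs, so it is one of their expansions (`d_eq_zero_of_expansions`). Every expansion that
matters has an odd symmetry or is isomorphic to one of 124 graphs, and there the contraction formula
gives zero.

Lower bound. Every edge of the wheel lies in a triangle, so its contraction has a double edge, and
coboundaries have coefficient zero at the wheel. This already shows that `gamma7` is not a
coboundary. On 35 explicit graphs with 7 vertices, `d` followed by the 35 free coefficients other
than the one of the wheel is given by a matrix that is triangular in a suitable order, hence
invertible (`combination7_injective`). So these 35 coefficients are coordinates on the coboundaries.
A normalised cocycle differs from `gamma7` by a cocycle without wheel, and such a cocycle is the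
coboundary with the same coordinates.

The finite checks are evaluated by the kernel on graphs written as decimal codes. They verify
certificates (permutations, contraction maps, indices), and how these were found plays no role. -/

namespace GraphComplex
open OrderedGraph

/-! ### The sign of a matching between two sequences. -/

section MatchSign

variable {E F : Type*} {k : ℕ}

open Classical in
/-- The sign of the permutation that carries the sequence `a` to the sequence `b` (`0` if there is
none), as the determinant of the incidence matrix. -/
noncomputable def matchSign (a b : Fin k → E) : ℝ :=
  (Matrix.of fun i j => if a i = b j then (1 : ℝ) else 0).det

-- Leibniz expansion: a permutation contributes only if it carries `a` to `b`. Distinct entries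
-- leave at most one term, and repeated entries give equal rows or columns, hence zero.
open Classical in
theorem matchSign_eq_sum (a b : Fin k → E) :
    matchSign a b = ∑ σ : Equiv.Perm (Fin k),
      if ∀ i, a (σ i) = b i then ((Equiv.Perm.sign σ : ℤ) : ℝ) else 0 := by
  rw [matchSign, Matrix.det_apply']
  refine Finset.sum_congr rfl fun σ _ => ?_
  simp only [Matrix.of_apply, Finset.prod_ite_zero]
  simp

theorem matchSign_comp_right (a b : Fin k → E) (τ : Equiv.Perm (Fin k)) :
    matchSign a (b ∘ τ) = ((Equiv.Perm.sign τ : ℤ) : ℝ) * matchSign a b := by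
  classical
  rw [matchSign, matchSign, ← Matrix.det_permute']
  rfl

theorem matchSign_comp_left (a b : Fin k → E) (τ : Equiv.Perm (Fin k)) :
    matchSign (a ∘ τ) b = ((Equiv.Perm.sign τ : ℤ) : ℝ) * matchSign a b := by
  classical
  rw [matchSign, matchSign, ← Matrix.det_permute]
  rfl

theorem matchSign_map {f : E → F} (hf : Function.Injective f) (a b : Fin k → E) :
    matchSign (f ∘ a) (f ∘ b) = matchSign a b := by
  classical
  unfold matchSign
  congr 2
  funext i j
  exact if_congr hf.eq_iff rfl rfl

theorem matchSign_eq_zero {a b : Fin k → E} (i : Fin k) (h : ∀ j, a i ≠ b j) :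
    matchSign a b = 0 := by
  classical
  rw [matchSign]
  exact Matrix.det_eq_zero_of_row_eq_zero i fun j => by simp [h j]

/-- Laplace expansion along the first column. In `•–• ∘ g` the edge of `•–•` comes first, and the
expansion lists the entries of `a` that can be matched with it. -/
theorem matchSign_cons [inst : DecidableEq E] (a : Fin (k + 1) → E) (b : Fin (k + 1) → E) :
    matchSign a b = ∑ i : Fin (k + 1), (-1 : ℝ) ^ (i : ℕ) *
      ((if a i = b 0 then 1 else 0) * matchSign (a ∘ i.succAbove) (b ∘ Fin.succ)) := by
  obtain rfl : inst = fun a b => Classical.propDecidable (a = b) := Subsingleton.elim _ _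
  rw [matchSign, Matrix.det_succ_column_zero]
  refine Finset.sum_congr rfl fun i _ => ?_
  rw [mul_assoc]
  rfl

/-- Laplace expansion along the last column, for `g ∘ •–•`, where the edge of `•–•` comes last. -/
theorem matchSign_snoc [inst : DecidableEq E] (a : Fin (k + 1) → E) (b : Fin (k + 1) → E) :
    matchSign a b = ∑ i : Fin (k + 1), (-1 : ℝ) ^ ((i : ℕ) + k) *
      ((if a i = b (Fin.last k) then 1 else 0) *
        matchSign (a ∘ i.succAbove) (b ∘ Fin.castSucc)) := by
  obtain rfl : inst = fun a b => Classical.propDecidable (a = b) := Subsingleton.elim _ _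
  rw [matchSign, Matrix.det_succ_column _ (Fin.last k)]
  refine Finset.sum_congr rfl fun i _ => ?_
  rw [mul_assoc, Fin.succAbove_last]
  rfl

/-- Summing over all lifts of the second sequence amounts to projecting the first one. -/
theorem sum_matchSign_lift [Finite E] (q : E → F) (a : Fin k → E) (b : Fin k → F)
    [Fintype {h : Fin k → E // ∀ i, q (h i) = b i}] :
    ∑ h : {h : Fin k → E // ∀ i, q (h i) = b i}, matchSign a h.1 = matchSign (q ∘ a) b := by
  classical
  simp only [matchSign_eq_sum]
  rw [Finset.sum_comm]
  refine Finset.sum_congr rfl fun σ _ => ?_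
  -- For a given `σ` the only candidate for `h` is `a ∘ σ`, and it is a lift of `b` exactly under
  -- this condition.
  by_cases hσ : ∀ i, (q ∘ a) (σ i) = b i
  · rw [if_pos hσ, Finset.sum_eq_single ⟨fun i => a (σ i), hσ⟩]
    · simp
    · intro h _ hne
      rw [if_neg]
      intro h'
      exact hne (Subtype.ext (funext fun i => (h' i).symm))
    · simp
  · rw [if_neg hσ]
    refine Finset.sum_eq_zero fun h _ => if_neg fun h' => hσ fun i => ?_
    rw [Function.comp_apply, h' i, h.2 i]

end MatchSign

/-! ### Signed counts of isomorphisms as functionals on the graph space. -/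

section Pairing

variable {V W : Type} {k : ℕ}

/-- The signed number of isomorphisms from a sequence of edges to an edge-ordered graph. -/
noncomputable def pairingGen (a : Fin k → Sym2 V) (x : Generator) : ℝ :=
  letI := Fintype.ofFinite (V ≃ Fin x.1)
  if h : x.2.1 = k then
    ∑ φ : V ≃ Fin x.1, matchSign (fun i => (a i).map φ) (fun j => x.2.2.edge (Fin.cast h.symm j))
  else 0

theorem pairingGen_relabel (a : Fin k → Sym2 V) {n m : ℕ} (g : OrderedGraph (Fin n) m)
    (φ : Equiv.Perm (Fin n)) (τ : Equiv.Perm (Fin m)) :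
    pairingGen a ⟨n, m, (g.map φ).reorder τ⟩
      = ((Equiv.Perm.sign τ : ℤ) : ℝ) • pairingGen a ⟨n, m, g⟩ := by
  let _ := Fintype.ofFinite (V ≃ Fin n)
  by_cases h : m = k
  · subst h
    simp only [pairingGen, dif_pos, Fin.cast_eq_self, smul_eq_mul, Finset.mul_sum]
    -- An isomorphism to the relabelled graph followed by the inverse of `φ` is one to the original
    -- graph. The reordering permutes columns and produces the sign.
    refine Fintype.sum_equiv ((Equiv.refl V).equivCongr φ.symm) _ _ fun ψ => ?_
    rw [← matchSign_comp_right]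
    refine Eq.trans ?_ (matchSign_map (Sym2.map.injective φ.injective) _ _)
    congr 1
    funext i
    simp [Sym2.map_map, Equiv.equivCongr]
  · simp [pairingGen, h]

/-- The functional `x ↦ ` signed number of isomorphisms from a sequence of edges. -/
noncomputable def pairing (a : Fin k → Sym2 V) : GraphSpace →ₗ[ℝ] ℝ :=
  relations.liftQ (Finsupp.linearCombination ℝ (pairingGen a))
    (relations_le_ker _ (pairingGen_relabel a))

theorem pairing_mk (a : Fin k → Sym2 V) (x : Generator) :
    pairing a (relations.mkQ (Finsupp.single x 1)) = pairingGen a x := by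
  change Finsupp.linearCombination ℝ (pairingGen a) (Finsupp.single x 1) = _
  simp

theorem pairing_cls [Fintype W] [Fintype (V ≃ W)] (a : Fin k → Sym2 V) (g : OrderedGraph W k) :
    pairing a g.cls = ∑ φ : V ≃ W, matchSign (fun i => (a i).map φ) g.edge := by
  let _ := Fintype.ofFinite (V ≃ Fin (Fintype.card W))
  rw [OrderedGraph.cls, pairing_mk]
  simp only [pairingGen, dif_pos, Fin.cast_eq_self]
  refine Fintype.sum_equiv ((Equiv.refl V).equivCongr (Fintype.equivFin W).symm) _ _ fun ψ => ?_
  rw [← matchSign_map (Sym2.map.injective (Fintype.equivFin W).injective)]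
  congr 1
  funext i
  simp [Sym2.map_map, Equiv.equivCongr, Function.comp_def]

theorem pairing_cls_of_ne [Fintype W] {m : ℕ} (a : Fin k → Sym2 V) (g : OrderedGraph W m)
    (h : m ≠ k) : pairing a g.cls = 0 := by
  rw [OrderedGraph.cls, pairing_mk]
  simp [pairingGen, h]

theorem cls_induction {p : GraphSpace → Prop} (x : GraphSpace) (h0 : p 0)
    (hadd : ∀ x y, p x → p y → p (x + y)) (hsmul : ∀ (c : ℝ) x, p x → p (c • x))
    (hcls : ∀ (n m : ℕ) (g : OrderedGraph (Fin n) m), p g.cls) : p x := by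
  obtain ⟨y, rfl⟩ := relations.mkQ_surjective x
  induction y using Finsupp.induction_linear with
  | zero => simpa using h0
  | add f g hf hg => rw [map_add]; exact hadd _ _ hf hg
  | single a b =>
    obtain ⟨n, m, g⟩ := a
    have : (Finsupp.single (⟨n, m, g⟩ : Generator) b)
        = b • Finsupp.single (⟨n, m, g⟩ : Generator) (1 : ℝ) := by simp
    rw [this, map_smul]
    apply hsmul
    have h := cls_eq g (Equiv.refl _)
    have e : g.map (Equiv.refl _) = g := by
      ext i : 2
      simp [OrderedGraph.map]
    rw [e] at h
    rw [← h]
    exact hcls n m g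

theorem linearMap_ext_cls {M : Type*} [AddCommGroup M] [Module ℝ M] {f g : GraphSpace →ₗ[ℝ] M}
    (h : ∀ (n m : ℕ) (G : OrderedGraph (Fin n) m), f G.cls = g G.cls) : f = g := by
  ext1
  refine LinearMap.ext fun y => ?_
  refine cls_induction (p := fun x => f x = g x) (relations.mkQ y) (by simp) ?_ ?_ h
  · intro x y hx hy; rw [map_add, map_add, hx, hy]
  · intro c x hx; rw [map_smul, map_smul, hx]

theorem pairing_comp_perm (a : Fin k → Sym2 V) (τ : Equiv.Perm (Fin k)) :
    pairing (a ∘ τ) = ((Equiv.Perm.sign τ : ℤ) : ℝ) • pairing a := by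
  refine linearMap_ext_cls fun n m G => ?_
  by_cases h : m = k
  · subst h
    let _ := Fintype.ofFinite (V ≃ Fin n)
    rw [LinearMap.smul_apply, pairing_cls, pairing_cls, smul_eq_mul, Finset.mul_sum]
    refine Finset.sum_congr rfl fun φ _ => ?_
    rw [← matchSign_comp_left]
    rfl
  · rw [LinearMap.smul_apply, pairing_cls_of_ne _ _ h, pairing_cls_of_ne _ _ h, smul_zero]

theorem pairing_map_equiv (a : Fin k → Sym2 V) (e : V ≃ W) :
    pairing (fun i => (a i).map e) = pairing a := by
  refine linearMap_ext_cls fun n m G => ?_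
  by_cases h : m = k
  · subst h
    let _ := Fintype.ofFinite (V ≃ Fin n)
    let _ := Fintype.ofFinite (W ≃ Fin n)
    rw [pairing_cls, pairing_cls]
    refine Fintype.sum_equiv (e.symm.equivCongr (Equiv.refl _)) _ _ fun ψ => ?_
    congr 1
    funext i
    simp [Sym2.map_map, Equiv.equivCongr, Function.comp_def]
  · rw [pairing_cls_of_ne _ _ h, pairing_cls_of_ne _ _ h]

/-- Two surjections with the same fibres identify the vertices in the same way. -/
theorem exists_equiv_of_ker {U : Type} {q : U → V} {r : U → W} (hq : q.Surjective)
    (hr : r.Surjective) (h : ∀ x y, q x = q y ↔ r x = r y) : ∃ e : V ≃ W, ∀ x, e (q x) = r x := by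
  choose s hs using hq
  have key : ∀ x, r (s (q x)) = r x := fun x => (h _ _).1 (hs _)
  refine ⟨Equiv.ofBijective (fun v => r (s v)) ⟨fun v w hvw => ?_, fun w => ?_⟩, key⟩
  · have := (h _ _).2 hvw
    rwa [hs, hs] at this
  · obtain ⟨x, rfl⟩ := hr w
    exact ⟨q x, key x⟩

/-- A loop never matches an edge of a loopless graph. Loops have to be admitted in the sequence
because contractions create them. -/
theorem pairing_eq_zero_of_isDiag (a : Fin k → Sym2 V) (i : Fin k) (h : (a i).IsDiag) :
    pairing a = 0 := by
  refine linearMap_ext_cls fun n m G => ?_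
  by_cases hk : m = k
  · subst hk
    let _ := Fintype.ofFinite (V ≃ Fin n)
    rw [pairing_cls]
    refine Finset.sum_eq_zero fun φ _ => matchSign_eq_zero i fun j hj => G.loopless j ?_
    rw [← hj]
    exact (Sym2.isDiag_map φ.injective).2 h
  · rw [pairing_cls_of_ne _ _ hk]
    rfl

end Pairing

/-! ### Edge contractions and the bijections of vertices behind the two kinds of insertion. -/

section Contraction

variable {V W : Type} {k n : ℕ}

/-- The equivalence relation that identifies the two ends of an edge. -/
def contractSetoid (e : Sym2 V) : Setoid V where
  r x y := x = y ∨ (x ∈ e ∧ y ∈ e)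
  iseqv := by
    refine ⟨fun x => Or.inl rfl, ?_, ?_⟩
    · rintro x y (rfl | h)
      · exact Or.inl rfl
      · exact Or.inr h.symm
    · rintro x y z (rfl | h) (rfl | h')
      · exact Or.inl rfl
      · exact Or.inr h'
      · exact Or.inr h
      · exact Or.inr ⟨h.1, h'.2⟩

/-- `q` contracts the edge `e` and does nothing else. -/
structure IsContraction (e : Sym2 V) (q : V → W) : Prop where
  surj : q.Surjective
  ker : ∀ x y, q x = q y ↔ x = y ∨ (x ∈ e ∧ y ∈ e)

theorem isContraction_mk (e : Sym2 V) :
    IsContraction e (Quotient.mk (contractSetoid e)) where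
  surj := Quotient.mk_surjective
  ker _ _ := Quotient.eq

/-- The number of ends of `e` that lie on no edge of the list `l`. -/
noncomputable def freeEnds (e : Sym2 V) (l : List (Sym2 V)) : ℝ :=
  ({v | v ∈ e ∧ ∀ e' ∈ l, v ∉ e'} : Set V).ncard

open Classical in
theorem freeEnds_mk {a b : V} (hab : a ≠ b) (l : List (Sym2 V)) :
    freeEnds s(a, b) l = (if ∀ e ∈ l, a ∉ e then 1 else 0) + (if ∀ e ∈ l, b ∉ e then 1 else 0) := by
  unfold freeEnds
  have h : ({v | v ∈ s(a, b) ∧ ∀ e' ∈ l, v ∉ e'} : Set V)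
      = {v | v = a ∧ ∀ e ∈ l, a ∉ e} ∪ {v | v = b ∧ ∀ e ∈ l, b ∉ e} := by
    ext v
    simp only [Sym2.mem_iff, Set.mem_ofPred_eq, Set.mem_union]
    constructor
    · rintro ⟨rfl | rfl, h⟩
      · exact Or.inl ⟨rfl, h⟩
      · exact Or.inr ⟨rfl, h⟩
    · rintro (⟨rfl, h⟩ | ⟨rfl, h⟩)
      · exact ⟨Or.inl rfl, h⟩
      · exact ⟨Or.inr rfl, h⟩
  have hfin : ∀ (c : V) (p : Prop), ({v | v = c ∧ p} : Set V).Finite := fun c p =>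
    (Set.finite_singleton c).subset fun v hv => hv.1
  have hc : ∀ (c : V) (p : Prop) [Decidable p], (({v | v = c ∧ p} : Set V).ncard : ℝ) = if p then 1 else 0 := by
    intro c p _
    by_cases hp : p <;> simp [hp]
  have hd : Disjoint {v | v = a ∧ ∀ e ∈ l, a ∉ e} {v | v = b ∧ ∀ e ∈ l, b ∉ e} := by
    rw [Set.disjoint_left]
    rintro v ⟨rfl, -⟩ ⟨h, -⟩
    exact hab h
  rw [h, Set.ncard_union_eq hd (hfin _ _) (hfin _ _), Nat.cast_add, hc, hc]

/-- The image of `a` under the collapse is `v`, and outside the inserted edge the collapse is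
injective. So nothing is lost by collapsing, once the images of `a` and `b` are prescribed. -/
theorem insVertex_ext {v w : Fin n} {φ : V ≃ InsVertex (Fin 2) v} {ψ : V ≃ InsVertex (Fin 2) w}
    {a b : V} (h₁ : φ a = Sum.inr 0 ∧ φ b = Sum.inr 1) (h₂ : ψ a = Sum.inr 0 ∧ ψ b = Sum.inr 1)
    (h : collapse (Fin 2) v ∘ φ = collapse (Fin 2) w ∘ ψ) :
    (⟨v, φ⟩ : Σ v : Fin n, V ≃ InsVertex (Fin 2) v) = ⟨w, ψ⟩ := by
  have hv : v = w := by
    have := congrFun h a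
    simpa [h₁.1, h₂.1, collapse] using this
  subst hv
  congr 1
  ext x : 1
  have hx := congrFun h x
  simp only [Function.comp_apply] at hx
  have aux : ∀ (φ ψ : V ≃ InsVertex (Fin 2) v), φ a = Sum.inr 0 ∧ φ b = Sum.inr 1 →
      ψ a = Sum.inr 0 ∧ ψ b = Sum.inr 1 → ∀ i, φ x = Sum.inr i → φ x = ψ x := by
    intro φ ψ h₁ h₂ i hi
    fin_cases i
    · have : x = a := φ.injective (hi.trans h₁.1.symm)
      rw [this, h₁.1, h₂.1]
    · have : x = b := φ.injective (hi.trans h₁.2.symm)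
      rw [this, h₁.2, h₂.2]
  rcases hφ : φ x with y | i
  · rcases hψ : ψ x with z | j
    · rw [hφ, hψ] at hx
      exact congrArg Sum.inl (Subtype.ext hx)
    · rw [← hφ, ← hψ, aux ψ φ h₂ h₁ j hψ]
  · rw [← hφ, aux φ ψ h₁ h₂ i hφ]

/-- A labelling of the contracted vertices lifts: `v` is the label of the merged vertex, `a` and `b`
become the two ends of the inserted edge, and all other vertices keep their labels. -/
theorem exists_insVertex_equiv {a b : V} (hab : a ≠ b) {q : V → W}
    (hq : IsContraction s(a, b) q) (π : W ≃ Fin n) :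
    ∃ x : Σ v : Fin n, V ≃ InsVertex (Fin 2) v, (x.2 a = Sum.inr 0 ∧ x.2 b = Sum.inr 1) ∧
      collapse (Fin 2) x.1 ∘ x.2 = π ∘ q := by
  classical
  have hker : ∀ x, q x = q a ↔ x = a ∨ x = b := by
    intro x
    rw [hq.ker]
    simp only [Sym2.mem_iff]
    tauto
  have hba : q b = q a := (hker b).2 (Or.inr rfl)
  let f : V → InsVertex (Fin 2) (π (q a)) := fun x =>
    if hx : q x = q a then Sum.inr (if x = a then 0 else 1)
    else Sum.inl ⟨π (q x), fun h => hx (π.injective h)⟩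
  have hfa : f a = Sum.inr 0 := by simp [f]
  have hfb : f b = Sum.inr 1 := by simp [f, hba, hab.symm]
  have hcf : ∀ x, collapse (Fin 2) (π (q a)) (f x) = π (q x) := by
    intro x
    by_cases hx : q x = q a
    · simp [f, hx, collapse]
    · simp [f, hx, collapse]
  have hf : f.Bijective := by
    constructor
    · intro x y hxy
      have h := (hcf x).symm.trans ((congrArg _ hxy).trans (hcf y))
      have h' := π.injective h
      by_cases hx : q x = q a
      · have hy : q y = q a := h' ▸ hx
        rcases (hker x).1 hx with rfl | rfl <;> rcases (hker y).1 hy with rfl | rfl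
        · rfl
        · rw [hfa, hfb] at hxy; simp at hxy
        · rw [hfa, hfb] at hxy; simp at hxy
        · rfl
      · rcases (hq.ker x y).1 h' with h | h
        · exact h
        · exact absurd ((hker x).2 (Sym2.mem_iff.1 h.1)) hx
    · rintro (⟨w, hw⟩ | i)
      · obtain ⟨x, hx⟩ := hq.surj (π.symm w)
        have hxa : q x ≠ q a := by
          rw [hx]
          rintro h
          exact hw (by rw [← h]; simp)
        refine ⟨x, ?_⟩
        have hfx : f x = Sum.inl ⟨π (q x), fun h => hxa (π.injective h)⟩ := dif_neg hxa
        rw [hfx]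
        congr 2
        rw [hx, π.apply_symm_apply]
      · fin_cases i
        · exact ⟨a, hfa⟩
        · exact ⟨b, hfb⟩
  exact ⟨⟨π (q a), Equiv.ofBijective f hf⟩, ⟨hfa, hfb⟩, funext hcf⟩

/-- Conversely, collapsing identifies exactly `a` and `b`, so it factors through the contraction
`q`. -/
theorem exists_perm_of_insVertex {a b : V} {q : V → W}
    (hq : IsContraction s(a, b) q) {v : Fin n} (φ : V ≃ InsVertex (Fin 2) v)
    (h : φ a = Sum.inr 0 ∧ φ b = Sum.inr 1) :
    ∃ π : W ≃ Fin n, π ∘ q = collapse (Fin 2) v ∘ φ := by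
  have hr : Function.Surjective (collapse (Fin 2) v ∘ φ) := by
    intro w
    by_cases hw : w = v
    · exact ⟨a, by simp [h.1, collapse, hw]⟩
    · exact ⟨φ.symm (Sum.inl ⟨w, hw⟩), by simp [collapse]⟩
  suffices hk : ∀ x y, q x = q y ↔
      (collapse (Fin 2) v ∘ φ) x = (collapse (Fin 2) v ∘ φ) y by
    obtain ⟨π, hπ⟩ := exists_equiv_of_ker hq.surj hr hk
    exact ⟨π, funext hπ⟩
  intro x y
  rw [hq.ker]
  have hx : ∀ x, x ∈ s(a, b) ↔ ∃ i, φ x = Sum.inr i := by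
    intro x
    rw [Sym2.mem_iff]
    constructor
    · rintro (rfl | rfl)
      exacts [⟨_, h.1⟩, ⟨_, h.2⟩]
    · rintro ⟨i, hi⟩
      fin_cases i
      · exact Or.inl (φ.injective (hi.trans h.1.symm))
      · exact Or.inr (φ.injective (hi.trans h.2.symm))
  rw [hx, hx, ← φ.injective.eq_iff (a := x)]
  simp only [Function.comp_apply]
  generalize φ x = x', φ y = y'
  rcases x' with ⟨w, hw⟩ | i <;> rcases y' with ⟨z, hz⟩ | j
  · simp [collapse]
  · simp [collapse, hw]
  · simp [collapse, Ne.symm hz]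
  · simp [collapse]

-- By the three preceding lemmas, the pairs of a vertex `v` and a bijection with the inserted edge
-- in the prescribed position correspond to the labellings of the contracted vertex set.
open Classical in
theorem sum_insVertex {a b : V} (hab : a ≠ b) {q : V → W} (hq : IsContraction s(a, b) q)
    [Fintype (W ≃ Fin n)] [∀ v : Fin n, Fintype (V ≃ InsVertex (Fin 2) v)]
    (F : (V → Fin n) → ℝ) :
    ∑ v : Fin n, ∑ φ : V ≃ InsVertex (Fin 2) v,
      (if φ a = Sum.inr 0 ∧ φ b = Sum.inr 1 then F (collapse (Fin 2) v ∘ φ) else 0)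
      = ∑ π : W ≃ Fin n, F (π ∘ q) := by
  rw [Finset.sum_sigma', ← Finset.sum_filter]
  choose i hi₁ hi₂ using exists_insVertex_equiv (n := n) hab hq
  symm
  refine Finset.sum_bij (fun π _ => i π) ?_ ?_ ?_ ?_
  · intro π _
    simp [hi₁]
  · intro π _ π' _ h
    have : π ∘ q = π' ∘ q := by rw [← hi₂, ← hi₂, h]
    ext1 w
    obtain ⟨x, rfl⟩ := hq.surj w
    exact congrFun this x
  · rintro ⟨v, φ⟩ h
    have h' := (Finset.mem_filter.1 h).2
    obtain ⟨π, hπ⟩ := exists_perm_of_insVertex hq φ h'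
    exact ⟨π, Finset.mem_univ _, insVertex_ext (hi₁ π) h' ((hi₂ π).trans hπ)⟩
  · intro π _
    rw [hi₂]

/-- An unordered edge is matched with the inserted edge in two orientations, and each contributes
the sum over `π`. This is the origin of the factor 2 in the contraction formula. -/
theorem sum_insVertex_edge {a b : V} (hab : a ≠ b) {q : V → W} (hq : IsContraction s(a, b) q)
    [Fintype (W ≃ Fin n)] [∀ v : Fin n, Fintype (V ≃ InsVertex (Fin 2) v)]
    [∀ v : Fin n, DecidableEq (Sym2 (InsVertex (Fin 2) v))] (F : (V → Fin n) → ℝ) :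
    ∑ v : Fin n, ∑ φ : V ≃ InsVertex (Fin 2) v,
      (if s(a, b).map φ = s(Sum.inr 0, Sum.inr 1) then F (collapse (Fin 2) v ∘ φ) else 0)
      = 2 * ∑ π : W ≃ Fin n, F (π ∘ q) := by
  classical
  have hq' : IsContraction s(b, a) q := by rwa [Sym2.eq_swap]
  rw [two_mul]
  nth_rewrite 1 [← sum_insVertex hab hq F]
  rw [← sum_insVertex hab.symm hq' F, ← Finset.sum_add_distrib]
  refine Finset.sum_congr rfl fun v _ => ?_
  rw [← Finset.sum_add_distrib]
  refine Finset.sum_congr rfl fun φ _ => ?_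
  have h01 : (Sum.inr 0 : InsVertex (Fin 2) v) ≠ Sum.inr 1 := by simp
  rw [Sym2.map_mk, if_congr Sym2.eq_iff rfl rfl]
  by_cases h₁ : φ a = Sum.inr 0 ∧ φ b = Sum.inr 1
  · rw [if_pos (Or.inl h₁), if_pos h₁, if_neg, add_zero]
    rintro ⟨h, -⟩
    exact h01 (h.symm.trans h₁.2)
  · by_cases h₂ : φ b = Sum.inr 0 ∧ φ a = Sum.inr 1
    · rw [if_pos (Or.inr h₂.symm), if_neg h₁, if_pos h₂, zero_add]
    · rw [if_neg h₁, if_neg h₂, if_neg, add_zero]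
      rintro (h | h)
      · exact h₁ h
      · exact h₂ h.symm

/-- The extra vertex when a graph on `Fin n` is inserted into one end of an edge. -/
def extraVertex (n : ℕ) (v : Fin 2) : InsVertex (Fin n) v :=
  Sum.inl ⟨v + 1, by revert v; decide⟩

theorem insVertex_cases {v : Fin 2} (x : InsVertex (Fin n) v) :
    x = extraVertex n v ∨ ∃ y, x = Sum.inr y := by
  rcases x with ⟨w, hw⟩ | y
  · left
    have : w = v + 1 := by revert v w; decide
    subst this
    rfl
  · exact Or.inr ⟨y, rfl⟩

-- No edge inside the inserted graph touches the extra vertex, so a further edge at `b` has no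
-- match. Otherwise `φ` restricted to the vertices other than `b` is a labelling of the contracted
-- vertex set, in which `a` stands for the merged vertex.
open Classical in
theorem sum_extraVertex {a b : V} (hab : a ≠ b) {q : V → W} (hq : IsContraction s(a, b) q)
    {v : Fin 2} [Fintype (W ≃ Fin n)] [Fintype (V ≃ InsVertex (Fin n) v)]
    (c : Fin k → Sym2 V) (g : Fin k → Sym2 (Fin n)) :
    ∑ φ : V ≃ InsVertex (Fin n) v, (if φ b = extraVertex n v then
      matchSign (fun i => (c i).map φ) (fun i => (g i).map Sum.inr) else 0)
      = (if ∀ e ∈ List.ofFn c, b ∉ e then 1 else 0) *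
        ∑ π : W ≃ Fin n, matchSign (fun i => (c i).map (π ∘ q)) g := by
  by_cases hb : ∀ e ∈ List.ofFn c, b ∉ e
  swap
  · rw [if_neg hb, zero_mul]
    push Not at hb
    obtain ⟨e, he, hbe⟩ := hb
    obtain ⟨i, rfl⟩ := List.mem_ofFn.1 he
    refine Finset.sum_eq_zero fun φ _ => ?_
    split_ifs with h
    · refine matchSign_eq_zero i fun j hj => ?_
      have : φ b ∈ (c i).map φ := Sym2.mem_map.2 ⟨b, hbe, rfl⟩
      rw [hj, h] at this
      obtain ⟨y, -, hy⟩ := Sym2.mem_map.1 this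
      exact Sum.inr_ne_inl hy
    · rfl
  rw [if_pos hb, one_mul, ← Finset.sum_filter]
  have hker : ∀ x y, x ≠ b → y ≠ b → q x = q y → x = y := by
    intro x y hx hy h
    rcases (hq.ker x y).1 h with h | ⟨h, h'⟩
    · exact h
    · rw [Sym2.mem_iff] at h h'
      rw [h.resolve_right hx, h'.resolve_right hy]
  -- Every class of the contraction has a representative other than `b`; for the merged vertex it is
  -- `a`.
  have hne : ∀ w, ∃ x, x ≠ b ∧ q x = w := by
    intro w
    obtain ⟨x, rfl⟩ := hq.surj w
    by_cases hx : x = b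
    · exact ⟨a, hab, (hq.ker _ _).2 (Or.inr (by simp [hx]))⟩
    · exact ⟨x, hx, rfl⟩
  have hex : ∀ π : W ≃ Fin n, ∃ φ : V ≃ InsVertex (Fin n) v, φ b = extraVertex n v ∧
      ∀ x, x ≠ b → φ x = Sum.inr (π (q x)) := by
    intro π
    let f : V → InsVertex (Fin n) v := fun x => if x = b then extraVertex n v
      else Sum.inr (π (q x))
    have hf : f.Bijective := by
      constructor
      · intro x y hxy
        by_cases hx : x = b <;> by_cases hy : y = b
        · rw [hx, hy]
        · simp [f, hx, hy, extraVertex] at hxy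
        · simp [f, hx, hy, extraVertex] at hxy
        · simp only [f, if_neg hx, if_neg hy] at hxy
          exact hker x y hx hy (π.injective (Sum.inr_injective hxy))
      · intro y
        rcases insVertex_cases y with rfl | ⟨y, rfl⟩
        · exact ⟨b, if_pos rfl⟩
        · obtain ⟨x, hx, hxy⟩ := hne (π.symm y)
          refine ⟨x, ?_⟩
          simp only [f, if_neg hx, hxy, π.apply_symm_apply]
    exact ⟨Equiv.ofBijective f hf, if_pos rfl, fun x hx => if_neg hx⟩
  choose i hi₁ hi₂ using hex
  symm
  refine Finset.sum_bij (fun π _ => i π) ?_ ?_ ?_ ?_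
  · intro π _
    simp [hi₁]
  · intro π _ π' _ h
    ext1 w
    obtain ⟨x, hx, rfl⟩ := hne w
    have := hi₂ π x hx
    rw [h, hi₂ π' x hx] at this
    exact (Sum.inr_injective this).symm
  · intro φ hφ
    have hφ' := (Finset.mem_filter.1 hφ).2
    have hφ₂ : ∀ x, ∃ y, x ≠ b → φ x = Sum.inr y := by
      intro x
      by_cases hx : x = b
      · rcases insVertex_cases (φ a) with h | ⟨y, h⟩
        · exact absurd (φ.injective (h.trans hφ'.symm)) hab
        · exact ⟨y, fun h' => absurd hx h'⟩
      · rcases insVertex_cases (φ x) with h | ⟨y, h⟩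
        · exact absurd (φ.injective (h.trans hφ'.symm)) hx
        · exact ⟨y, fun _ => h⟩
    choose r hr using hφ₂
    choose s hs₁ hs₂ using hne
    have hsq : ∀ x, x ≠ b → s (q x) = x := fun x hx => hker _ _ (hs₁ _) hx (hs₂ _)
    have hπ : Function.Bijective fun w => r (s w) := by
      constructor
      · intro w w' h
        have : φ (s w) = φ (s w') := by
          rw [hr _ (hs₁ w), hr _ (hs₁ w')]
          exact congrArg Sum.inr h
        rw [← hs₂ w, φ.injective this, hs₂]
      · intro y
        have hy : φ.symm (Sum.inr y) ≠ b := by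
          intro h
          rw [← h, φ.apply_symm_apply] at hφ'
          exact Sum.inr_ne_inl hφ'
        refine ⟨q (φ.symm (Sum.inr y)), ?_⟩
        have := hr _ hy
        rw [φ.apply_symm_apply] at this
        simp only [hsq _ hy]
        exact (Sum.inr_injective this).symm
    refine ⟨Equiv.ofBijective _ hπ, Finset.mem_univ _, ?_⟩
    ext1 x
    by_cases hx : x = b
    · rw [hx, hi₁, hφ']
    · rw [hi₂ _ x hx, hr x hx]
      simp [hsq x hx]
  · intro π _
    rw [← matchSign_map (Sym2.map.injective (Sum.inr_injective (α := {w : Fin 2 // w ≠ v})))]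
    congr 1
    funext j
    rw [Function.comp_apply, Sym2.map_map]
    refine Sym2.map_congr fun x hx => ?_
    have hxb : x ≠ b := by
      rintro rfl
      exact hb _ (List.mem_ofFn.2 ⟨j, rfl⟩) hx
    rw [hi₂ π x hxb]
    rfl

end Contraction

/-! ### The two halves of the bracket, seen through the pairing. -/

section Adjunction

variable {V W : Type} {k n : ℕ}

theorem pairing_cls_cast [Fintype W] [Fintype (V ≃ W)] {m : ℕ} (a : Fin k → Sym2 V)
    (g : OrderedGraph W m) (h : m = k) :
    pairing a g.cls = ∑ φ : V ≃ W,
      matchSign (fun i => (a i).map φ) (fun j => g.edge (Fin.cast h.symm j)) := by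
  subst h
  exact pairing_cls a g

/-- The Laplace expansion selects the entry `a i` matched with the inserted edge. Summing over the
re-attachments collapses the other edges (`sum_matchSign_lift`), and summing over `v` and the
bijections yields the labellings of the contraction (`sum_insVertex_edge`). A loop cannot be matched
with the inserted edge. -/
theorem pairing_insertion_singleEdge (a : Fin (k + 1) → Sym2 V) (g : OrderedGraph (Fin n) k)
    {U : Fin (k + 1) → Type} (q : ∀ i, V → U i) (hq : ∀ i, IsContraction (a i) (q i)) :
    pairing a (insertion singleEdge g) = ∑ i : Fin (k + 1), (-1 : ℝ) ^ (i : ℕ) *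
      (open Classical in if (a i).IsDiag then 0
        else 2 * pairing (fun j => (a (i.succAbove j)).map (q i)) g.cls) := by
  classical
  let _ : ∀ v : Fin n, Fintype (V ≃ InsVertex (Fin 2) v) := fun v => Fintype.ofFinite _
  let _ : ∀ i, Fintype (U i ≃ Fin n) := fun v => Fintype.ofFinite _
  have h1 : ∀ (v : Fin n) (φ : V ≃ InsVertex (Fin 2) v) (h : Reattachment (Fin 2) g v),
      matchSign (fun i => (a i).map φ)
        (fun j => (insertAt singleEdge g v h).edge (Fin.cast (Nat.add_comm k 1) j))
      = ∑ i : Fin (k + 1), (-1 : ℝ) ^ (i : ℕ) *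
        ((if (a i).map φ = s(Sum.inr 0, Sum.inr 1) then 1 else 0) *
          matchSign (fun j => (a (i.succAbove j)).map φ) h.1) := by
    intro v φ h
    rw [matchSign_cons]
    refine Finset.sum_congr rfl fun i _ => ?_
    have e0 : (insertAt singleEdge g v h).edge (Fin.cast (Nat.add_comm k 1) (0 : Fin (k + 1)))
        = s(Sum.inr 0, Sum.inr 1) := by
      exact Fin.append_left (fun i => (singleEdge.edge i).map (Sum.inr : _ → InsVertex (Fin 2) v))
        h.1 (0 : Fin 1)
    have e1 : (fun j => (insertAt singleEdge g v h).edge (Fin.cast (Nat.add_comm k 1) j)) ∘ Fin.succ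
        = h.1 := by
      funext j
      have : Fin.cast (Nat.add_comm k 1) j.succ = Fin.natAdd 1 j := by
        ext
        simp [Nat.add_comm]
      simp only [insertAt, Function.comp_apply, this, Fin.append_right]
    rw [e0, e1]
    rfl
  simp only [insertion, map_sum]
  simp only [pairing_cls_cast _ _ (Nat.add_comm 1 k), h1]
  calc _ = ∑ i : Fin (k + 1), (-1 : ℝ) ^ (i : ℕ) *
        ∑ v : Fin n, ∑ φ : V ≃ InsVertex (Fin 2) v,
          (if (a i).map φ = s(Sum.inr 0, Sum.inr 1) then
            matchSign (fun j => (a (i.succAbove j)).map (collapse (Fin 2) v ∘ φ)) g.edge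
            else 0) := by
        simp only [Finset.mul_sum]
        rw [Finset.sum_comm' (t' := Finset.univ) (s' := fun _ => Finset.univ) (by simp)]
        refine Finset.sum_congr rfl fun v _ => ?_
        refine Finset.sum_comm.trans (Eq.trans ?_ Finset.sum_comm)
        refine Finset.sum_congr rfl fun φ _ => Finset.sum_comm.trans ?_
        refine Finset.sum_congr rfl fun i _ => ?_
        rw [← Finset.mul_sum, ← Finset.mul_sum, sum_matchSign_lift (Sym2.map (collapse (Fin 2) v))]
        congr 1
        split_ifs
        · rw [one_mul]
          congr 1
          funext j
          simp [Sym2.map_map]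
        · rw [zero_mul]
    _ = _ := by
        refine Finset.sum_congr rfl fun i _ => ?_
        congr 1
        have hi := hq i
        revert hi
        generalize q i = r
        generalize a i = e
        induction e with | _ x y =>
        intro hr
        by_cases hxy : x = y
        · subst hxy
          rw [if_pos (by simp)]
          refine Finset.sum_eq_zero fun v _ => Finset.sum_eq_zero fun φ _ => if_neg ?_
          rw [Sym2.map_mk, Sym2.eq_iff]
          rintro (⟨h, h'⟩ | ⟨h, h'⟩) <;> simpa using h.symm.trans h'
        · rw [if_neg (by simpa using hxy), pairing_cls]
          have := sum_insVertex_edge hxy hr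
            (fun ψ => matchSign (fun j => (a (i.succAbove j)).map ψ) g.edge)
          rw [this]
          simp only [Sym2.map_map]

/-- The edge of `•–•` is the last one, which explains the sign. It joins a vertex of `g` to an extra
vertex on no other edge, so each free end of the matched entry contributes once. The two ends of
`•–•` into which `g` can be inserted give equal sums, hence the factor 2. -/
theorem pairing_singleEdge_insertion (a : Fin (k + 1) → Sym2 V) (g : OrderedGraph (Fin n) k)
    {U : Fin (k + 1) → Type} (q : ∀ i, V → U i) (hq : ∀ i, IsContraction (a i) (q i)) :
    pairing a (insertion g singleEdge) = (-1) ^ k * ∑ i : Fin (k + 1), (-1 : ℝ) ^ (i : ℕ) *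
      (open Classical in if (a i).IsDiag then 0
        else 2 * freeEnds (a i) (List.ofFn fun j => a (i.succAbove j)) *
          pairing (fun j => (a (i.succAbove j)).map (q i)) g.cls) := by
  classical
  let _ : ∀ v : Fin 2, Fintype (V ≃ InsVertex (Fin n) v) := fun v => Fintype.ofFinite _
  let _ : ∀ i, Fintype (U i ≃ Fin n) := fun v => Fintype.ofFinite _
  have h1 : ∀ (v : Fin 2) (φ : V ≃ InsVertex (Fin n) v) (h : Reattachment (Fin n) singleEdge v),
      matchSign (fun i => (a i).map φ) (insertAt g singleEdge v h).edge
      = ∑ i : Fin (k + 1), (-1 : ℝ) ^ ((i : ℕ) + k) *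
        ((if (a i).map φ = h.1 0 then 1 else 0) *
          matchSign (fun j => (a (i.succAbove j)).map φ)
            (fun j => (g.edge j).map (Sum.inr : _ → InsVertex (Fin n) v))) := by
    intro v φ h
    rw [matchSign_snoc]
    refine Finset.sum_congr rfl fun i _ => ?_
    have e0 : (insertAt g singleEdge v h).edge (Fin.last k) = h.1 0 :=
      Fin.append_right (fun i => (g.edge i).map (Sum.inr : _ → InsVertex (Fin n) v)) h.1 (0 : Fin 1)
    have e1 : (insertAt g singleEdge v h).edge ∘ Fin.castSucc
        = fun j => (g.edge j).map (Sum.inr : _ → InsVertex (Fin n) v) := by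
      funext j
      exact Fin.append_left (fun i => (g.edge i).map (Sum.inr : _ → InsVertex (Fin n) v)) h.1 j
    rw [e0, e1]
    rfl
  have h2 : ∀ (v : Fin 2) (e : Sym2 (InsVertex (Fin n) v)),
      ∑ h : Reattachment (Fin n) singleEdge v, (if e = h.1 0 then (1 : ℝ) else 0)
        = if e.map (collapse (Fin n) v) = s(0, 1) then 1 else 0 := by
    intro v e
    split_ifs with he
    · rw [Finset.sum_eq_single ⟨fun _ => e, fun _ => he⟩]
      · simp
      · intro h _ hne
        rw [if_neg]
        rintro rfl
        exact hne (Subtype.ext (funext fun i => by rw [Subsingleton.elim i 0]))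
      · simp
    · refine Finset.sum_eq_zero fun h _ => if_neg ?_
      rintro rfl
      exact he (h.2 0)
  simp only [insertion, map_sum, pairing_cls, h1]
  calc _ = ∑ i : Fin (k + 1), (-1 : ℝ) ^ ((i : ℕ) + k) *
        ∑ v : Fin 2, ∑ φ : V ≃ InsVertex (Fin n) v,
          (if ((a i).map φ).map (collapse (Fin n) v) = s(0, 1) then
            matchSign (fun j => (a (i.succAbove j)).map φ)
              (fun j => (g.edge j).map (Sum.inr : _ → InsVertex (Fin n) v)) else 0) := by
        simp only [Finset.mul_sum]
        rw [Finset.sum_comm' (t' := Finset.univ) (s' := fun _ => Finset.univ) (by simp)]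
        refine Finset.sum_congr rfl fun v _ => ?_
        refine Finset.sum_comm.trans (Eq.trans ?_ Finset.sum_comm)
        refine Finset.sum_congr rfl fun φ _ => Finset.sum_comm.trans ?_
        refine Finset.sum_congr rfl fun i _ => ?_
        rw [← Finset.mul_sum, ← Finset.sum_mul, h2]
        congr 1
        split_ifs
        · rw [one_mul]
        · rw [zero_mul]
    _ = _ := by
        rw [Finset.mul_sum]
        refine Finset.sum_congr rfl fun i _ => ?_
        rw [pow_add, mul_comm ((-1 : ℝ) ^ (i : ℕ)), mul_assoc]
        congr 2
        have hi := hq i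
        revert hi
        generalize q i = r
        generalize a i = e
        -- In `Fin 2` the end of `•–•` other than `v` is `v + 1`. The extra vertex collapses to it,
        -- and the copy of `g` collapses to `v`.
        have hcol : ∀ (v : Fin 2) (x : InsVertex (Fin n) v),
            collapse (Fin n) v x = if x = extraVertex n v then v + 1 else v := by
          intro v x
          rcases insVertex_cases x with rfl | ⟨y, rfl⟩
          · rw [if_pos rfl]
            rfl
          · rw [if_neg (by simp [extraVertex])]
            rfl
        induction e with | _ x y =>
        intro hr
        by_cases hxy : x = y
        · subst hxy
          rw [if_pos (by simp)]
          refine Finset.sum_eq_zero fun v _ => Finset.sum_eq_zero fun φ _ => if_neg ?_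
          rw [Sym2.map_mk, Sym2.map_mk, Sym2.eq_iff]
          rintro (⟨h, h'⟩ | ⟨h, h'⟩) <;> simpa using h.symm.trans h'
        · have hr' : IsContraction s(y, x) r := by rwa [Sym2.eq_swap]
          have h01 : ∀ v : Fin 2, s(v + 1, v) = s((0 : Fin 2), 1) := by decide
          have h10 : ∀ v : Fin 2, s(v, v + 1) = s((0 : Fin 2), 1) := by decide
          have h00 : ∀ v : Fin 2, s(v, v) ≠ s((0 : Fin 2), 1) := by decide
          have key : ∀ v : Fin 2, ∑ φ : V ≃ InsVertex (Fin n) v,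
              (if (s(x, y).map φ).map (collapse (Fin n) v) = s(0, 1) then
                matchSign (fun j => (a (i.succAbove j)).map φ)
                  (fun j => (g.edge j).map (Sum.inr : _ → InsVertex (Fin n) v)) else 0)
              = freeEnds s(x, y) (List.ofFn fun j => a (i.succAbove j)) *
                pairing (fun j => (a (i.succAbove j)).map r) g.cls := by
            intro v
            rw [freeEnds_mk hxy, add_mul, add_comm, pairing_cls]
            simp only [Sym2.map_map]
            rw [← sum_extraVertex (v := v) hxy hr, ← sum_extraVertex (v := v) (Ne.symm hxy) hr',
              ← Finset.sum_add_distrib]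
            refine Finset.sum_congr rfl fun φ _ => ?_
            rw [Sym2.map_mk, Function.comp_apply, Function.comp_apply, hcol, hcol]
            have hne : ¬ (φ y = extraVertex n v ∧ φ x = extraVertex n v) := fun h =>
              hxy (φ.injective (h.2.trans h.1.symm))
            by_cases hy : φ y = extraVertex n v <;> by_cases hx : φ x = extraVertex n v
            · exact absurd ⟨hy, hx⟩ hne
            · simp [hx, hy, h10]
            · simp [hx, hy, h01]
            · simp [hx, hy, h00]
          rw [if_neg (by simpa using hxy)]
          simp only [key]
          simp [mul_assoc, pairing_cls]

end Adjunction

/-! ### Alternating sums over the entries of a list. -/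

section AltSum

variable {E F : Type*} {k : ℕ}

/-- The alternating sum over the entries of a list of a function of the entry and of the list of
the other entries. -/
def altSum (T : E → List E → ℝ) : List E → ℝ
  | [] => 0
  | e :: l => T e l - altSum (fun e' l' => T e' (e :: l')) l

theorem altSum_ofFn (T : E → List E → ℝ) (a : Fin (k + 1) → E) :
    altSum T (List.ofFn a) = ∑ i : Fin (k + 1), (-1 : ℝ) ^ (i : ℕ) *
      T (a i) (List.ofFn fun j => a (i.succAbove j)) := by
  induction k generalizing T with
  | zero => simp [altSum]
  | succ k ih =>
    rw [List.ofFn_succ, altSum, ih, Fin.sum_univ_succ (n := k + 1), sub_eq_add_neg,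
      ← Finset.sum_neg_distrib]
    congr 1
    · simp
    · refine Finset.sum_congr rfl fun i _ => ?_
      rw [List.ofFn_succ (f := fun j => a (i.succ.succAbove j))]
      simp [pow_succ]

theorem altSum_eq_zero {T : E → List E → ℝ} {l : List E}
    (h : ∀ l₁ e l₂, l = l₁ ++ e :: l₂ → T e (l₁ ++ l₂) = 0) : altSum T l = 0 := by
  induction l generalizing T with
  | nil => rfl
  | cons e l ih =>
    rw [altSum, show T e l = 0 from h [] e l rfl, ih, sub_zero]
    rintro l₁ e' l₂ rfl
    exact h (e :: l₁) e' l₂ rfl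

end AltSum

/-! ### Coefficients at lists of edges, and the differential as the dual of contraction. -/

section Coeff

variable {V W : Type} {k n : ℕ}

theorem map_refl (g : OrderedGraph V k) : g.map (Equiv.refl V) = g := by
  ext i : 2
  simp [OrderedGraph.map]

theorem d_cls (g : OrderedGraph (Fin n) k) :
    d g.cls = insertion singleEdge g - (-1 : ℝ) ^ k • insertion g singleEdge := by
  rw [d, cls_eq singleEdge (Equiv.refl _), cls_eq g (Equiv.refl _), map_refl, map_refl]
  change (Finsupp.linearCombination ℝ bracketLeft (Finsupp.single _ 1)) _ = _
  rw [Finsupp.linearCombination_single, one_smul]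
  change Finsupp.linearCombination ℝ (bracketGen _) (Finsupp.single _ 1) = _
  rw [Finsupp.linearCombination_single, one_smul, bracketGen, one_mul]

/-- The sign `(-1) ^ k` of the bracket cancels the one that arises from moving the edge to the last
place, so both insertions combine to the factor `1 - freeEnds`. An entry with exactly one free end
drops out: the leaves grown by inserting the edge into a vertex are removed by the other half of the
bracket. -/
theorem pairing_d (a : Fin (k + 1) → Sym2 V) {U : Fin (k + 1) → Type} (q : ∀ i, V → U i)
    (hq : ∀ i, IsContraction (a i) (q i)) (x : GraphSpace) :
    pairing a (d x) = ∑ i : Fin (k + 1), (-1 : ℝ) ^ (i : ℕ) *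
      (open Classical in if (a i).IsDiag then 0
        else 2 * (1 - freeEnds (a i) (List.ofFn fun j => a (i.succAbove j))) *
          pairing (fun j => (a (i.succAbove j)).map (q i)) x) := by
  classical
  refine cls_induction (p := fun x => pairing a (d x) = ∑ i : Fin (k + 1), (-1 : ℝ) ^ (i : ℕ) *
      (if (a i).IsDiag then 0
        else 2 * (1 - freeEnds (a i) (List.ofFn fun j => a (i.succAbove j))) *
          pairing (fun j => (a (i.succAbove j)).map (q i)) x)) x ?_ ?_ ?_ ?_
  · simp
  · intro x y hx hy
    rw [map_add, map_add, hx, hy, ← Finset.sum_add_distrib]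
    refine Finset.sum_congr rfl fun i _ => ?_
    split_ifs
    · simp
    · rw [map_add]
      ring
  · intro c x hx
    rw [map_smul, map_smul, hx, smul_eq_mul, Finset.mul_sum]
    refine Finset.sum_congr rfl fun i _ => ?_
    split_ifs
    · simp
    · rw [map_smul, smul_eq_mul]
      ring
  · intro n m g
    by_cases hm : m = k
    · subst hm
      rw [d_cls, map_sub, map_smul, pairing_insertion_singleEdge a g q hq,
        pairing_singleEdge_insertion a g q hq, smul_eq_mul, ← mul_assoc, ← mul_pow]
      rw [show (-1 : ℝ) * -1 = 1 by norm_num, one_pow, one_mul, ← Finset.sum_sub_distrib]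
      refine Finset.sum_congr rfl fun i _ => ?_
      split_ifs
      · simp
      · ring
    · have h1 : pairing a (insertion singleEdge g) = 0 := by
        simp only [insertion, map_sum]
        exact Finset.sum_eq_zero fun v _ => Finset.sum_eq_zero fun h _ =>
          pairing_cls_of_ne _ _ (by omega)
      have h2 : pairing a (insertion g singleEdge) = 0 := by
        simp only [insertion, map_sum]
        exact Finset.sum_eq_zero fun v _ => Finset.sum_eq_zero fun h _ =>
          pairing_cls_of_ne _ _ (by omega)
      rw [d_cls, map_sub, map_smul, h1, h2, smul_zero, sub_zero]
      symm
      refine Finset.sum_eq_zero fun i _ => ?_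
      rw [pairing_cls_of_ne _ _ hm]
      simp

/-- Every graph in `d x` contains the edge of `•–•`, so the empty sequence has nothing to match. -/
theorem pairing_zero_d (a : Fin 0 → Sym2 V) (x : GraphSpace) : pairing a (d x) = 0 := by
  have : (pairing a).comp d = 0 := by
    refine linearMap_ext_cls fun n m g => ?_
    rw [LinearMap.comp_apply, d_cls, map_sub, map_smul]
    simp only [insertion, map_sum]
    rw [Finset.sum_eq_zero fun v _ => Finset.sum_eq_zero fun h _ =>
        pairing_cls_of_ne _ _ (by omega),
      Finset.sum_eq_zero fun v _ => Finset.sum_eq_zero fun h _ =>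
        pairing_cls_of_ne _ _ (by omega)]
    simp
  exact LinearMap.congr_fun this x

/-- The signed count of a list of edges in an element of the graph complex: up to the number of
automorphisms, the coefficient. -/
noncomputable def coeff (x : GraphSpace) (l : List (Sym2 V)) : ℝ := pairing l.get x

theorem coeff_ofFn (x : GraphSpace) (a : Fin k → Sym2 V) : coeff x (List.ofFn a) = pairing a x := by
  have key : ∀ {m : ℕ} (h : m = k), pairing (fun i => a (Fin.cast h i)) = pairing a := by
    rintro _ rfl
    rfl
  rw [← key (List.length_ofFn (f := a)), coeff]
  congr 2
  funext i
  simp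
  rfl

theorem exists_ofFn (l : List (Sym2 V)) : ∃ a : Fin l.length → Sym2 V, l = List.ofFn a :=
  ⟨l.get, (List.ofFn_get l).symm⟩

@[simp] theorem coeff_zero (l : List (Sym2 V)) : coeff 0 l = 0 := map_zero _

@[simp] theorem coeff_add (x y : GraphSpace) (l : List (Sym2 V)) :
    coeff (x + y) l = coeff x l + coeff y l := map_add _ _ _

@[simp] theorem coeff_sub (x y : GraphSpace) (l : List (Sym2 V)) :
    coeff (x - y) l = coeff x l - coeff y l := map_sub _ _ _

@[simp] theorem coeff_smul (c : ℝ) (x : GraphSpace) (l : List (Sym2 V)) :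
    coeff (c • x) l = c * coeff x l := map_smul _ _ _

theorem coeff_sum {ι : Type*} (s : Finset ι) (x : ι → GraphSpace) (l : List (Sym2 V)) :
    coeff (∑ i ∈ s, x i) l = ∑ i ∈ s, coeff (x i) l := map_sum _ _ _

theorem coeff_map_equiv (x : GraphSpace) (e : V ≃ W) (l : List (Sym2 V)) :
    coeff x (l.map (Sym2.map e)) = coeff x l := by
  obtain ⟨a, ha⟩ := exists_ofFn l
  rw [ha, List.map_ofFn, coeff_ofFn, coeff_ofFn, ← pairing_map_equiv a e]
  rfl

/-- Only the partition of the vertices matters, not the names of the classes. An abstract quotient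
may thus be replaced by a concrete map, for instance one between types `Fin n`. -/
theorem coeff_map_of_ker {U : Type} (x : GraphSpace) {q : U → V} {r : U → W} (hq : q.Surjective)
    (hr : r.Surjective) (h : ∀ x y, q x = q y ↔ r x = r y) (l : List (Sym2 U)) :
    coeff x (l.map (Sym2.map q)) = coeff x (l.map (Sym2.map r)) := by
  obtain ⟨e, he⟩ := exists_equiv_of_ker hq hr h
  rw [← coeff_map_equiv x e, List.map_map]
  congr 2
  funext z
  rw [Function.comp_apply, Sym2.map_map]
  congr 1
  funext u
  exact he u

/-- The contribution of contracting the edge `e`, where `l` are the other edges. -/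
noncomputable def contractTerm (x : GraphSpace) (e : Sym2 V) (l : List (Sym2 V)) : ℝ :=
  open Classical in
  if e.IsDiag then 0
  else 2 * (1 - freeEnds e l) * coeff x (l.map (Sym2.map (Quotient.mk (contractSetoid e))))

theorem contractTerm_eq (x : GraphSpace) {e : Sym2 V} (he : ¬ e.IsDiag) {q : V → W}
    (hq : IsContraction e q) (l : List (Sym2 V)) :
    contractTerm x e l = 2 * (1 - freeEnds e l) * coeff x (l.map (Sym2.map q)) := by
  rw [contractTerm, if_neg he,
    coeff_map_of_ker x (isContraction_mk e).surj hq.surj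
      (fun u v => by rw [(isContraction_mk e).ker, hq.ker])]

/-- The differential is dual to edge contraction. -/
theorem coeff_d (x : GraphSpace) (l : List (Sym2 V)) :
    coeff (d x) l = altSum (contractTerm x) l := by
  obtain ⟨a, ha⟩ := exists_ofFn l
  rw [ha]
  clear ha
  revert a
  generalize l.length = m
  intro a
  rw [coeff_ofFn]
  cases m with
  | zero => rw [pairing_zero_d]; simp [altSum]
  | succ m =>
    rw [altSum_ofFn, pairing_d a _ (fun i => isContraction_mk (a i))]
    refine Finset.sum_congr rfl fun i _ => ?_
    rw [contractTerm]
    congr 2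
    rw [List.map_ofFn, coeff_ofFn]
    rfl

/-- A function of sequences that is alternating under transpositions changes its sign when two
neighbouring entries of a list are exchanged. -/
theorem apply_get_swap {E : Type*} (F : ∀ m, (Fin m → E) → ℝ)
    (hF : ∀ m (b : Fin m → E) (i j : Fin m), i ≠ j → F m (b ∘ Equiv.swap i j) = -F m b)
    (l₁ l₂ : List E) (a b : E) :
    F _ (l₁ ++ a :: b :: l₂).get = -F _ (l₁ ++ b :: a :: l₂).get := by
  set l := l₁ ++ b :: a :: l₂ with hl
  have hlen : l.length = l₁.length + l₂.length + 2 := by simp [hl]; omega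
  let i : Fin l.length := ⟨l₁.length, by omega⟩
  let j : Fin l.length := ⟨l₁.length + 1, by omega⟩
  have hij : i ≠ j := by simp [i, j]
  have h : l₁ ++ a :: b :: l₂ = List.ofFn (l.get ∘ Equiv.swap i j) := by
    apply List.ext_getElem
    · simp [hlen]
      omega
    · intro t h₁ h₂
      have ht : t < l.length := by simpa using h₂
      have hr : (List.ofFn (l.get ∘ Equiv.swap i j))[t] = l.get (Equiv.swap i j ⟨t, ht⟩) := by
        simp
      rw [hr]
      by_cases hti : t = l₁.length
      · subst hti
        have : Equiv.swap i j ⟨l₁.length, ht⟩ = j := Equiv.swap_apply_left _ _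
        rw [this, List.get_eq_getElem]
        simp [j, hl]
      · by_cases htj : t = l₁.length + 1
        · subst htj
          have : Equiv.swap i j ⟨l₁.length + 1, ht⟩ = i := Equiv.swap_apply_right _ _
          rw [this, List.get_eq_getElem]
          simp [i, hl]
        · rw [Equiv.swap_apply_of_ne_of_ne (by simpa [i] using hti) (by simpa [j] using htj),
            List.get_eq_getElem]
          by_cases hlt : t < l₁.length
          · simp [hl, hlt]
          · obtain ⟨s, rfl⟩ : ∃ s, t = l₁.length + (s + 2) := ⟨t - l₁.length - 2, by omega⟩
            simp [hl]
  have key : ∀ {m : ℕ} (c : Fin m → E), F _ (List.ofFn c).get = F m c := by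
    intro m c
    have : ∀ {m' : ℕ} (h : m' = m), F m' (fun i => c (Fin.cast h i)) = F m c := by
      rintro _ rfl
      rfl
    rw [← this (List.length_ofFn (f := c))]
    congr 1
    funext i
    simp
    rfl
  rw [h, key, hF _ _ _ _ hij]

theorem coeff_swap (x : GraphSpace) (l₁ l₂ : List (Sym2 V)) (a b : Sym2 V) :
    coeff x (l₁ ++ a :: b :: l₂) = -coeff x (l₁ ++ b :: a :: l₂) := by
  refine apply_get_swap (fun _ a => pairing a x) (fun m c i j hij => ?_) l₁ l₂ a b
  rw [pairing_comp_perm, Equiv.Perm.sign_swap hij]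
  simp

/-- The prefix `l₀` absorbs the head of the list in the `cons` case of the induction. The sign is
left open because only vanishing is transferred in this way; signs are tracked by `sortSign`. -/
theorem coeff_append_perm (x : GraphSpace) (l₀ : List (Sym2 V)) {l l' : List (Sym2 V)}
    (h : l.Perm l') : coeff x (l₀ ++ l) = coeff x (l₀ ++ l') ∨
      coeff x (l₀ ++ l) = -coeff x (l₀ ++ l') := by
  induction h generalizing l₀ with
  | nil => exact Or.inl rfl
  | cons a _ ih => simpa using ih (l₀ ++ [a])
  | swap a b l => exact Or.inr (coeff_swap x l₀ l b a)
  | trans _ _ ih₁ ih₂ =>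
    rcases ih₁ l₀ with h₁ | h₁ <;> rcases ih₂ l₀ with h₂ | h₂ <;> rw [h₁, h₂] <;> simp

theorem coeff_perm_eq_zero (x : GraphSpace) {l l' : List (Sym2 V)} (h : l.Perm l') :
    coeff x l = 0 ↔ coeff x l' = 0 := by
  rcases coeff_append_perm x [] h with h | h <;> simp only [List.nil_append] at h <;> simp [h]

theorem coeff_eq_zero_of_isDiag (x : GraphSpace) {l : List (Sym2 V)} {e : Sym2 V} (he : e ∈ l)
    (h : e.IsDiag) : coeff x l = 0 := by
  obtain ⟨i, rfl⟩ := List.mem_iff_get.1 he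
  rw [coeff, pairing_eq_zero_of_isDiag _ i h]
  rfl

/-- Exchanging two equal entries changes the sign of the coefficient and not the list. So
contractions with double edges do not contribute. -/
theorem coeff_eq_zero_of_not_nodup (x : GraphSpace) {l : List (Sym2 V)} (h : ¬ l.Nodup) :
    coeff x l = 0 := by
  rw [List.nodup_iff_injective_get, Function.Injective] at h
  push Not at h
  obtain ⟨i, j, hij, hne⟩ := h
  have key := pairing_comp_perm l.get (Equiv.swap i j)
  rw [Equiv.Perm.sign_swap hne] at key
  have e : l.get ∘ Equiv.swap i j = l.get := by
    funext t
    by_cases hi : t = i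
    · subst hi; simp only [Function.comp_apply, Equiv.swap_apply_left, hij]
    · by_cases hj : t = j
      · subst hj; simp only [Function.comp_apply, Equiv.swap_apply_right, hij]
      · simp only [Function.comp_apply, Equiv.swap_apply_of_ne_of_ne hi hj]
  rw [e] at key
  have := LinearMap.congr_fun key x
  rw [LinearMap.smul_apply] at this
  simp at this
  rw [coeff]
  linarith

theorem perm_of_matchSign_ne_zero {E : Type*} {a b : Fin k → E} (h : matchSign a b ≠ 0) :
    (List.ofFn a).Perm (List.ofFn b) := by
  classical
  rw [matchSign_eq_sum] at h
  obtain ⟨σ, -, hσ⟩ := Finset.exists_ne_zero_of_sum_ne_zero h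
  have hσ' : ∀ i, a (σ i) = b i := by
    by_contra hc
    exact hσ (if_neg hc)
  rw [show b = a ∘ σ from funext fun i => (hσ' i).symm]
  exact (Equiv.Perm.ofFn_comp_perm σ a).symm

/-- A nonzero sum over bijections has a nonzero summand, and a nonzero determinant has a nonzero
Leibniz term, which matches the edges. -/
theorem exists_equiv_of_coeff_cls_ne_zero [Fintype W] {l : List (Sym2 V)} {g : OrderedGraph W k}
    (h : coeff g.cls l ≠ 0) : ∃ φ : V ≃ W, (l.map (Sym2.map φ)).Perm (List.ofFn g.edge) := by
  classical
  let _ : Fintype (V ≃ W) := Fintype.ofFinite _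
  obtain ⟨a, ha⟩ := exists_ofFn l
  rw [ha] at h ⊢
  clear ha
  revert a
  generalize l.length = m
  intro a h
  rw [coeff_ofFn] at h
  by_cases hk : k = m
  · subst hk
    rw [pairing_cls] at h
    obtain ⟨φ, -, hφ⟩ := Finset.exists_ne_zero_of_sum_ne_zero h
    refine ⟨φ, ?_⟩
    rw [List.map_ofFn]
    exact perm_of_matchSign_ne_zero hφ
  · exact absurd (pairing_cls_of_ne a g hk) h

end Coeff

/-! ### The square of the differential is zero. -/

section DSquared

variable {E F : Type*}

theorem altSum_map (T : F → List F → ℝ) (f : E → F) (l : List E) :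
    altSum T (l.map f) = altSum (fun e l' => T (f e) (l'.map f)) l := by
  induction l generalizing T with
  | nil => rfl
  | cons e l ih => simp only [List.map_cons, altSum, ih]

theorem altSum_sub (T T' : E → List E → ℝ) (l : List E) :
    altSum (fun e l' => T e l' - T' e l') l = altSum T l - altSum T' l := by
  induction l generalizing T T' with
  | nil => simp [altSum]
  | cons e l ih =>
    simp only [altSum, ih]
    ring

theorem altSum_const_mul (c : ℝ) (T : E → List E → ℝ) (l : List E) :
    altSum (fun e l' => c * T e l') l = c * altSum T l := by
  induction l generalizing T with
  | nil => simp [altSum]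
  | cons e l ih =>
    simp only [altSum, ih]
    ring

theorem altSum_congr {T T' : E → List E → ℝ} {l : List E}
    (h : ∀ e l', l.Perm (e :: l') → T e l' = T' e l') : altSum T l = altSum T' l := by
  rw [← sub_eq_zero, ← altSum_sub]
  refine altSum_eq_zero ?_
  rintro l₁ e l₂ rfl
  rw [h _ _ List.perm_middle, sub_self]

/-- Deleting `e` before `e'` and deleting `e'` before `e` carry opposite signs, so a symmetric
summand cancels in pairs. -/
theorem altSum_altSum_eq_zero (D : E → E → List E → ℝ) (hD : ∀ e e' l, D e e' l = D e' e l)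
    (l : List E) : altSum (fun e l' => altSum (fun e' l'' => D e e' l'') l') l = 0 := by
  induction l generalizing D with
  | nil => rfl
  | cons e l ih =>
    have h : altSum (fun e' l' => altSum (fun e'' l'' => D e' e'' l'') (e :: l')) l
        = altSum (fun e' l' => D e e' l') l
          - altSum (fun e' l' => altSum (fun e'' l'' => D e' e'' (e :: l'')) l') l := by
      rw [← altSum_sub]
      refine altSum_congr fun e' l' _ => ?_
      rw [altSum, hD e']
    rw [altSum, h, ih (fun e' e'' l'' => D e' e'' (e :: l'')) fun _ _ _ => hD _ _ _]
    simp

variable {V W : Type}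

theorem freeEnds_perm (e : Sym2 V) {l l' : List (Sym2 V)} (h : l.Perm l') :
    freeEnds e l = freeEnds e l' := by
  simp only [freeEnds, h.mem_iff]

/-- Contracting two edges in succession. -/
noncomputable def contractTwice (x : GraphSpace) (e e' : Sym2 V) (l : List (Sym2 V)) : ℝ :=
  open Classical in
  if e.IsDiag then 0
  else (1 - freeEnds e (e' :: l)) *
    contractTerm x (e'.map (Quotient.mk (contractSetoid e)))
      (l.map (Sym2.map (Quotient.mk (contractSetoid e))))

-- The vertex that arises by merging the ends of `e` is free only if both ends of `e` are free. The
-- condition `¬ (v ∈ e ∧ c ∈ e)` accounts for the second end.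
open Classical in
theorem freeEnds_map {e : Sym2 V} {q : V → W} (hq : IsContraction e q) {c d : V} (hcd : q c ≠ q d)
    (l : List (Sym2 V)) :
    freeEnds s(q c, q d) (l.map (Sym2.map q)) =
      (if ∀ e' ∈ l, ∀ v ∈ e', v ≠ c ∧ ¬ (v ∈ e ∧ c ∈ e) then 1 else 0) +
      (if ∀ e' ∈ l, ∀ v ∈ e', v ≠ d ∧ ¬ (v ∈ e ∧ d ∈ e) then 1 else 0) := by
  rw [freeEnds_mk hcd]
  have h : ∀ c, (∀ e' ∈ l.map (Sym2.map q), q c ∉ e') ↔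
      ∀ e' ∈ l, ∀ v ∈ e', v ≠ c ∧ ¬ (v ∈ e ∧ c ∈ e) := by
    intro c
    simp only [List.mem_map, forall_exists_index, and_imp, forall_apply_eq_imp_iff₂, Sym2.mem_map,
      not_exists, not_and, hq.ker]
    refine forall₂_congr fun e' _ => forall₂_congr fun v _ => ?_
    tauto
  rw [if_congr (h c) rfl rfl, if_congr (h d) rfl rfl]

/-- In both orders the vertices are identified by the equivalence relation generated by the two
edges. The proof distinguishes which ends coincide. -/
theorem contract_contract_ker {V W W' U U' : Type} {a b c e : V} {q : V → W} {r : V → W'}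
    {q' : W → U} {r' : W' → U'} {t t' : Sym2 V} (hq : IsContraction t q) (hr : IsContraction t' r)
    (hq' : IsContraction (t'.map q) q') (hr' : IsContraction (t.map r) r')
    (ht : t = s(a, b)) (ht' : t' = s(c, e)) (u v : V) :
    (q' ∘ q) u = (q' ∘ q) v ↔ (r' ∘ r) u = (r' ∘ r) v := by
  subst ht ht'
  simp only [Function.comp_apply, hq'.ker, hr'.ker, Sym2.map_mk, Sym2.mem_iff, hq.ker, hr.ker]
  by_cases h1 : a = c <;> by_cases h2 : a = e <;> by_cases h3 : b = c <;> by_cases h4 : b = e <;> grind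

/-- Let `α`, `β`, `γ` be 1 or 0 according to whether `a`, `b`, `c` are off all edges of `l`. In the
first step `b` is not free, as the other edge meets it; in the second step the merged vertex is free
if both of its constituents are. The two products are `(1 - α) * (1 - α * β - γ)` and `(1 - γ) * (1
- γ * β - α)`, and both equal `(1 - α) * (1 - γ)`. -/
theorem contractTwice_of_adjacent (x : GraphSpace) {a b c : V} (hab : a ≠ b) (hbc : b ≠ c)
    (hac : a ≠ c) (l : List (Sym2 V)) :
    contractTwice x s(a, b) s(b, c) l = contractTwice x s(c, b) s(b, a) l := by
  classical
  have hq := isContraction_mk s(a, b)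
  have hr := isContraction_mk s(c, b)
  have h₁ : (Quotient.mk (contractSetoid s(a, b))) b ≠ (Quotient.mk (contractSetoid s(a, b))) c := by
    rw [Ne, hq.ker]
    simp [hbc, Ne.symm hbc, Ne.symm hac]
  have h₂ : (Quotient.mk (contractSetoid s(c, b))) b ≠ (Quotient.mk (contractSetoid s(c, b))) a := by
    rw [Ne, hr.ker]
    simp [hab, Ne.symm hab, hac]
  have hq' := isContraction_mk (s(b, c).map (Quotient.mk (contractSetoid s(a, b))))
  have hr' := isContraction_mk (s(b, a).map (Quotient.mk (contractSetoid s(c, b))))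
  rw [contractTwice, contractTwice, if_neg (by simpa using hab), if_neg (by simpa using hbc.symm),
    contractTerm_eq x (by simpa using h₁) hq', contractTerm_eq x (by simpa using h₂) hr',
    Sym2.map_mk, Sym2.map_mk, freeEnds_map hq h₁, freeEnds_map hr h₂, freeEnds_mk hab,
    freeEnds_mk hbc.symm, List.map_map, List.map_map]
  have hker : coeff x (l.map (Sym2.map (Quotient.mk (contractSetoid
        (s(b, c).map (Quotient.mk (contractSetoid s(a, b)))))) ∘
        Sym2.map (Quotient.mk (contractSetoid s(a, b)))))
      = coeff x (l.map (Sym2.map (Quotient.mk (contractSetoid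
        (s(b, a).map (Quotient.mk (contractSetoid s(c, b)))))) ∘
        Sym2.map (Quotient.mk (contractSetoid s(c, b))))) := by
    rw [Sym2.map_comp.symm, Sym2.map_comp.symm]
    refine coeff_map_of_ker x (hq'.surj.comp hq.surj) (hr'.surj.comp hr.surj) 
      (contract_contract_ker hq ?_ hq' ?_ rfl rfl) l
    · rw [Sym2.eq_swap (a := b)]
      exact hr
    · rw [Sym2.eq_swap (a := a)]
      exact hr'
  rw [Sym2.map_mk, Sym2.map_mk] at hker
  rw [hker]
  have e₁ : (∀ e' ∈ s(b, c) :: l, a ∉ e') ↔ ∀ e' ∈ l, a ∉ e' := by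
    simp [hab, hac]
  have e₂ : ¬ (∀ e' ∈ s(b, c) :: l, b ∉ e') := by simp
  have e₃ : (∀ e' ∈ s(b, a) :: l, c ∉ e') ↔ ∀ e' ∈ l, c ∉ e' := by
    simp [hbc.symm, hac.symm]
  have e₄ : ¬ (∀ e' ∈ s(b, a) :: l, b ∉ e') := by simp
  have e₅ : (∀ e' ∈ l, ∀ v ∈ e', v ≠ b ∧ ¬ (v ∈ s(a, b) ∧ b ∈ s(a, b))) ↔
      (∀ e' ∈ l, a ∉ e') ∧ ∀ e' ∈ l, b ∉ e' := by
    simp only [Sym2.mem_iff]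
    grind
  have e₆ : (∀ e' ∈ l, ∀ v ∈ e', v ≠ b ∧ ¬ (v ∈ s(c, b) ∧ b ∈ s(c, b))) ↔
      (∀ e' ∈ l, c ∉ e') ∧ ∀ e' ∈ l, b ∉ e' := by
    simp only [Sym2.mem_iff]
    grind
  have e₇ : (∀ e' ∈ l, ∀ v ∈ e', v ≠ c ∧ ¬ (v ∈ s(a, b) ∧ c ∈ s(a, b))) ↔ ∀ e' ∈ l, c ∉ e' := by
    simp only [Sym2.mem_iff]
    grind
  have e₈ : (∀ e' ∈ l, ∀ v ∈ e', v ≠ a ∧ ¬ (v ∈ s(c, b) ∧ a ∈ s(c, b))) ↔ ∀ e' ∈ l, a ∉ e' := by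
    simp only [Sym2.mem_iff]
    grind
  simp only [e₁, e₂, e₃, e₄, e₅, e₆, e₇, e₈]
  clear e₁ e₂ e₃ e₄ e₅ e₆ e₇ e₈ hker hq hr hq' hr' h₁ h₂
  split_ifs <;> first | ring1 | (exfalso; tauto)

/-- Contracting one edge does not affect the free ends of a disjoint edge, so the same two factors
occur in both orders. -/
theorem contractTwice_of_disjoint (x : GraphSpace) {a b c d : V} (hab : a ≠ b) (hcd : c ≠ d)
    (hac : a ≠ c) (had : a ≠ d) (hbc : b ≠ c) (hbd : b ≠ d) (l : List (Sym2 V)) :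
    contractTwice x s(a, b) s(c, d) l = contractTwice x s(c, d) s(a, b) l := by
  classical
  have hq := isContraction_mk s(a, b)
  have hr := isContraction_mk s(c, d)
  have h₁ : (Quotient.mk (contractSetoid s(a, b))) c ≠ (Quotient.mk (contractSetoid s(a, b))) d := by
    rw [Ne, hq.ker]
    simp [hcd, Ne.symm hac, Ne.symm hbc]
  have h₂ : (Quotient.mk (contractSetoid s(c, d))) a ≠ (Quotient.mk (contractSetoid s(c, d))) b := by
    rw [Ne, hr.ker]
    simp [hab, hac, had]
  have hq' := isContraction_mk (s(c, d).map (Quotient.mk (contractSetoid s(a, b))))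
  have hr' := isContraction_mk (s(a, b).map (Quotient.mk (contractSetoid s(c, d))))
  rw [contractTwice, contractTwice, if_neg (by simpa using hab), if_neg (by simpa using hcd),
    contractTerm_eq x (by simpa using h₁) hq', contractTerm_eq x (by simpa using h₂) hr',
    Sym2.map_mk, Sym2.map_mk, freeEnds_map hq h₁, freeEnds_map hr h₂, freeEnds_mk hab,
    freeEnds_mk hcd, List.map_map, List.map_map]
  have hker : coeff x (l.map (Sym2.map (Quotient.mk (contractSetoid
        (s(c, d).map (Quotient.mk (contractSetoid s(a, b)))))) ∘
        Sym2.map (Quotient.mk (contractSetoid s(a, b)))))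
      = coeff x (l.map (Sym2.map (Quotient.mk (contractSetoid
        (s(a, b).map (Quotient.mk (contractSetoid s(c, d)))))) ∘
        Sym2.map (Quotient.mk (contractSetoid s(c, d))))) := by
    rw [Sym2.map_comp.symm, Sym2.map_comp.symm]
    refine coeff_map_of_ker x (hq'.surj.comp hq.surj) (hr'.surj.comp hr.surj) 
      (contract_contract_ker hq hr hq' hr' rfl rfl) l
  rw [Sym2.map_mk, Sym2.map_mk] at hker
  rw [hker]
  have e₁ : (∀ e' ∈ s(c, d) :: l, a ∉ e') ↔ ∀ e' ∈ l, a ∉ e' := by simp [hac, had]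
  have e₂ : (∀ e' ∈ s(c, d) :: l, b ∉ e') ↔ ∀ e' ∈ l, b ∉ e' := by simp [hbc, hbd]
  have e₃ : (∀ e' ∈ s(a, b) :: l, c ∉ e') ↔ ∀ e' ∈ l, c ∉ e' := by simp [hac.symm, hbc.symm]
  have e₄ : (∀ e' ∈ s(a, b) :: l, d ∉ e') ↔ ∀ e' ∈ l, d ∉ e' := by simp [had.symm, hbd.symm]
  have e₅ : ∀ u, u ≠ a → u ≠ b → ((∀ e' ∈ l, ∀ v ∈ e', v ≠ u ∧ ¬ (v ∈ s(a, b) ∧ u ∈ s(a, b))) ↔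
      ∀ e' ∈ l, u ∉ e') := by
    simp only [Sym2.mem_iff]
    grind
  have e₆ : ∀ u, u ≠ c → u ≠ d → ((∀ e' ∈ l, ∀ v ∈ e', v ≠ u ∧ ¬ (v ∈ s(c, d) ∧ u ∈ s(c, d))) ↔
      ∀ e' ∈ l, u ∉ e') := by
    simp only [Sym2.mem_iff]
    grind
  simp only [e₁, e₂, e₃, e₄, e₅ c hac.symm hbc.symm, e₅ d had.symm hbd.symm, e₆ a hac had,
    e₆ b hbc hbd]
  ring

theorem contractTwice_comm (x : GraphSpace) (e e' : Sym2 V) (l : List (Sym2 V)) :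
    contractTwice x e e' l = contractTwice x e' e l := by
  by_cases he : e.IsDiag
  · rw [contractTwice, if_pos he, contractTwice]
    split_ifs
    · rfl
    · rw [contractTerm, if_pos, mul_zero]
      induction e with | _ a b =>
      simp only [Sym2.mk_isDiag_iff] at he
      simp [he]
  by_cases he' : e'.IsDiag
  · rw [contractTwice, if_neg he, contractTwice, if_pos he']
    rw [contractTerm, if_pos, mul_zero]
    induction e' with | _ a b =>
    simp only [Sym2.mk_isDiag_iff] at he'
    simp [he']
  induction e with | _ a b =>
  induction e' with | _ c d =>
  simp only [Sym2.mk_isDiag_iff] at he he'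
  by_cases hac : a = c
  · subst hac
    by_cases hbd : b = d
    · rw [hbd]
    · have := contractTwice_of_adjacent x (Ne.symm he) he' hbd l
      rwa [Sym2.eq_swap (a := b), Sym2.eq_swap (a := d)] at this
  by_cases had : a = d
  · subst had
    by_cases hbc : b = c
    · rw [hbc, Sym2.eq_swap]
    · have := contractTwice_of_adjacent x (Ne.symm he) (Ne.symm he') hbc l
      rwa [Sym2.eq_swap (a := b), Sym2.eq_swap (a := a) (b := c)] at this
  by_cases hbc : b = c
  · subst hbc
    have := contractTwice_of_adjacent x he he' had l
    rwa [Sym2.eq_swap (a := d), Sym2.eq_swap (a := b) (b := a)] at this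
  by_cases hbd : b = d
  · subst hbd
    have := contractTwice_of_adjacent x he (Ne.symm he') hac l
    rwa [Sym2.eq_swap (a := b) (b := c), Sym2.eq_swap (a := b) (b := a)] at this
  exact contractTwice_of_disjoint x he he' hac had hbc hbd l

/-- Applying the contraction formula twice gives the iterated alternating sum of a summand that is
symmetric by `contractTwice_comm`. -/
theorem coeff_d_d (x : GraphSpace) (l : List (Sym2 V)) : coeff (d (d x)) l = 0 := by
  rw [coeff_d]
  have h : altSum (contractTerm (d x)) l
      = altSum (fun e l' => altSum (fun e' l'' => 2 * contractTwice x e e' l'') l') l := by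
    refine altSum_congr fun e l' _ => ?_
    rw [contractTerm]
    by_cases he : e.IsDiag
    · rw [if_pos he]
      symm
      refine altSum_eq_zero fun l₁ e' l₂ _ => ?_
      rw [contractTwice, if_pos he, mul_zero]
    · rw [if_neg he, coeff_d, altSum_map, ← altSum_const_mul]
      refine altSum_congr fun e' l'' hl => ?_
      rw [contractTwice, if_neg he, freeEnds_perm e hl, mul_assoc]
  rw [h]
  exact altSum_altSum_eq_zero (fun e e' l => 2 * contractTwice x e e' l)
    (fun e e' l => by rw [contractTwice_comm]) l

end DSquared

/-! ### Elements of the graph space are recovered from their coefficients. -/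

section Average

variable {n k m : ℕ}

instance (V : Type) [Finite V] (k : ℕ) : Finite (OrderedGraph V k) :=
  Finite.of_injective OrderedGraph.edge fun _ _ h => OrderedGraph.ext h

/-- For each permutation `σ` of the edges exactly one `h` is matched, namely `g` transported back
along `φ` and reordered. Its class is the sign of `σ` times that of `g`, and this sign cancels the
one in the matching. Each of the `k !` permutations thus contributes `g.cls`. -/
theorem sum_matchSign_smul_cls [Fintype (OrderedGraph (Fin n) k)] (φ : Fin n ≃ Fin n)
    (g : OrderedGraph (Fin n) k) :
    ∑ h : OrderedGraph (Fin n) k, matchSign (fun i => (h.edge i).map φ) g.edge • h.cls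
      = (k.factorial : ℝ) • g.cls := by
  classical
  simp only [matchSign_eq_sum, Finset.sum_smul]
  rw [Finset.sum_comm]
  have key : ∀ σ : Equiv.Perm (Fin k), ∑ h : OrderedGraph (Fin n) k,
      (if ∀ i, (h.edge (σ i)).map φ = g.edge i then ((Equiv.Perm.sign σ : ℤ) : ℝ) else 0) • h.cls
        = g.cls := by
    intro σ
    rw [Finset.sum_eq_single ((g.map φ.symm).reorder σ⁻¹)]
    · have hp : ∀ i, (((g.map φ.symm).reorder σ⁻¹).edge (σ i)).map φ = g.edge i := by
        intro i
        change ((g.edge (σ⁻¹ (σ i))).map φ.symm).map φ = g.edge i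
        rw [Sym2.map_map]
        simp
      rw [if_pos hp, cls_reorder, cls_map, smul_smul, Equiv.Perm.sign_inv]
      have h1 : ((Equiv.Perm.sign σ : ℤ) : ℝ) * ((Equiv.Perm.sign σ : ℤ) : ℝ) = 1 := by
        rcases Int.units_eq_one_or (Equiv.Perm.sign σ) with h | h <;> simp [h]
      rw [h1, one_smul]
    · intro h _ hne
      rw [if_neg, zero_smul]
      intro hh
      apply hne
      ext i : 2
      change h.edge i = (g.edge (σ⁻¹ i)).map φ.symm
      rw [← hh, Sym2.map_map]
      simp
    · simp
  trans ∑ _ : Equiv.Perm (Fin k), g.cls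
  · refine Finset.sum_congr rfl fun σ _ => ?_
    convert key σ
  · rw [Finset.sum_const, Finset.card_univ, Fintype.card_perm, Fintype.card_fin,
      Nat.cast_smul_eq_nsmul]

/-- The projection to the part with `n` vertices and `k` edges. -/
noncomputable def homogeneousPart (n k : ℕ) : GraphSpace →ₗ[ℝ] GraphSpace :=
  let _ : Fintype (OrderedGraph (Fin n) k) := Fintype.ofFinite _
  ((n.factorial * k.factorial : ℕ) : ℝ)⁻¹ •
    ∑ g : OrderedGraph (Fin n) k, (pairing g.edge).smulRight g.cls

/-- There are `n !` bijections of vertices, and each contributes `k !` copies of the class; the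
normalisation removes both factors. -/
theorem homogeneousPart_cls (g : OrderedGraph (Fin n) k) : homogeneousPart n k g.cls = g.cls := by
  let _ : Fintype (OrderedGraph (Fin n) k) := Fintype.ofFinite _
  have h : ∑ h : OrderedGraph (Fin n) k, pairing h.edge g.cls • h.cls
      = ((n.factorial * k.factorial : ℕ) : ℝ) • g.cls := by
    simp only [pairing_cls, Finset.sum_smul]
    rw [Finset.sum_comm, Finset.sum_congr rfl fun φ _ => sum_matchSign_smul_cls φ g,
      Finset.sum_const, Finset.card_univ, Fintype.card_equiv (Equiv.refl _), Fintype.card_fin,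
      ← Nat.cast_smul_eq_nsmul ℝ, smul_smul, Nat.cast_mul]
  simp only [homogeneousPart, LinearMap.smul_apply, LinearMap.sum_apply,
    LinearMap.smulRight_apply]
  rw [h, smul_smul, inv_mul_cancel₀, one_smul]
  exact_mod_cast (Nat.mul_pos n.factorial_pos k.factorial_pos).ne'

theorem homogeneousPart_cls_of_ne {m l : ℕ} (g : OrderedGraph (Fin m) l) (h : (m, l) ≠ (n, k)) :
    homogeneousPart n k g.cls = 0 := by
  simp only [homogeneousPart, LinearMap.smul_apply, LinearMap.sum_apply,
    LinearMap.smulRight_apply]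
  rw [Finset.sum_eq_zero, smul_zero]
  intro g' _
  rw [show pairing g'.edge g.cls = 0 from ?_, zero_smul]
  by_cases hl : l = k
  · subst hl
    rw [pairing_cls]
    refine Finset.sum_eq_zero fun φ _ => absurd ?_ h
    rw [show n = m by simpa using Fintype.card_congr φ]
  · exact pairing_cls_of_ne _ _ hl

theorem exists_sum_homogeneousPart (x : GraphSpace) :
    ∃ S : Finset (ℕ × ℕ), ∀ T, S ⊆ T → ∑ p ∈ T, homogeneousPart p.1 p.2 x = x := by
  classical
  refine cls_induction (p := fun x => ∃ S : Finset (ℕ × ℕ), ∀ T, S ⊆ T →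
    ∑ p ∈ T, homogeneousPart p.1 p.2 x = x) x ⟨∅, by simp⟩ ?_ ?_ ?_
  · rintro x y ⟨S, hS⟩ ⟨S', hS'⟩
    refine ⟨S ∪ S', fun T hT => ?_⟩
    simp only [map_add, Finset.sum_add_distrib]
    rw [hS T (Finset.union_subset_left hT), hS' T (Finset.union_subset_right hT)]
  · rintro c x ⟨S, hS⟩
    refine ⟨S, fun T hT => ?_⟩
    simp only [map_smul, ← Finset.smul_sum]
    rw [hS T hT]
  · intro n k g
    refine ⟨{(n, k)}, fun T hT => ?_⟩
    rw [Finset.sum_eq_single_of_mem (n, k) (by simpa using hT), homogeneousPart_cls]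
    intro p _ hp
    exact homogeneousPart_cls_of_ne g hp.symm

/-- By the averaging formula `x` is a combination of the classes of those graphs at which its
coefficient does not vanish. With `M` the zero subspace this says that coefficients separate points.
-/
theorem mem_of_coeff {M : Submodule ℝ GraphSpace} {x : GraphSpace}
    (h : ∀ (n k : ℕ) (g : OrderedGraph (Fin n) k), coeff x (List.ofFn g.edge) ≠ 0 → g.cls ∈ M) :
    x ∈ M := by
  obtain ⟨S, hS⟩ := exists_sum_homogeneousPart x
  rw [← hS S subset_rfl]
  refine M.sum_mem fun p _ => ?_
  simp only [homogeneousPart, LinearMap.smul_apply, LinearMap.sum_apply,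
    LinearMap.smulRight_apply]
  refine M.smul_mem _ (M.sum_mem fun g _ => ?_)
  by_cases hg : coeff x (List.ofFn g.edge) = 0
  · rw [coeff_ofFn] at hg
    simp [hg]
  · exact M.smul_mem _ (h _ _ g hg)

theorem eq_zero_of_coeff {x : GraphSpace}
    (h : ∀ (n : ℕ) (l : List (Sym2 (Fin n))), coeff x l = 0) : x = 0 := by
  rw [← Submodule.mem_bot ℝ]
  exact mem_of_coeff fun n k g hg => absurd (h n _) hg

theorem d_d (x : GraphSpace) : d (d x) = 0 :=
  eq_zero_of_coeff fun _ l => coeff_d_d x l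

end Average

/-! ### Connectedness and the differential. -/

section Connected

variable {V W : Type}

/-- No proper nonempty set of vertices is closed under the edges in the list `l`. -/
def ListConnected (l : List (Sym2 V)) : Prop :=
  ∀ S : Set V, (∀ a b, s(a, b) ∈ l → a ∈ S → b ∈ S) → S.Nonempty → S = Set.univ

theorem ListConnected.of_perm {l l' : List (Sym2 V)} (h : ListConnected l) (hl : l.Perm l') :
    ListConnected l' :=
  fun S hS => h S fun a b hab => hS a b (hl.mem_iff.1 hab)

theorem ListConnected.of_map_equiv {l : List (Sym2 V)} (φ : V ≃ W)
    (h : ListConnected (l.map (Sym2.map φ))) : ListConnected l := by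
  intro S hS hne
  have := h (φ '' S) ?_ (hne.image _)
  · refine Set.eq_univ_of_forall fun v => ?_
    obtain ⟨u, hu, huv⟩ := (Set.eq_univ_iff_forall.1 this) (φ v)
    exact φ.injective huv ▸ hu
  · rintro _ w hw ⟨u, hu, rfl⟩
    obtain ⟨b, rfl⟩ := φ.surjective w
    refine ⟨b, hS u b ?_ hu, rfl⟩
    rw [← Sym2.map_mk] at hw
    exact (List.mem_map_of_injective (Sym2.map.injective φ.injective)).1 hw

theorem toSimpleGraph_adj {k : ℕ} (g : OrderedGraph V k) (a b : V) :
    g.toSimpleGraph.Adj a b ↔ s(a, b) ∈ List.ofFn g.edge := by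
  rw [toSimpleGraph, SimpleGraph.fromEdgeSet_adj, List.mem_ofFn, Set.mem_range]
  refine and_iff_left_of_imp ?_
  rintro ⟨i, hi⟩ rfl
  exact g.loopless i (by simp [hi])

theorem listConnected_of_connected {k : ℕ} {g : OrderedGraph V k}
    (h : g.toSimpleGraph.Connected) : ListConnected (List.ofFn g.edge) := by
  intro S hS ⟨v, hv⟩
  refine Set.eq_univ_of_forall fun w => ?_
  obtain ⟨p⟩ := h.preconnected v w
  induction p with
  | nil => exact hv
  | cons hadj _ ih => exact ih (hS _ _ ((toSimpleGraph_adj g _ _).1 hadj) hv)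

theorem connected_of_listConnected {k : ℕ} [Nonempty V] {g : OrderedGraph V k}
    (h : ListConnected (List.ofFn g.edge)) : g.toSimpleGraph.Connected := by
  refine ⟨fun v w => ?_⟩
  have := h {u | g.toSimpleGraph.Reachable v u} ?_ ⟨v, SimpleGraph.Reachable.refl v⟩
  · exact (Set.eq_univ_iff_forall.1 this) w
  · intro a b hab ha
    exact ha.trans ((toSimpleGraph_adj g a b).2 hab).reachable

theorem exists_mem_coeff_ne_zero {S : Set GraphSpace} {x : GraphSpace}
    (hx : x ∈ Submodule.span ℝ S) {l : List (Sym2 V)} (h : coeff x l ≠ 0) :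
    ∃ s ∈ S, coeff s l ≠ 0 := by
  by_contra! hc
  have : Submodule.span ℝ S ≤ LinearMap.ker (pairing l.get) := Submodule.span_le.2 hc
  exact h (this hx)

theorem coeff_ne_zero_of_mem_connectedPart {n k : ℕ} {x : GraphSpace}
    (hx : x ∈ connectedPart n k) {l : List (Sym2 V)} (h : coeff x l ≠ 0) :
    Nonempty (V ≃ Fin n) ∧ l.length = k ∧ ListConnected l := by
  obtain ⟨_, ⟨g, hg, rfl⟩, hs⟩ := exists_mem_coeff_ne_zero hx h
  obtain ⟨φ, hφ⟩ := exists_equiv_of_coeff_cls_ne_zero hs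
  refine ⟨⟨φ⟩, by simpa using hφ.length_eq, ?_⟩
  exact ((listConnected_of_connected hg).of_perm hφ.symm).of_map_equiv φ

theorem mem_connectedPart_of_coeff {n k : ℕ} [NeZero n] {x : GraphSpace}
    (h : ∀ (m : ℕ) (l : List (Sym2 (Fin m))), coeff x l ≠ 0 →
      m = n ∧ l.length = k ∧ ListConnected l) : x ∈ connectedPart n k := by
  refine mem_of_coeff fun m j g hg => ?_
  obtain ⟨rfl, hj, hl⟩ := h m _ hg
  rw [List.length_ofFn] at hj
  subst hj
  have : Nonempty (Fin m) := ⟨0⟩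
  exact Submodule.subset_span ⟨g, connected_of_listConnected hl, rfl⟩

theorem IsContraction.card [Finite V] {a b : V} (hab : a ≠ b) {q : V → W}
    (hq : IsContraction s(a, b) q) : Nat.card V = Nat.card W + 1 := by
  have hbij : Function.Bijective fun v : {v : V // v ≠ b} => q v := by
    constructor
    · rintro ⟨u, hu⟩ ⟨v, hv⟩ h
      have := (hq.ker u v).1 h
      simp only [Sym2.mem_iff, hu, hv, or_false] at this
      simp only [Subtype.mk.injEq]
      rcases this with h | ⟨rfl, rfl⟩
      · exact h
      · rfl
    · intro w
      obtain ⟨v, rfl⟩ := hq.surj w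
      by_cases hv : v = b
      · subst hv
        exact ⟨⟨a, hab⟩, (hq.ker _ _).2 (by simp)⟩
      · exact ⟨⟨v, hv⟩, rfl⟩
  rw [← Nat.card_eq_of_bijective _ hbij]
  classical
  rw [← Nat.card_congr (Equiv.optionSubtypeNe b), Finite.card_option]

/-- A set closed under the edges, the contracted one included, is a union of fibres of `q`. Its
image is closed in the contraction and hence everything. -/
theorem ListConnected.of_contraction {e : Sym2 V} {q : V → W} (hq : IsContraction e q)
    {l : List (Sym2 V)} (h : ListConnected (l.map (Sym2.map q))) : ListConnected (e :: l) := by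
  intro S hS hne
  have hsat : ∀ u v, q u = q v → u ∈ S → v ∈ S := by
    intro u v huv hu
    rcases (hq.ker u v).1 huv with rfl | ⟨h1, h2⟩
    · exact hu
    · by_cases hne : u = v
      · exact hne ▸ hu
      · exact hS u v (by rw [(Sym2.mem_and_mem_iff hne).1 ⟨h1, h2⟩]; simp) hu
  have := h (q '' S) ?_ (hne.image q)
  · refine Set.eq_univ_of_forall fun v => ?_
    obtain ⟨u, hu, huv⟩ := (Set.eq_univ_iff_forall.1 this) (q v)
    exact hsat u v huv hu
  · rintro _ w hw ⟨u, hu, rfl⟩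
    obtain ⟨e', he', h'⟩ := List.mem_map.1 hw
    induction e' with | _ a b =>
    rw [Sym2.map_mk, Sym2.eq_iff] at h'
    rcases h' with ⟨h1, rfl⟩ | ⟨rfl, h1⟩
    · exact ⟨b, hS a b (List.mem_cons_of_mem _ he') (hsat _ _ h1.symm hu), rfl⟩
    · exact ⟨a, hS b a (List.mem_cons_of_mem _ (Sym2.eq_swap ▸ he')) (hsat _ _ h1.symm hu), rfl⟩

/-- A nonzero coefficient of `d x` requires a contraction with nonzero coefficient in `x`. The graph
before the contraction is connected too, with one more vertex and one more edge. -/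
theorem d_mem_connectedPart {n k : ℕ} {x : GraphSpace} (hx : x ∈ connectedPart n k) :
    d x ∈ connectedPart (n + 1) (k + 1) := by
  refine mem_connectedPart_of_coeff fun m l hl => ?_
  rw [coeff_d] at hl
  by_contra hc
  refine hl (altSum_eq_zero fun l₁ e l₂ h => ?_)
  subst h
  by_contra hT
  apply hc
  rw [contractTerm] at hT
  split_ifs at hT with he
  · exact absurd rfl hT
  obtain ⟨⟨ψ⟩, hlen, hcon⟩ := coeff_ne_zero_of_mem_connectedPart hx (right_ne_zero_of_mul hT)
  refine ⟨?_, by simp at hlen ⊢; omega,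
    (hcon.of_contraction (isContraction_mk e)).of_perm List.perm_middle.symm⟩
  induction e with | _ a b =>
  have := (isContraction_mk s(a, b)).card he
  rw [Nat.card_congr ψ] at this
  simpa using this

theorem coboundaries_le : coboundaries 7 13 ≤ connectedPart 8 14 := by
  rintro _ ⟨x, hx, rfl⟩
  exact d_mem_connectedPart hx

end Connected

/-! ### Splitting off a vertex; leaves and bivalent vertices in cocycles. -/

section Star

variable {U V W : Type}

/-- The list of edges on `Option U` that joins the new vertex `none` to the vertices in `ys`,
followed by the edges in `rest`. -/
def star (ys : List U) (rest : List (Sym2 U)) : List (Sym2 (Option U)) :=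
  ys.map (fun y => s(none, some y)) ++ rest.map (Sym2.map some)

theorem star_map (q : U → W) (ys : List U) (rest : List (Sym2 U)) :
    (star ys rest).map (Sym2.map (Option.map q)) = star (ys.map q) (rest.map (Sym2.map q)) := by
  simp only [star, List.map_append, List.map_map]
  congr 1
  refine List.map_congr_left fun e _ => ?_
  simp only [Function.comp_apply, Sym2.map_map]
  rfl

theorem exists_perm_star (l : List (Sym2 (Option U))) (hl : ∀ e ∈ l, ¬ e.IsDiag) :
    ∃ ys rest, l.Perm (star ys rest) := by
  induction l with
  | nil => exact ⟨[], [], List.Perm.refl _⟩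
  | cons e l ih =>
    obtain ⟨ys, rest, h⟩ := ih fun e' he' => hl e' (List.mem_cons_of_mem _ he')
    have he := hl e List.mem_cons_self
    have h1 : ∀ y, (s(none, some y) :: l).Perm (star (y :: ys) rest) := fun y => h.cons _
    induction e with | _ a b =>
    rcases a with _ | a <;> rcases b with _ | b
    · simp at he
    · exact ⟨_, _, h1 b⟩
    · exact ⟨_, _, Sym2.eq_swap ▸ h1 a⟩
    · exact ⟨ys, s(a, b) :: rest, (h.cons _).trans List.perm_middle.symm⟩

/-- The number of edges in `l` at the vertex `v`. -/
def vdeg [DecidableEq V] (v : V) (l : List (Sym2 V)) : ℕ := l.countP (v ∈ ·)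

theorem vdeg_perm [DecidableEq V] (v : V) {l l' : List (Sym2 V)} (h : l.Perm l') :
    vdeg v l = vdeg v l' := h.countP_eq _

theorem vdeg_map [DecidableEq V] [DecidableEq W] {f : V → W} (hf : f.Injective) (v : V)
    (l : List (Sym2 V)) : vdeg (f v) (l.map (Sym2.map f)) = vdeg v l := by
  rw [vdeg, vdeg, List.countP_map]
  refine List.countP_congr fun e _ => ?_
  simp [Sym2.mem_map, hf.eq_iff]

theorem vdeg_none_star [DecidableEq U] (ys : List U) (rest : List (Sym2 U)) :
    vdeg none (star ys rest) = ys.length := by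
  rw [vdeg, star, List.countP_append, List.countP_eq_length.2, List.countP_eq_zero.2]
  · simp
  · simp [Sym2.mem_map]
  · simp

theorem vdeg_some_star [DecidableEq U] [BEq U] [LawfulBEq U] (u : U) (ys : List U) (rest : List (Sym2 U)) :
    vdeg (some u) (star ys rest) = ys.count u + vdeg u rest := by
  rw [vdeg, star, List.countP_append]
  congr 1
  · rw [List.countP_map, List.count]
    refine List.countP_congr fun y _ => ?_
    simp only [Function.comp_apply, Sym2.mem_iff, Option.some.injEq, reduceCtorEq, false_or,
      decide_eq_true_eq, beq_iff_eq]
    exact eq_comm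
  · exact vdeg_map (Option.some_injective U) u rest

theorem Nodup.of_star {ys : List U} {rest : List (Sym2 U)} (h : (star ys rest).Nodup) :
    ys.Nodup ∧ rest.Nodup :=
  ⟨(List.Nodup.of_append_left h).of_map _, (List.Nodup.of_append_right h).of_map _⟩

theorem loopless_of_star {ys : List U} {rest : List (Sym2 U)}
    (h : ∀ e ∈ star ys rest, ¬ e.IsDiag) : ∀ e ∈ rest, ¬ e.IsDiag := by
  intro e he hd
  refine h (e.map some) (List.mem_append_right _ (List.mem_map_of_mem he)) ?_
  rwa [Sym2.isDiag_map (Option.some_injective U)]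

theorem IsContraction.option {e : Sym2 U} {q : U → W} (hq : IsContraction e q) :
    IsContraction (e.map some) (Option.map q) where
  surj := by
    rintro (_ | w)
    · exact ⟨none, rfl⟩
    · obtain ⟨u, rfl⟩ := hq.surj w
      exact ⟨some u, rfl⟩
  ker := by
    rintro (_ | u) (_ | v) <;> simp [Sym2.mem_map, hq.ker]

theorem contractTerm_eq_zero (x : GraphSpace) {e : Sym2 V} {l : List (Sym2 V)} {q : V → W}
    (hq : IsContraction e q) (h : coeff x (l.map (Sym2.map q)) = 0) : contractTerm x e l = 0 := by
  by_cases he : e.IsDiag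
  · rw [contractTerm, if_pos he]
  · rw [contractTerm_eq x he hq, h, mul_zero]

theorem freeEnds_eq_zero {a b : V} (hab : a ≠ b) {l : List (Sym2 V)} (ha : ∃ e ∈ l, a ∈ e)
    (hb : ∃ e ∈ l, b ∈ e) : freeEnds s(a, b) l = 0 := by
  classical
  rw [freeEnds_mk hab, if_neg, if_neg, add_zero]
  · rintro h
    obtain ⟨e, he, hbe⟩ := hb
    exact h e he hbe
  · rintro h
    obtain ⟨e, he, hae⟩ := ha
    exact h e he hae

theorem isContraction_elim (c : V) : IsContraction s(none, some c) fun o : Option V => o.elim c id where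
  surj v := ⟨some v, rfl⟩
  ker := by
    rintro (_ | u) (_ | v) <;> simp only [Option.elim, id, Sym2.mem_iff, Option.some.injEq,
      reduceCtorEq, true_or, false_or, true_and, and_true, iff_self] <;> grind

theorem isContraction_map_elim (c : V) : IsContraction s(some none, some (some c))
    (Option.map fun o : Option V => o.elim c id) :=
  (isContraction_elim c).option

/-- Contracting an edge of `rest` leaves the pattern `l₀` at the two new vertices intact and
replaces the old vertices by a quotient. This is why the vanishing hypotheses are required over all
vertex types. -/
theorem altSum_contractTerm_star {x : GraphSpace} (l₀ : List (Sym2 (Option (Option U))))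
    (rest : List (Sym2 U))
    (h : ∀ (W : Type) (q : U → W) (rest : List (Sym2 W)), coeff x (l₀.map (Sym2.map (Option.map (Option.map q))) ++
      rest.map (Sym2.map (some ∘ some))) = 0) :
    altSum (fun e l => contractTerm x e (l₀ ++ l)) (rest.map (Sym2.map (some ∘ some))) = 0 := by
  rw [altSum_map]
  refine altSum_eq_zero fun l₁ e l₂ _ => ?_
  have hq : IsContraction (e.map (some ∘ some))
      (Option.map (Option.map (Quotient.mk (contractSetoid e)))) := by
    have := (isContraction_mk e).option.option
    rwa [Sym2.map_map] at this
  refine contractTerm_eq_zero x hq ?_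
  rw [← h _ (Quotient.mk (contractSetoid e)) ((l₁ ++ l₂).map (Sym2.map (Quotient.mk _))),
    List.map_append, List.map_map, List.map_map]
  congr 2
  refine List.map_congr_left fun e' _ => ?_
  simp only [Function.comp_apply, Sym2.map_map]
  rfl

/-- If the antennas of length two have coefficient zero in a cocycle, so have all leaves. -/
theorem coeff_leaf_eq_zero {x : GraphSpace} (hx : d x = 0)
    (h : ∀ (U : Type) (w : U) (rest : List (Sym2 U)), coeff x (star [none] (star [w] rest)) = 0)
    (w : U) (rest : List (Sym2 U)) (hw : ∃ e ∈ rest, w ∈ e) : coeff x (star [w] rest) = 0 := by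
  -- The leaf is lengthened to an antenna with two edges, and the cocycle condition is read off at
  -- that graph. Contractions away from the antenna keep it and vanish by hypothesis.
  have key : coeff (d x) (star [none] (star [w] rest)) = 0 := by rw [hx, coeff_zero]
  have e (U : Type) (w : U) (rest : List (Sym2 U)) : star [none] (star [w] rest) =
      [s(none, some none), s(some none, some (some w))] ++ rest.map (Sym2.map (some ∘ some)) := by
    simp [star, Function.comp_def, Sym2.map_map]
  rw [coeff_d, e, List.cons_append, List.cons_append, List.nil_append, altSum, altSum] at key
  have h₀ := altSum_contractTerm_star (x := x) [s(none, some none), s(some none, some (some w))] rest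
    fun W q rest => by
      rw [← h W (q w) rest, e]
      rfl
  simp only [List.cons_append, List.nil_append] at h₀
  rw [h₀, sub_zero, sub_eq_zero, contractTerm_eq x (by simp) (isContraction_elim none),
    contractTerm_eq x (by simp) (isContraction_map_elim w)] at key
  -- The outer edge has exactly one free end and does not contribute, so contracting the inner edge
  -- is all that remains.
  have f₀ : freeEnds s(none, some none)
      (s(some none, some (some w)) :: rest.map (Sym2.map (some ∘ some))) = 1 := by
    classical
    rw [freeEnds_mk (by simp), if_pos, if_neg, add_zero]
    · simp
    · simp [Sym2.mem_map]
  obtain ⟨e₀, he₀, hw⟩ := hw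
  have f₁ : freeEnds s(some none, some (some w))
      (s(none, some none) :: rest.map (Sym2.map (some ∘ some))) = 0 :=
    freeEnds_eq_zero (by simp) ⟨_, List.mem_cons_self, by simp⟩
      ⟨_, List.mem_cons_of_mem _ (List.mem_map_of_mem he₀), Sym2.mem_map.2 ⟨w, hw, rfl⟩⟩
  have c₁ : (s(none, some none) :: rest.map (Sym2.map (some ∘ some))).map
      (Sym2.map (Option.map fun o : Option U => o.elim w id)) = star [w] rest := by
    simp [star, Function.comp_def, Sym2.map_map]
  rw [f₀, f₁, c₁] at key
  linarith

/-- If the paths of two adjacent bivalent vertices have coefficient zero in a cocycle, so have all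
bivalent vertices. -/
theorem coeff_bivalent_eq_zero {x : GraphSpace} (hx : d x = 0)
    (h : ∀ (U : Type) (a b : U) (rest : List (Sym2 U)),
      coeff x (star [none, some b] (star [a] rest)) = 0)
    {a b : U} (rest : List (Sym2 U)) (ha : ∃ e ∈ rest, a ∈ e)
    (hb : ∃ e ∈ rest, b ∈ e) : coeff x (star [b, a] rest) = 0 := by
  -- The bivalent vertex is doubled: the path from `b` to `a` now has three edges and two inner
  -- vertices. Only contractions along this path survive.
  have key : coeff (d x) (star [none, some b] (star [a] rest)) = 0 := by rw [hx, coeff_zero]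
  have e (U : Type) (a b : U) (rest : List (Sym2 U)) : star [none, some b] (star [a] rest) =
      [s(none, some none), s(none, some (some b)), s(some none, some (some a))] ++
        rest.map (Sym2.map (some ∘ some)) := by
    simp [star, Function.comp_def, Sym2.map_map]
  rw [coeff_d, e, List.cons_append, List.cons_append, List.cons_append, List.nil_append, altSum,
    altSum, altSum] at key
  have h₀ := altSum_contractTerm_star (x := x)
    [s(none, some none), s(none, some (some b)), s(some none, some (some a))] rest
    fun W q rest => by
      rw [← h W (q a) (q b) rest, e]
      rfl
  simp only [List.cons_append, List.nil_append] at h₀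
  rw [h₀, sub_zero, contractTerm_eq x (by simp) (isContraction_elim none),
    contractTerm_eq x (by simp) (isContraction_elim (some b)),
    contractTerm_eq x (by simp) (isContraction_map_elim a)] at key
  obtain ⟨e₁, he₁, ha⟩ := ha
  obtain ⟨e₂, he₂, hb⟩ := hb
  have f₀ : freeEnds s(none, some none) (s(none, some (some b)) :: s(some none, some (some a)) ::
      rest.map (Sym2.map (some ∘ some))) = 0 :=
    freeEnds_eq_zero (by simp) ⟨_, List.mem_cons_self, by simp⟩
      ⟨_, List.mem_cons_of_mem _ List.mem_cons_self, by simp⟩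
  have f₁ : freeEnds s(none, some (some b)) (s(none, some none) :: s(some none, some (some a)) ::
      rest.map (Sym2.map (some ∘ some))) = 0 :=
    freeEnds_eq_zero (by simp) ⟨_, List.mem_cons_self, by simp⟩
      ⟨_, List.mem_cons_of_mem _ (List.mem_cons_of_mem _ (List.mem_map_of_mem he₂)),
        Sym2.mem_map.2 ⟨b, hb, rfl⟩⟩
  have f₂ : freeEnds s(some none, some (some a)) (s(none, some none) :: s(none, some (some b)) ::
      rest.map (Sym2.map (some ∘ some))) = 0 :=
    freeEnds_eq_zero (by simp) ⟨_, List.mem_cons_self, by simp⟩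
      ⟨_, List.mem_cons_of_mem _ (List.mem_cons_of_mem _ (List.mem_map_of_mem he₁)),
        Sym2.mem_map.2 ⟨a, ha, rfl⟩⟩
  have c₀ : (s(none, some (some b)) :: s(some none, some (some a)) ::
      rest.map (Sym2.map (some ∘ some))).map (Sym2.map fun o : Option (Option U) => o.elim none id)
      = star [b, a] rest := by
    simp [star, Function.comp_def, Sym2.map_map]
  have c₁ : (s(none, some none) :: s(some none, some (some a)) ::
      rest.map (Sym2.map (some ∘ some))).map
        (Sym2.map fun o : Option (Option U) => o.elim (some b) id) = star [b, a] rest := by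
    simp [star, Function.comp_def, Sym2.map_map, Sym2.eq_swap]
  have c₂ : (s(none, some none) :: s(none, some (some b)) ::
      rest.map (Sym2.map (some ∘ some))).map
        (Sym2.map (Option.map fun o : Option U => o.elim a id)) = star [a, b] rest := by
    simp [star, Function.comp_def, Sym2.map_map]
  -- All three contractions give the same graph, with alternating signs and the edges exchanged in
  -- the last one. The total is `1 - 1 - 1`, which is not zero.
  have hs : coeff x (star [a, b] rest) = -coeff x (star [b, a] rest) := coeff_swap x [] _ _ _
  rw [f₀, f₁, f₂, c₀, c₁, c₂, hs] at key
  linarith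

end Star

/-! ### Reduction to valency three, for cocycles and for the differential. -/

section LowDegree

variable {U V W : Type}

theorem coeff_star_star_congr (x : GraphSpace) (φ : U ≃ W) (zs : List (Option U)) (ys : List U)
    (rest : List (Sym2 U)) :
    coeff x (star zs (star ys rest)) = coeff x (star (zs.map (Option.map φ))
      (star (ys.map φ) (rest.map (Sym2.map φ)))) := by
  rw [← star_map, ← star_map, ← coeff_map_equiv x φ.optionCongr.optionCongr]
  rfl

theorem nonempty_equiv_fin_of_option_option {n : ℕ} (h : Nonempty (Option (Option U) ≃ Fin (n + 2))) :
    Nonempty (U ≃ Fin n) := by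
  obtain ⟨φ⟩ := h
  have : Finite (Option (Option U)) := Finite.of_equiv _ φ.symm
  have : Finite U := Finite.of_injective (fun u => some (some u)) fun _ _ h => by simpa using h
  have hc := Nat.card_congr φ
  rw [Finite.card_option, Finite.card_option, Nat.card_fin] at hc
  exact ⟨Finite.equivFinOfCardEq (by omega)⟩

theorem length_star (ys : List U) (rest : List (Sym2 U)) :
    (star ys rest).length = ys.length + rest.length := by
  simp [star]

theorem core_of_coeff_ne_zero {n k : ℕ} {x : GraphSpace} (hx : x ∈ connectedPart (n + 2) k)
    {zs : List (Option U)} {ys : List U} {rest : List (Sym2 U)}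
    (h : coeff x (star zs (star ys rest)) ≠ 0) :
    Nonempty (U ≃ Fin n) ∧ rest.Nodup ∧ (∀ e ∈ rest, ¬ e.IsDiag) ∧
      zs.length + (ys.length + rest.length) = k := by
  obtain ⟨hφ, hlen, -⟩ := coeff_ne_zero_of_mem_connectedPart hx h
  rw [length_star, length_star] at hlen
  have hnd : (star zs (star ys rest)).Nodup := by
    by_contra hc
    exact h (coeff_eq_zero_of_not_nodup x hc)
  have hll : ∀ e ∈ star zs (star ys rest), ¬ e.IsDiag :=
    fun e he hd => h (coeff_eq_zero_of_isDiag x he hd)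
  exact ⟨nonempty_equiv_fin_of_option_option hφ, (Nodup.of_star (Nodup.of_star hnd).2).2,
    loopless_of_star (loopless_of_star hll), hlen⟩

theorem map_equiv_nodup_loopless (φ : U ≃ W) {l : List (Sym2 U)} (hn : l.Nodup)
    (hl : ∀ e ∈ l, ¬ e.IsDiag) :
    (l.map (Sym2.map φ)).Nodup ∧ ∀ e ∈ l.map (Sym2.map φ), ¬ e.IsDiag := by
  refine ⟨hn.map (Sym2.map.injective φ.injective), fun e he => ?_⟩
  obtain ⟨e, he', rfl⟩ := List.mem_map.1 he
  rw [Sym2.isDiag_map φ.injective]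
  exact hl e he'

theorem exists_star_of_vertex [DecidableEq V] (v : V) (l : List (Sym2 V)) (hl : ∀ e ∈ l, ¬ e.IsDiag) :
    ∃ ys rest, (l.map (Sym2.map (Equiv.optionSubtypeNe v).symm)).Perm (star ys rest) ∧
      ys.length = vdeg v l := by
  obtain ⟨ys, rest, h⟩ := exists_perm_star (l.map (Sym2.map (Equiv.optionSubtypeNe v).symm)) <| by
    intro e he
    obtain ⟨e, he', rfl⟩ := List.mem_map.1 he
    rw [Sym2.isDiag_map (Equiv.injective _)]
    exact hl e he'
  refine ⟨ys, rest, h, ?_⟩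
  rw [← vdeg_none_star ys rest, ← vdeg_perm _ h,
    ← vdeg_map (Equiv.optionSubtypeNe v).symm.injective v l]
  simp

theorem exists_mem_iff_vdeg_pos [DecidableEq V] {v : V} {l : List (Sym2 V)} :
    (∃ e ∈ l, v ∈ e) ↔ 0 < vdeg v l := by
  simp [vdeg, List.countP_pos_iff]

/-- A cocycle on connected graphs with 8 vertices and 14 edges vanishes if its coefficients at the
graphs with an antenna of length two, with two adjacent bivalent vertices, and without vertices of
valency less than three vanish. -/
theorem eq_zero_of_cocycle {x : GraphSpace} (hx : x ∈ connectedPart 8 14) (hdx : d x = 0)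
    (hA : ∀ (w : Fin 6) (rest : List (Sym2 (Fin 6))), rest.Nodup → (∀ e ∈ rest, ¬ e.IsDiag) →
      rest.length = 12 → coeff x (star [none] (star [w] rest)) = 0)
    (hB : ∀ (a b : Fin 6) (rest : List (Sym2 (Fin 6))), rest.Nodup → (∀ e ∈ rest, ¬ e.IsDiag) →
      rest.length = 11 → coeff x (star [none, some b] (star [a] rest)) = 0)
    (hD : ∀ l : List (Sym2 (Fin 8)), l.Nodup → (∀ e ∈ l, ¬ e.IsDiag) → l.length = 14 →
      (∀ v, 3 ≤ vdeg v l) → coeff x l = 0) : x = 0 := by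
  -- A nonzero coefficient forces six remaining vertices and a simple graph, so the hypothesis on
  -- `Fin 6` covers all vertex types.
  have hA' : ∀ (U : Type) (w : U) (rest : List (Sym2 U)),
      coeff x (star [none] (star [w] rest)) = 0 := by
    intro U w rest
    by_contra h
    obtain ⟨⟨φ⟩, hn, hl, hlen⟩ := core_of_coeff_ne_zero (n := 6) hx h
    obtain ⟨hn', hl'⟩ := map_equiv_nodup_loopless φ hn hl
    apply h
    rw [coeff_star_star_congr x φ]
    exact hA (φ w) _ hn' hl' (by simp at hlen ⊢; omega)
  have hB' : ∀ (U : Type) (a b : U) (rest : List (Sym2 U)),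
      coeff x (star [none, some b] (star [a] rest)) = 0 := by
    intro U a b rest
    by_contra h
    obtain ⟨⟨φ⟩, hn, hl, hlen⟩ := core_of_coeff_ne_zero (n := 6) hx h
    obtain ⟨hn', hl'⟩ := map_equiv_nodup_loopless φ hn hl
    apply h
    rw [coeff_star_star_congr x φ]
    exact hB (φ a) (φ b) _ hn' hl' (by simp at hlen ⊢; omega)
  refine eq_zero_of_coeff fun n l => ?_
  by_contra h
  obtain ⟨⟨φ⟩, hlen, hcon⟩ := coeff_ne_zero_of_mem_connectedPart hx h
  obtain rfl : n = 8 := by simpa using Fintype.card_congr φ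
  have hnd : l.Nodup := by
    by_contra hc
    exact h (coeff_eq_zero_of_not_nodup x hc)
  have hll : ∀ e ∈ l, ¬ e.IsDiag := fun e he hd => h (coeff_eq_zero_of_isDiag x he hd)
  have hmin : ∀ v, 0 < vdeg v l := by
    intro v
    by_contra hv
    rw [← exists_mem_iff_vdeg_pos] at hv
    have := hcon {v} (by
      rintro a b hab rfl
      exact absurd ⟨_, hab, Sym2.mem_mk_left _ _⟩ hv) ⟨v, rfl⟩
    obtain ⟨w, hw⟩ := exists_ne v
    exact hw (by simpa using (Set.eq_univ_iff_forall.1 this) w)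
  have key : ∀ v, coeff x l = 0 ∨ 2 ≤ vdeg v l := by
    intro v
    by_contra! hv
    obtain ⟨ys, rest, hp, hys⟩ := exists_star_of_vertex v l hll
    have hc : coeff x (star ys rest) ≠ 0 := by
      rw [Ne, ← coeff_perm_eq_zero x hp, coeff_map_equiv]
      exact hv.1
    obtain ⟨-, -, hcon'⟩ := coeff_ne_zero_of_mem_connectedPart hx hc
    obtain ⟨w, rfl⟩ := List.length_eq_one_iff.1 (show ys.length = 1 by have := hmin v; omega)
    refine hc (coeff_leaf_eq_zero hdx hA' w rest ?_)
    by_contra hw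
    -- If the neighbour of the leaf had no further edge, the two would form a component with 2 of
    -- the 8 vertices.
    have := hcon' {none, some w} ?_ ⟨none, by simp⟩
    · have h8 : Nat.card (Option {u // u ≠ v}) = 8 := by
        rw [Nat.card_congr (Equiv.optionSubtypeNe v)]
        simp
      rw [← Set.ncard_univ, ← this, Set.ncard_pair (by simp)] at h8
      omega
    · intro a b hab ha
      simp only [star, List.map_cons, List.map_nil, List.cons_append, List.nil_append,
        List.mem_cons, List.mem_map] at hab
      rcases hab with hab | ⟨e, he, hab⟩
      · have : b ∈ s(none, some w) := hab ▸ Sym2.mem_mk_right a b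
        simpa using this
      · exfalso
        have : a ∈ e.map some := hab ▸ Sym2.mem_mk_left a b
        obtain ⟨u, hu, rfl⟩ := Sym2.mem_map.1 this
        simp only [Set.mem_insert_iff, reduceCtorEq, Set.mem_singleton_iff, Option.some.injEq,
          false_or] at ha
        exact hw ⟨e, he, ha ▸ hu⟩
  have h2 : ∀ v, 2 ≤ vdeg v l := fun v => (key v).resolve_left h
  refine h (hD l hnd hll hlen fun v => ?_)
  by_contra hv
  obtain ⟨ys, rest, hp, hys⟩ := exists_star_of_vertex v l hll
  obtain ⟨b, a, rfl⟩ := List.length_eq_two.1 (show ys.length = 2 by have := h2 v; omega)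
  -- Leaves are already excluded, and `v` contributes at most one edge to a neighbour, so `a` and
  -- `b` each have an edge in `rest`.
  have hd : ∀ u : {u // u ≠ v}, 2 ≤ [b, a].count u + vdeg u rest := by
    intro u
    rw [← vdeg_some_star, ← vdeg_perm _ hp]
    have := vdeg_map (Equiv.optionSubtypeNe v).symm.injective u.1 l
    rw [Equiv.optionSubtypeNe_symm_of_ne u.2] at this
    exact (h2 u.1).trans_eq this.symm
  have hnd' : [b, a].Nodup := by
    refine (Nodup.of_star (hp.nodup_iff.1 ?_)).1
    exact hnd.map (Sym2.map.injective (Equiv.injective _))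
  have hc : ∀ u, [b, a].count u ≤ 1 := List.nodup_iff_count_le_one.1 hnd'
  rw [← coeff_map_equiv x (Equiv.optionSubtypeNe v).symm, coeff_perm_eq_zero x hp] at h
  refine h (coeff_bivalent_eq_zero hdx hB' rest ?_ ?_) <;> rw [exists_mem_iff_vdeg_pos]
  · have := hd a; have := hc a; omega
  · have := hd b; have := hc b; omega

/-- Contracting an edge away from `none` does not raise the number of edges at `none`. -/
theorem altSum_contractTerm_star_eq_zero [DecidableEq U] {x : GraphSpace}
    (hx : ∀ (W : Type) [DecidableEq W] (l : List (Sym2 W)) (v : W), vdeg v l ≤ 2 → coeff x l = 0)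
    (ys : List U) (hys : ys.length ≤ 2) (rest : List (Sym2 U)) :
    altSum (fun e l => contractTerm x e (ys.map (fun y => s(none, some y)) ++ l))
      (rest.map (Sym2.map some)) = 0 := by
  classical
  rw [altSum_map]
  refine altSum_eq_zero fun l₁ e l₂ _ => ?_
  refine contractTerm_eq_zero x (isContraction_mk e).option ?_
  have := star_map (Quotient.mk (contractSetoid e)) ys (l₁ ++ l₂)
  rw [star] at this
  rw [this]
  refine hx _ _ none ?_
  rw [vdeg_none_star]
  simpa using hys

/-- If the graphs in `x` have no vertices of valency less than three, neither have those in `d x`. -/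
theorem coeff_d_eq_zero_of_vdeg_le_two {x : GraphSpace}
    (hx : ∀ (W : Type) [DecidableEq W] (l : List (Sym2 W)) (v : W), vdeg v l ≤ 2 → coeff x l = 0)
    [DecidableEq V] (l : List (Sym2 V)) (v : V) (hv : vdeg v l ≤ 2) : coeff (d x) l = 0 := by
  by_cases hll : ∀ e ∈ l, ¬ e.IsDiag
  swap
  · push Not at hll
    obtain ⟨e, he, hd⟩ := hll
    exact coeff_eq_zero_of_isDiag _ he hd
  obtain ⟨ys, rest, hp, hys⟩ := exists_star_of_vertex v l hll
  rw [← coeff_map_equiv _ (Equiv.optionSubtypeNe v).symm, coeff_perm_eq_zero _ hp]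
  rw [← hys] at hv
  have h₀ := altSum_contractTerm_star_eq_zero hx ys hv rest
  have hfree : ∀ (u : {u // u ≠ v}) {l : List (Sym2 {u // u ≠ v})}, ¬ (∃ e ∈ l, u ∈ e) → vdeg u l = 0 :=
    fun u l h => by rw [exists_mem_iff_vdeg_pos] at h; omega
  -- Without edges at `v` nothing remains. For a leaf the free end makes the factor zero. For a
  -- bivalent vertex the contractions of its two edges give the same graph, and their signs are
  -- opposite.
  match ys, hv with
  | [], _ => rw [coeff_d]; exact h₀
  | [w], _ =>
    rw [coeff_d, star, List.map_cons, List.map_nil, List.cons_append, List.nil_append, altSum]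
    have h₁ : altSum (fun e l => contractTerm x e (s(none, some w) :: l))
      (rest.map (Sym2.map some)) = 0 := h₀
    rw [h₁, sub_zero, contractTerm_eq x (by simp) (isContraction_elim w)]
    have c : (rest.map (Sym2.map some)).map (Sym2.map fun o : Option _ => o.elim w id) = rest := by
      simp [Function.comp_def, Sym2.map_map]
    rw [c]
    by_cases hw : ∃ e ∈ rest, w ∈ e
    · rw [freeEnds_mk (by simp), if_pos (by simp [Sym2.mem_map]), if_neg]
      · ring
      · obtain ⟨e, he, hwe⟩ := hw
        exact fun h => h _ (List.mem_map_of_mem he) (Sym2.mem_map.2 ⟨w, hwe, rfl⟩)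
    -- If both ends of the edge are free, the factor is not zero, but the contracted graph has an
    -- isolated vertex.
    · rw [hx _ rest w (by rw [hfree w hw]; omega), mul_zero]
  | [a, b], _ =>
    by_cases hab : a = b
    · subst hab
      exact coeff_eq_zero_of_not_nodup _ (by simp [star])
    rw [coeff_d, star, List.map_cons, List.map_cons, List.map_nil, List.cons_append,
      List.cons_append, List.nil_append, altSum, altSum]
    have h₁ : altSum (fun e l => contractTerm x e (s(none, some a) :: s(none, some b) :: l))
      (rest.map (Sym2.map some)) = 0 := h₀
    rw [h₁, sub_zero, contractTerm_eq x (by simp) (isContraction_elim a),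
      contractTerm_eq x (by simp) (isContraction_elim b)]
    have c₁ : (s(none, some b) :: rest.map (Sym2.map some)).map
        (Sym2.map fun o : Option _ => o.elim a id) = s(a, b) :: rest := by
      simp [Function.comp_def, Sym2.map_map]
    have c₂ : (s(none, some a) :: rest.map (Sym2.map some)).map
        (Sym2.map fun o : Option _ => o.elim b id) = s(a, b) :: rest := by
      simp [Function.comp_def, Sym2.map_map, Sym2.eq_swap]
    rw [c₁, c₂]
    have hv' : ∀ u, vdeg u (s(a, b) :: rest) ≤ 1 + vdeg u rest := by
      intro u
      simp only [vdeg, List.countP_cons]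
      split_ifs <;> omega
    by_cases ha : ∃ e ∈ rest, a ∈ e
    · by_cases hb : ∃ e ∈ rest, b ∈ e
      · obtain ⟨e₁, he₁, ha⟩ := ha
        obtain ⟨e₂, he₂, hb⟩ := hb
        rw [freeEnds_eq_zero, freeEnds_eq_zero, sub_self]
        · simp
        · exact ⟨_, List.mem_cons_self, by simp⟩
        · exact ⟨_, List.mem_cons_of_mem _ (List.mem_map_of_mem he₂), Sym2.mem_map.2 ⟨b, hb, rfl⟩⟩
        · simp
        · exact ⟨_, List.mem_cons_self, by simp⟩
        · exact ⟨_, List.mem_cons_of_mem _ (List.mem_map_of_mem he₁), Sym2.mem_map.2 ⟨a, ha, rfl⟩⟩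
      · rw [hx _ _ b ((hv' b).trans (by rw [hfree b hb]; omega))]
        simp
    · rw [hx _ _ a ((hv' a).trans (by rw [hfree a ha]; omega))]
      simp

end LowDegree

/-! ### Decimal codes for edges and vertex maps, and sorting with signs. -/

section Codes

variable {V : Type} {m n : ℕ}

/-- The edge on `Fin n` denoted by a two-digit number. -/
def dec (n : ℕ) [NeZero n] (c : ℕ) : Sym2 (Fin n) :=
  s(Fin.ofNat n (c / 10 - 1), Fin.ofNat n (c % 10 - 1))

/-- The application of `f` to `n`, where the kernel evaluates `n` first. -/
def force {α : Type} (n : ℕ) (f : ℕ → α) : α := Nat.casesOn n (f 0) fun k => f k.succ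

@[simp] theorem force_eq {α : Type} (n : ℕ) (f : ℕ → α) : force n f = f n := by
  cases n <;> rfl

/-- The `i`-th decimal digit of `q`, where the last digit is the first one. -/
def digit (q i : ℕ) : ℕ := Nat.mod (Nat.div q (Nat.pow 10 (Nat.pred i))) 10

theorem digit_eq (q i : ℕ) : digit q i = q / 10 ^ (i - 1) % 10 := rfl

/-- The code of the edge between the vertices with labels `u` and `v`. -/
def edgeCode (u v : ℕ) : ℕ :=
  bif Nat.blt u v then Nat.add (Nat.mul 10 u) v else Nat.add (Nat.mul 10 v) u

theorem edgeCode_eq (u v : ℕ) : edgeCode u v = bif Nat.blt u v then 10 * u + v else 10 * v + u :=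
  rfl

/-- Relabel the vertex `i` to the `i`-th digit of `q`. -/
def relabel (q c : ℕ) : ℕ :=
  force (digit q (Nat.div c 10)) fun u => force (digit q (Nat.mod c 10)) (edgeCode u)

theorem relabel_eq (q c : ℕ) : relabel q c = edgeCode (digit q (c / 10)) (digit q (c % 10)) := by
  rw [relabel, force_eq, force_eq]
  rfl

/-- Whether the code denotes an edge between different vertices with labels `1, …, n`. -/
def validCode (n c : ℕ) : Bool :=
  Nat.blt 0 (c / 10) && Nat.ble (c / 10) n && Nat.blt 0 (c % 10) && Nat.ble (c % 10) n &&
    !Nat.beq (c / 10) (c % 10)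

/-- The map of vertices encoded by the digits of `q`. -/
def labelMap (m n : ℕ) [NeZero n] (q : ℕ) (i : Fin m) : Fin n := Fin.ofNat n (digit q (i + 1) - 1)

theorem digit_lt (q i : ℕ) : digit q i < 10 := Nat.mod_lt _ (by norm_num)

theorem dec_edgeCode [NeZero n] {u v : ℕ} (hu : u < 10) (hv : v < 10) :
    dec n (edgeCode u v) = s(Fin.ofNat n (u - 1), Fin.ofNat n (v - 1)) := by
  rw [edgeCode_eq]
  cases h : Nat.blt u v
  · rw [cond_false, dec, show (10 * v + u) / 10 = v by omega, show (10 * v + u) % 10 = u by omega,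
      Sym2.eq_swap]
  · rw [cond_true, dec, show (10 * u + v) / 10 = u by omega, show (10 * u + v) % 10 = v by omega]

theorem validCode_iff {c : ℕ} : validCode n c = true ↔
    0 < c / 10 ∧ c / 10 ≤ n ∧ 0 < c % 10 ∧ c % 10 ≤ n ∧ c / 10 ≠ c % 10 := by
  simp only [validCode, Bool.and_eq_true, Nat.blt_eq, Nat.ble_eq, Bool.not_eq_true',
    and_assoc, ← Bool.not_eq_true, Nat.beq_eq, ne_eq]

theorem not_isDiag_dec [NeZero n] {c : ℕ} (h : validCode n c = true) : ¬ (dec n c).IsDiag := by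
  obtain ⟨h1, h2, h3, h4, h5⟩ := validCode_iff.1 h
  rw [dec, Sym2.mk_isDiag_iff, Fin.ext_iff, Fin.val_ofNat, Fin.val_ofNat,
    Nat.mod_eq_of_lt (by omega), Nat.mod_eq_of_lt (by omega)]
  omega

theorem dec_relabel [NeZero m] [NeZero n] (q : ℕ) {c : ℕ} (h : validCode m c = true) :
    dec n (relabel q c) = (dec m c).map (labelMap m n q) := by
  obtain ⟨h1, h2, h3, h4, -⟩ := validCode_iff.1 h
  have key : ∀ i, 0 < i → i ≤ m →
      labelMap m n q (Fin.ofNat m (i - 1)) = Fin.ofNat n (digit q i - 1) := by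
    intro i h h'
    rw [labelMap, Fin.val_ofNat, Nat.mod_eq_of_lt (by omega), Nat.sub_add_cancel h]
  rw [relabel_eq, dec_edgeCode (digit_lt _ _) (digit_lt _ _), dec, Sym2.map_mk, key _ h1 h2,
    key _ h3 h4]

theorem map_dec_relabel [NeZero m] [NeZero n] (q : ℕ) {l : List ℕ} (h : l.all (validCode m) = true) :
    (l.map (relabel q)).map (dec n) = (l.map (dec m)).map (Sym2.map (labelMap m n q)) := by
  rw [List.map_map, List.map_map]
  exact List.map_congr_left fun c hc => dec_relabel q (List.all_eq_true.1 h c hc)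

/-- The set of the first `m` digits of `q`, as a bit mask. -/
def digitMask (q : ℕ) : ℕ → ℕ
  | 0 => 0
  | i + 1 => digitMask q i ||| 2 ^ digit q (i + 1)

/-- Whether `q` maps the labels `1, …, m` onto the labels `1, …, n`. -/
def isOnto (m n q : ℕ) : Bool := Nat.beq (digitMask q m) (2 ^ (n + 1) - 2)

theorem testBit_digitMask (q m j : ℕ) :
    (digitMask q m).testBit j = true ↔ ∃ i < m, digit q (i + 1) = j := by
  induction m with
  | zero => simp [digitMask]
  | succ m ih =>
    rw [digitMask, Nat.testBit_or, Bool.or_eq_true, ih, Nat.testBit_two_pow]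
    simp only [decide_eq_true_eq]
    constructor
    · rintro (⟨i, hi, h⟩ | h)
      · exact ⟨i, by omega, h⟩
      · exact ⟨m, by omega, h⟩
    · rintro ⟨i, hi, h⟩
      rcases Nat.lt_succ_iff_lt_or_eq.1 hi with hi | rfl
      · exact Or.inl ⟨i, hi, h⟩
      · exact Or.inr h

theorem surjective_of_isOnto [NeZero n] {q : ℕ} (h : isOnto m n q = true) :
    Function.Surjective (labelMap m n q) := by
  intro j
  -- The binary digits of `2 ^ (n + 1) - 2` that equal 1 are those at the places `1, …, n`; the
  -- label 0 is not used.
  have hb : (digitMask q m).testBit (j + 1) = true := by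
    rw [Nat.eq_of_beq_eq_true h, show 2 ^ (n + 1) - 2 = 2 * (2 ^ n - 1) by rw [pow_succ]; omega,
      Nat.testBit_succ, Nat.mul_div_cancel_left _ (by norm_num), Nat.testBit_two_pow_sub_one]
    simp
  obtain ⟨i, hi, h⟩ := (testBit_digitMask q m _).1 hb
  refine ⟨⟨i, hi⟩, ?_⟩
  rw [labelMap, h, Nat.add_sub_cancel]
  ext
  rw [Fin.val_ofNat, Nat.mod_eq_of_lt j.2]

theorem bijective_of_isOnto [NeZero n] {q : ℕ} (h : isOnto n n q = true) :
    Function.Bijective (labelMap n n q) :=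
  Finite.surjective_iff_bijective.1 (surjective_of_isOnto h)

/-- Omitting `b` keeps the map onto, as `a` has the same image. Between sets of `n` elements it is
then injective, so no further vertices are identified. A certificate therefore has to be tested for
surjectivity only. -/
theorem isContraction_of_surjective {f : Fin (n + 1) → Fin n} (hf : f.Surjective) {a b : Fin (n + 1)}
    (hab : a ≠ b) (h : f a = f b) : IsContraction s(a, b) f where
  surj := hf
  ker := by
    have hs : Function.Surjective fun i : Fin n => f (b.succAbove i) := by
      intro j
      obtain ⟨i, rfl⟩ := hf j
      by_cases hi : i = b
      · obtain ⟨i', hi'⟩ := Fin.exists_succAbove_eq hab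
        exact ⟨i', by simp only; rw [hi', hi, h]⟩
      · obtain ⟨i', hi'⟩ := Fin.exists_succAbove_eq hi
        exact ⟨i', by simp only; rw [hi']⟩
    have hinj := Finite.injective_iff_surjective.2 hs
    have key : ∀ u v, u ≠ b → v ≠ b → f u = f v → u = v := by
      intro u v hu hv huv
      obtain ⟨u, rfl⟩ := Fin.exists_succAbove_eq hu
      obtain ⟨v, rfl⟩ := Fin.exists_succAbove_eq hv
      rw [hinj huv]
    intro u v
    simp only [Sym2.mem_iff]
    constructor
    · intro huv
      by_cases hu : u = b
      · by_cases hv : v = b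
        · exact Or.inl (hu.trans hv.symm)
        · exact Or.inr ⟨Or.inr hu, Or.inl (key v a hv hab (by rw [← huv, hu, h]))⟩
      · by_cases hv : v = b
        · exact Or.inr ⟨Or.inl (key u a hu hab (by rw [huv, hv, h])), Or.inr hv⟩
        · exact Or.inl (key u v hu hv huv)
    · rintro (rfl | ⟨rfl | rfl, rfl | rfl⟩) <;> simp [h]

/-- The sign `-1` for `true` and `1` for `false`. -/
def boolSign (b : Bool) : ℤ := bif b then -1 else 1

theorem boolSign_xor (a b : Bool) : boolSign (a.xor b) = boolSign a * boolSign b := by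
  cases a <;> cases b <;> rfl

/-- Insertion into a sorted list, with the parity of the number of transpositions. -/
def insertSign (c : ℕ) : List ℕ → Bool × List ℕ
  | [] => (false, [c])
  | e :: l => bif Nat.ble c e then (false, c :: e :: l) else
      match insertSign c l with
      | (b, l') => (!b, e :: l')

/-- The sorted list, with the parity of the sorting permutation. -/
def sortSign : List ℕ → Bool × List ℕ
  | [] => (false, [])
  | c :: l =>
      match sortSign l with
      | (b, l') =>
        match force c fun c => insertSign c l' with
        | (b', l'') => (b.xor b', l'')

theorem sortSign_cons (c : ℕ) (l : List ℕ) : sortSign (c :: l) =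
    ((sortSign l).1.xor (insertSign c (sortSign l).2).1, (insertSign c (sortSign l).2).2) := by
  simp only [sortSign, force_eq]

/-- Each step of the insertion is a transposition of neighbours. The function `F` is kept abstract
because the result serves both `coeff` and the sign of a permutation of edges (`listSign`). -/
theorem apply_insertSign {E : Type*} {F : List E → ℝ}
    (hF : ∀ l₁ l₂ a b, F (l₁ ++ a :: b :: l₂) = -F (l₁ ++ b :: a :: l₂)) (f : ℕ → E) (c : ℕ)
    (l : List ℕ) (l₀ : List E) : F (l₀ ++ (c :: l).map f)
      = (boolSign (insertSign c l).1 : ℝ) * F (l₀ ++ (insertSign c l).2.map f) := by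
  induction l generalizing l₀ with
  | nil => simp [insertSign, boolSign]
  | cons e l ih =>
    rw [insertSign]
    cases Nat.ble c e
    · have h : ∀ (b : Bool) y, (boolSign (!b) : ℝ) * y = -(boolSign b * y) := by
        rintro (_ | _) y <;> simp [boolSign]
      rw [cond_false]
      simp only [h]
      rw [List.map_cons, List.map_cons, hF]
      have := ih (l₀ ++ [f e])
      simp only [List.append_assoc, List.cons_append, List.nil_append, List.map_cons] at this
      rw [this, List.map_cons]
    · simp [boolSign]

theorem apply_sortSign {E : Type*} {F : List E → ℝ}
    (hF : ∀ l₁ l₂ a b, F (l₁ ++ a :: b :: l₂) = -F (l₁ ++ b :: a :: l₂)) (f : ℕ → E)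
    (l : List ℕ) (l₀ : List E) : F (l₀ ++ l.map f)
      = (boolSign (sortSign l).1 : ℝ) * F (l₀ ++ (sortSign l).2.map f) := by
  induction l generalizing l₀ with
  | nil => simp [sortSign, boolSign]
  | cons c l ih =>
    have h₁ := ih (l₀ ++ [f c])
    have h₂ := apply_insertSign hF f c (sortSign l).2 l₀
    simp only [List.append_assoc, List.cons_append, List.nil_append, List.map_cons] at h₁ h₂
    rw [List.map_cons, h₁, h₂, sortSign_cons, boolSign_xor]
    push_cast
    ring

theorem coeff_sortSign (x : GraphSpace) (f : ℕ → Sym2 V) (l : List ℕ) :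
    coeff x (l.map f) = (boolSign (sortSign l).1 : ℝ) * coeff x ((sortSign l).2.map f) :=
  apply_sortSign (coeff_swap x) f l []

theorem insertSign_perm (c : ℕ) (l : List ℕ) : (c :: l).Perm (insertSign c l).2 := by
  induction l with
  | nil => exact List.Perm.refl _
  | cons e l ih =>
    rw [insertSign]
    cases Nat.ble c e
    · exact (List.Perm.swap e c l).trans (ih.cons e)
    · exact List.Perm.refl _

theorem sortSign_perm (l : List ℕ) : l.Perm (sortSign l).2 := by
  induction l with
  | nil => exact List.Perm.refl _
  | cons c l ih => exact sortSign_cons c l ▸ (ih.cons c).trans (insertSign_perm c _)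

/-- Equality of lists of numbers. -/
def listBeq : List ℕ → List ℕ → Bool
  | [], [] => true
  | a :: l, b :: l' => Nat.beq a b && listBeq l l'
  | _, _ => false

theorem eq_of_listBeq {l l' : List ℕ} (h : listBeq l l' = true) : l = l' := by
  induction l generalizing l' with
  | nil => cases l' with
    | nil => rfl
    | cons b l' => cases h
  | cons a l ih => cases l' with
    | nil => cases h
    | cons b l' =>
      rw [listBeq, Bool.and_eq_true] at h
      rw [Nat.eq_of_beq_eq_true h.1, ih h.2]

/-- Whether the permutation `q` of the vertices maps the graph `l` to the graph `T` with sorted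
edges; if so, the sign. -/
def isoSign (n : ℕ) (l T : List ℕ) (q : ℕ) : Option Bool :=
  bif isOnto n n q then
    match sortSign (l.map (relabel q)) with
    | (b, l') => bif listBeq l' T then some b else none
  else none

theorem eq_of_isoSign {l T : List ℕ} {q : ℕ} {b : Bool} (h : isoSign n l T q = some b) :
    isOnto n n q = true ∧ sortSign (l.map (relabel q)) = (b, T) := by
  rw [isoSign] at h
  cases hq : isOnto n n q
  · simp [hq] at h
  · rw [hq, cond_true] at h
    cases hT : listBeq (sortSign (l.map (relabel q))).2 T
    · simp [hT] at h
    · simp only [hT, cond_true, Option.some.injEq] at h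
      exact ⟨rfl, Prod.ext h (eq_of_listBeq hT)⟩

theorem isoSign_spec [NeZero n] {l T : List ℕ} {q : ℕ} {b : Bool} (h : isoSign n l T q = some b)
    (hl : l.all (validCode n) = true) : ∃ φ : Fin n ≃ Fin n,
      (∀ x, coeff x ((l.map (dec n)).map (Sym2.map φ)) = boolSign b * coeff x (T.map (dec n))) ∧
      ((l.map (dec n)).map (Sym2.map φ)).Perm (T.map (dec n)) := by
  obtain ⟨hq, hT⟩ := eq_of_isoSign h
  refine ⟨Equiv.ofBijective _ (bijective_of_isOnto hq), fun x => ?_, ?_⟩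
  · rw [Equiv.coe_ofBijective, ← map_dec_relabel q hl]
    have := coeff_sortSign x (dec n) (l.map (relabel q))
    rwa [hT] at this
  · rw [Equiv.coe_ofBijective, ← map_dec_relabel q hl]
    have := (sortSign_perm (l.map (relabel q))).map (dec n)
    rwa [hT] at this

theorem coeff_of_isoSign [NeZero n] {l T : List ℕ} {q : ℕ} {b : Bool}
    (h : isoSign n l T q = some b) (hl : l.all (validCode n) = true) (x : GraphSpace) :
    coeff x (l.map (dec n)) = boolSign b * coeff x (T.map (dec n)) := by
  obtain ⟨φ, hφ, -⟩ := isoSign_spec h hl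
  rw [← hφ x, coeff_map_equiv]

/-- Whether the permutation `q` of the vertices is a symmetry of the graph `l` that induces an odd
permutation of the edges. -/
def isOddSymmetry (n : ℕ) (l : List ℕ) (q : ℕ) : Bool :=
  match sortSign l with
  | (b, l') =>
    match isoSign n l l' q with
    | some b' => b.xor b'
    | none => false

/-- The sorted list is reached from `l` directly and after relabelling by `q`, with opposite signs.
So the coefficient equals its negative. -/
theorem coeff_of_isOddSymmetry [NeZero n] {l : List ℕ} {q : ℕ} (h : isOddSymmetry n l q = true)
    (hl : l.all (validCode n) = true) (x : GraphSpace) : coeff x (l.map (dec n)) = 0 := by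
  rw [isOddSymmetry] at h
  cases hb : isoSign n l (sortSign l).2 q with
  | none => simp [hb] at h
  | some b' =>
    simp only [hb] at h
    have h₁ := coeff_of_isoSign hb hl x
    have h₂ := coeff_sortSign x (dec n) l
    have h₃ := boolSign_xor (sortSign l).1 b'
    rw [h] at h₃
    have h₄ : (boolSign (sortSign l).1 : ℝ) * boolSign b' = -1 := by
      rw [← Int.cast_mul, ← h₃]
      simp [boolSign]
    have h₅ : (boolSign b' : ℝ) * boolSign b' = 1 := by
      cases b' <;> simp [boolSign]
    have : coeff x (l.map (dec n)) = -coeff x (l.map (dec n)) := by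
      conv_lhs => rw [h₂]
      rw [h₁]
      linear_combination (coeff x ((sortSign l).2.map (dec n))) *
        ((boolSign b' : ℝ) * h₄ - (boolSign (sortSign l).1 : ℝ) * h₅)
    linarith

end Codes

/-! ### Enumeration of graphs up to isomorphism by deleting a vertex of minimal valency. -/

section Cover

variable {V W : Type} {n k D : ℕ}

/-- The edge list of a simple graph with `k` edges and minimal valency at least `D`. -/
structure IsSimpleList [DecidableEq V] (k D : ℕ) (l : List (Sym2 V)) : Prop where
  nodup : l.Nodup
  loopless : ∀ e ∈ l, ¬ e.IsDiag
  length_eq : l.length = k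
  le_vdeg : ∀ v, D ≤ vdeg v l

/-- Every simple graph with `n` vertices, `k` edges and minimal valency at least `D` is isomorphic
to a graph in the list `R`. -/
def IsCover (n k D : ℕ) [NeZero n] (R : List (List ℕ)) : Prop :=
  ∀ l : List (Sym2 (Fin n)), IsSimpleList k D l →
    ∃ T ∈ R, ∃ φ : Fin n ≃ Fin n, (l.map (Sym2.map φ)).Perm (T.map (dec n))

theorem sum_vdeg [Fintype V] [DecidableEq V] (l : List (Sym2 V)) (hl : ∀ e ∈ l, ¬ e.IsDiag) :
    ∑ v, vdeg v l = 2 * l.length := by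
  induction l with
  | nil => simp [vdeg]
  | cons e l ih =>
    have he := hl e List.mem_cons_self
    have : ∀ v, vdeg v (e :: l) = vdeg v l + if v ∈ e then 1 else 0 := by
      intro v
      simp [vdeg, List.countP_cons]
    rw [Finset.sum_congr rfl fun v _ => this v, Finset.sum_add_distrib,
      ih fun e' he' => hl e' (List.mem_cons_of_mem _ he'), Finset.sum_boole]
    have h2 : (Finset.univ.filter fun v => v ∈ e).card = 2 := by
      induction e with | _ a b =>
      simp only [Sym2.mk_isDiag_iff] at he
      rw [← Finset.card_pair he]
      congr 1
      ext v
      simp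
    rw [h2, List.length_cons]
    push_cast
    ring

theorem dec_succ [NeZero n] {c : ℕ} (h : validCode n c = true) :
    dec (n + 1) c = (dec n c).map Fin.castSucc := by
  obtain ⟨h1, h2, h3, h4, -⟩ := validCode_iff.1 h
  have key : ∀ i, 0 < i → i ≤ n → Fin.ofNat (n + 1) (i - 1) = (Fin.ofNat n (i - 1)).castSucc := by
    intro i h h'
    ext
    rw [Fin.val_ofNat, Fin.val_castSucc, Fin.val_ofNat, Nat.mod_eq_of_lt (by omega),
      Nat.mod_eq_of_lt (by omega)]
  rw [dec, dec, Sym2.map_mk, key _ h1 h2, key _ h3 h4]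

theorem dec_last (hn : n < 9) (y : Fin n) :
    dec (n + 1) (10 * (y + 1) + (n + 1)) = s(Fin.last n, y.castSucc) := by
  rw [dec, show (10 * (y + 1) + (n + 1)) / 10 = (y : ℕ) + 1 by omega,
    show (10 * (y + 1) + (n + 1)) % 10 = n + 1 by omega, Sym2.eq_swap]
  congr 1
  · ext
    simp
  · ext
    simp

theorem exists_sublist_range' (ys : List (Fin n)) (h : ys.Nodup) :
    ∃ S ∈ (List.range' 1 n).sublistsLen ys.length, (ys.map fun y : Fin n => (y : ℕ) + 1).Perm S := by
  have hinj : Function.Injective fun y : Fin n => (y : ℕ) + 1 := fun a b hab => by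
    ext
    simpa using hab
  refine ⟨(List.range' 1 n).filter (· ∈ ys.map fun y : Fin n => (y : ℕ) + 1), ?_⟩
  have hp : (ys.map fun y : Fin n => (y : ℕ) + 1).Perm
      ((List.range' 1 n).filter (· ∈ ys.map fun y : Fin n => (y : ℕ) + 1)) := by
    rw [List.perm_ext_iff_of_nodup (h.map hinj) ((List.nodup_range' (step := 1)).filter _)]
    intro a
    simp only [List.mem_filter, List.mem_range'_1, decide_eq_true_eq, iff_and_self, List.mem_map]
    rintro ⟨y, -, rfl⟩
    omega
  refine ⟨List.mem_sublistsLen.2 ⟨List.filter_sublist, ?_⟩, hp⟩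
  rw [← hp.length_eq, List.length_map]

/-- The graph with an additional vertex joined to the vertices in `S`. -/
def extend (n : ℕ) (T S : List ℕ) : List ℕ := T ++ S.map fun s => 10 * s + (n + 1)

theorem map_dec_extend [NeZero n] (hn : n < 9) {T : List ℕ} (hT : T.all (validCode n) = true)
    {ys : List (Fin n)} {S : List ℕ} (hS : (ys.map fun y : Fin n => (y : ℕ) + 1).Perm S) :
    ((star ys (T.map (dec n))).map (Sym2.map finSuccEquivLast.symm)).Perm
      ((extend n T S).map (dec (n + 1))) := by
  rw [star, extend, List.map_append, List.map_append]
  refine List.perm_append_comm.trans (List.Perm.append (List.Perm.of_eq ?_) ?_)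
  · rw [List.map_map, List.map_map]
    refine List.map_congr_left fun c hc => ?_
    rw [dec_succ (List.all_eq_true.1 hT c hc)]
    simp only [Function.comp_apply, Sym2.map_map]
    congr 1
    funext i
    simp
  · refine List.Perm.trans (List.Perm.of_eq ?_) (((hS.map fun s => 10 * s + (n + 1))).map _)
    rw [List.map_map, List.map_map, List.map_map]
    refine List.map_congr_left fun y _ => ?_
    simp only [Function.comp_apply, dec_last hn, Sym2.map_mk]
    simp

/-- Removing a vertex of minimal valency. -/
theorem IsSimpleList.exists_extend [NeZero n] (hn : n < 9) {R : ℕ → List (List ℕ)}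
    (hR : ∀ d, D ≤ d → d * (n + 1) ≤ 2 * k → IsCover n (k - d) (d - 1) (R d))
    (hv : ∀ d, ∀ T ∈ R d, T.all (validCode n) = true)
    {l : List (Sym2 (Fin (n + 1)))} (hl : IsSimpleList k D l) :
    ∃ d, D ≤ d ∧ d * (n + 1) ≤ 2 * k ∧ ∃ T ∈ R d, ∃ S ∈ (List.range' 1 n).sublistsLen d,
      ∃ φ : Fin (n + 1) ≃ Fin (n + 1),
        (l.map (Sym2.map φ)).Perm ((extend n T S).map (dec (n + 1))) ∧
        ∀ v, d ≤ vdeg v ((extend n T S).map (dec (n + 1))) := by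
  obtain ⟨v, hvmin⟩ := Finite.exists_min fun v => vdeg v l
  have hd : D ≤ vdeg v l := hl.le_vdeg v
  -- The sum of the valencies is twice the number of edges, and each of the `n + 1` valencies is at
  -- least the minimal one.
  have hsum : vdeg v l * (n + 1) ≤ 2 * k := by
    rw [← hl.length_eq, ← sum_vdeg l hl.loopless]
    calc vdeg v l * (n + 1) = ∑ _ : Fin (n + 1), vdeg v l := by simp [mul_comm]
      _ ≤ _ := Finset.sum_le_sum fun u _ => hvmin u
  let σ := finSuccEquiv' v
  obtain ⟨hn', hl'⟩ := map_equiv_nodup_loopless σ hl.nodup hl.loopless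
  obtain ⟨ys, rest, hp⟩ := exists_perm_star _ hl'
  have hys : ys.length = vdeg v l := by
    rw [← vdeg_none_star ys rest, ← vdeg_perm _ hp, ← vdeg_map σ.injective v l]
    simp [σ]
  have hlen := hp.length_eq
  rw [List.length_map, length_star, hl.length_eq] at hlen
  have hnd := Nodup.of_star (hp.nodup_iff.1 hn')
  -- Deleting `v` lowers any other valency by at most one.
  have hrest : IsSimpleList (k - vdeg v l) (vdeg v l - 1) rest := by
    refine ⟨hnd.2, loopless_of_star fun e he => hl' e (hp.mem_iff.2 he), by omega, fun u => ?_⟩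
    have h₁ := hvmin (σ.symm (some u))
    rw [← vdeg_map σ.injective (σ.symm (some u)), Equiv.apply_symm_apply, vdeg_perm _ hp,
      vdeg_some_star] at h₁
    have h₂ := List.nodup_iff_count_le_one.1 hnd.1 u
    omega
  obtain ⟨T, hT, φ, hφ⟩ := hR _ hd hsum rest hrest
  obtain ⟨S, hS, hSp⟩ := exists_sublist_range' (ys.map φ) (hnd.1.map φ.injective)
  rw [List.length_map, hys] at hS
  have hperm : (l.map (Sym2.map ((σ.trans φ.optionCongr).trans finSuccEquivLast.symm))).Perm
      ((extend n T S).map (dec (n + 1))) := by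
    have h₁ : (l.map (Sym2.map ((σ.trans φ.optionCongr).trans finSuccEquivLast.symm)))
        = ((l.map (Sym2.map σ)).map (Sym2.map (Option.map φ))).map
          (Sym2.map finSuccEquivLast.symm) := by
      rw [List.map_map, List.map_map]
      refine List.map_congr_left fun e _ => ?_
      simp only [Function.comp_apply, Sym2.map_map]
      rfl
    rw [h₁]
    refine List.Perm.trans ?_ (map_dec_extend hn (hv _ T hT) hSp)
    refine List.Perm.map _ ((hp.map _).trans ?_)
    rw [star_map]
    exact List.Perm.append_left _ (hφ.map _)
  refine ⟨_, hd, hsum, T, hT, S, hS, _, hperm, fun u => ?_⟩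
  obtain ⟨u, rfl⟩ := ((σ.trans φ.optionCongr).trans finSuccEquivLast.symm).surjective u
  rw [← vdeg_perm _ hperm, vdeg_map (Equiv.injective _)]
  exact hvmin u

/-- The number of edges at the vertex with label `v`. -/
def codeDegree (v : ℕ) : List ℕ → ℕ
  | [] => 0
  | c :: l => bif Nat.beq (Nat.div c 10) v || Nat.beq (Nat.mod c 10) v then
      Nat.succ (codeDegree v l) else codeDegree v l

theorem codeDegree_cons (v c : ℕ) (l : List ℕ) : codeDegree v (c :: l) =
    bif Nat.beq (c / 10) v || Nat.beq (c % 10) v then codeDegree v l + 1 else codeDegree v l := rfl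

theorem mem_dec_iff [NeZero n] {c : ℕ} (hc : validCode n c = true) (v : Fin n) :
    v ∈ dec n c ↔ c / 10 = v + 1 ∨ c % 10 = v + 1 := by
  obtain ⟨h1, h2, h3, h4, -⟩ := validCode_iff.1 hc
  rw [dec, Sym2.mem_iff, Fin.ext_iff, Fin.ext_iff, Fin.val_ofNat, Fin.val_ofNat,
    Nat.mod_eq_of_lt (by omega), Nat.mod_eq_of_lt (by omega)]
  omega

theorem codeDegree_eq [NeZero n] {l : List ℕ} (hl : l.all (validCode n) = true) (v : Fin n) :
    codeDegree (v + 1) l = vdeg v (l.map (dec n)) := by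
  induction l with
  | nil => rfl
  | cons c l ih =>
    rw [List.all_cons, Bool.and_eq_true] at hl
    rw [codeDegree_cons, ih hl.2, List.map_cons, vdeg, vdeg, List.countP_cons]
    have h : (Nat.beq (c / 10) (v + 1) || Nat.beq (c % 10) (v + 1)) = decide (v ∈ dec n c) := by
      rw [Bool.eq_iff_iff, Bool.or_eq_true, Nat.beq_eq, Nat.beq_eq, decide_eq_true_eq,
        mem_dec_iff hl.1]
    rw [h]
    by_cases hv : v ∈ dec n c <;> simp [hv]

/-- Whether all valencies are at least `d`. -/
def hasMinDegree (n d : ℕ) (l : List ℕ) : Bool :=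
  (List.range' 1 n).all fun v => Nat.ble d (codeDegree v l)

theorem hasMinDegree_of [NeZero n] {l : List ℕ} (hl : l.all (validCode n) = true) {d : ℕ}
    (h : ∀ v, d ≤ vdeg v (l.map (dec n))) : hasMinDegree n d l = true := by
  rw [hasMinDegree, List.all_eq_true]
  intro v hv
  rw [List.mem_range'_1] at hv
  have := h ⟨v - 1, by omega⟩
  rw [← codeDegree_eq hl, Nat.sub_add_cancel hv.1] at this
  rwa [Nat.ble_eq]

/-- The graphs of minimal valency at least `d` that arise from a graph in `R` by adding a vertex
of valency `d`. -/
def extensions (n d : ℕ) (R : List (List ℕ)) : List (List ℕ) :=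
  (R.flatMap fun T => ((List.range' 1 n).sublistsLen d).map fun S => extend n T S).filter
    (hasMinDegree (n + 1) d)

/-- Check every entry of a list with the help of a list of certificates. -/
def checkAll {α : Type} (test : α → ℕ → Bool) : List α → List ℕ → Bool
  | [], _ => true
  | a :: l, q :: qs => test a q && checkAll test l qs
  | _ :: _, [] => false

theorem exists_of_checkAll {α : Type} {test : α → ℕ → Bool} {l : List α} {qs : List ℕ}
    (h : checkAll test l qs = true) : ∀ a ∈ l, ∃ q, test a q = true := by
  induction l generalizing qs with
  | nil => simp
  | cons a l ih =>
    cases qs with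
    | nil => cases h
    | cons q qs =>
      rw [checkAll, Bool.and_eq_true] at h
      exact List.forall_mem_cons.2 ⟨⟨q, h.1⟩, ih h.2⟩

theorem valid_extend (hn : n < 9) {T S : List ℕ} (hT : T.all (validCode n) = true) {d : ℕ}
    (hS : S ∈ (List.range' 1 n).sublistsLen d) : (extend n T S).all (validCode (n + 1)) = true := by
  rw [extend, List.all_append, Bool.and_eq_true]
  simp only [List.all_eq_true, validCode_iff, List.mem_map] at hT ⊢
  constructor
  · intro c hc
    have := hT c hc
    omega
  · rintro _ ⟨s, hs, rfl⟩
    have := (List.mem_sublistsLen.1 hS).1.subset hs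
    rw [List.mem_range'_1] at this
    omega

theorem mem_extensions [NeZero n] (hn : n < 9) {R : List (List ℕ)} {T S : List ℕ} (hTR : T ∈ R)
    (hT : T.all (validCode n) = true) {d : ℕ} (hS : S ∈ (List.range' 1 n).sublistsLen d)
    (h : ∀ v, d ≤ vdeg v ((extend n T S).map (dec (n + 1)))) : extend n T S ∈ extensions n d R := by
  rw [extensions, List.mem_filter, List.mem_flatMap]
  exact ⟨⟨T, hTR, List.mem_map_of_mem hS⟩, hasMinDegree_of (valid_extend hn hT hS) h⟩

/-- Whether the permutation encoded by `q` carries `l` to the graph of `R` with the index encoded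
by `q`. -/
def isoTest (n : ℕ) (R : List (List ℕ)) (l : List ℕ) (q : ℕ) : Bool :=
  (isoSign n l (R.getD (q / 10 ^ 9) []) (q % 10 ^ 9)).isSome && Nat.blt (q / 10 ^ 9) R.length

theorem exists_of_isoTest [NeZero n] {R : List (List ℕ)} {l : List ℕ} {q : ℕ}
    (h : isoTest n R l q = true) (hl : l.all (validCode n) = true) :
    ∃ T ∈ R, ∃ φ : Fin n ≃ Fin n, ((l.map (dec n)).map (Sym2.map φ)).Perm (T.map (dec n)) := by
  rw [isoTest, Bool.and_eq_true, Option.isSome_iff_exists, Nat.blt_eq] at h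
  obtain ⟨⟨b, hb⟩, hlt⟩ := h
  obtain ⟨φ, -, hφ⟩ := isoSign_spec hb hl
  refine ⟨_, ?_, φ, hφ⟩
  rw [List.getD_eq_getElem _ _ hlt]
  exact List.getElem_mem hlt

/-- One step of the enumeration: every graph extends a known representative by a vertex of minimal
valency `d`, and a certificate carries each extension to a representative in `R'`. -/
theorem isCover_succ [NeZero n] (hn : n < 9) (R : ℕ → List (List ℕ)) {R' : List (List ℕ)}
    (hR : ∀ d, D ≤ d → d * (n + 1) ≤ 2 * k → IsCover n (k - d) (d - 1) (R d) ∧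
      ∃ qs, checkAll (isoTest (n + 1) R') (extensions n d (R d)) qs = true)
    (hv : ∀ d, ∀ T ∈ R d, T.all (validCode n) = true) : IsCover (n + 1) k D R' := by
  intro l hl
  obtain ⟨d, hd, hd', T, hT, S, hS, φ, hφ, hdeg⟩ :=
    hl.exists_extend hn (fun d h h' => (hR d h h').1) hv
  obtain ⟨-, qs, hqs⟩ := hR d hd hd'
  obtain ⟨q, hq⟩ := exists_of_checkAll hqs _ (mem_extensions hn hT (hv _ T hT) hS hdeg)
  obtain ⟨T', hT', ψ, hψ⟩ := exists_of_isoTest hq (valid_extend hn (hv _ T hT) hS)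
  refine ⟨T', hT', φ.trans ψ, List.Perm.trans ?_ hψ⟩
  refine List.Perm.trans (List.Perm.of_eq ?_) (hφ.map (Sym2.map ψ))
  rw [List.map_map]
  refine List.map_congr_left fun e _ => ?_
  simp only [Function.comp_apply, Sym2.map_map]
  rfl

/-- In the last step no list of representatives is needed, since vanishing at all extensions
suffices. -/
theorem coeff_eq_zero_of_extensions [NeZero n] (hn : n < 9) (x : GraphSpace)
    (R : ℕ → List (List ℕ))
    (hR : ∀ d, D ≤ d → d * (n + 1) ≤ 2 * k → IsCover n (k - d) (d - 1) (R d) ∧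
      ∀ l ∈ extensions n d (R d), l.all (validCode (n + 1)) = true → coeff x (l.map (dec (n + 1))) = 0)
    (hv : ∀ d, ∀ T ∈ R d, T.all (validCode n) = true)
    {l : List (Sym2 (Fin (n + 1)))} (hl : IsSimpleList k D l) : coeff x l = 0 := by
  obtain ⟨d, hd, hd', T, hT, S, hS, φ, hφ, hdeg⟩ :=
    hl.exists_extend hn (fun d h h' => (hR d h h').1) hv
  rw [← coeff_map_equiv x φ, coeff_perm_eq_zero x hφ]
  exact (hR d hd hd').2 _ (mem_extensions hn hT (hv _ T hT) hS hdeg) (valid_extend hn (hv _ T hT) hS)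

end Cover

/-! ### The contraction formula evaluated with certificates. -/

section Rows

variable {n : ℕ}

/-- Whether two successive entries agree. -/
def hasRepetition : List ℕ → Bool
  | a :: b :: l => Nat.beq a b || hasRepetition (b :: l)
  | _ => false

theorem not_nodup_of_hasRepetition {l : List ℕ} (h : hasRepetition l = true) : ¬ l.Nodup := by
  induction l with
  | nil => cases h
  | cons a l ih =>
    cases l with
    | nil => cases h
    | cons b l =>
      rw [hasRepetition, Bool.or_eq_true] at h
      rcases h with h | h
      · simp [Nat.eq_of_beq_eq_true h]
      · exact fun hn => ih h hn.of_cons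

/-- The contraction of the edge with code `e` along the map of vertices encoded by `q`, where `l`
are the other edges. -/
def contractCodes (n e : ℕ) (l : List ℕ) (q : ℕ) : Option (Bool × List ℕ) :=
  bif Nat.beq (digit q (e / 10)) (digit q (e % 10)) && isOnto (n + 1) n q then
    some (sortSign (l.map (relabel q))) else none

theorem contractCodes_spec [NeZero n] {e : ℕ} {l : List ℕ} {q : ℕ} {r : Bool × List ℕ}
    (h : contractCodes n e l q = some r) (he : validCode (n + 1) e = true)
    (hl : l.all (validCode (n + 1)) = true) (x : GraphSpace) :
    contractTerm x (dec (n + 1) e) (l.map (dec (n + 1))) =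
      2 * (1 - freeEnds (dec (n + 1) e) (l.map (dec (n + 1)))) *
        (boolSign r.1 * coeff x (r.2.map (dec n))) := by
  rw [contractCodes] at h
  cases hc : Nat.beq (digit q (e / 10)) (digit q (e % 10)) && isOnto (n + 1) n q
  · simp only [hc, cond_false, reduceCtorEq] at h
  · rw [hc, cond_true, Option.some.injEq] at h
    rw [Bool.and_eq_true] at hc
    have hq : IsContraction (dec (n + 1) e) (labelMap (n + 1) n q) := by
      have hne := not_isDiag_dec he
      rw [dec, Sym2.mk_isDiag_iff] at hne
      refine isContraction_of_surjective (surjective_of_isOnto hc.2) hne ?_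
      obtain ⟨h1, h2, h3, h4, -⟩ := validCode_iff.1 he
      rw [labelMap, labelMap, Fin.val_ofNat, Fin.val_ofNat, Nat.mod_eq_of_lt (by omega),
        Nat.mod_eq_of_lt (by omega), Nat.sub_add_cancel h1, Nat.sub_add_cancel h3,
        Nat.eq_of_beq_eq_true hc.1]
    rw [contractTerm_eq x (not_isDiag_dec he) hq, ← map_dec_relabel q hl, ← h]
    congr 1
    exact coeff_sortSign x (dec n) (l.map (relabel q))

/-- The digits of the map that contracts the edge between `a < b` and fills the gap with the last
of the `m` labels. -/
def contractionDigits (m a b : ℕ) : ℕ :=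
  987654321 % 10 ^ m - (b - a) * 10 ^ (b - 1) - (m - b) * 10 ^ (m - 1)

/-- The contribution of contracting the edge `e` in terms of the coefficients of the graphs in
`tab`. The certificate `0` stands for a double edge, a certificate `q < 10 ^ 9` for an odd symmetry
of the contracted graph, and a certificate `(i + 1) * 10 ^ 9 + q` for a contraction onto the `i`-th
graph. -/
def termRow (tab : List (List ℕ)) (n e : ℕ) (l : List ℕ) (q : ℕ) : Option (List (Bool × ℕ)) :=
  match Nat.beq (codeDegree (e / 10) l) 0, Nat.beq (codeDegree (e % 10) l) 0 with
  | true, true => none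
  | true, false => some []
  | false, true => some []
  | false, false =>
    bif Nat.blt q (10 ^ 9) then
      match contractCodes n e l (contractionDigits (n + 1) (e / 10) (e % 10)) with
      | none => none
      | some (_, l') =>
        bif (bif Nat.beq q 0 then hasRepetition l' else
          l'.all (validCode n) && isOddSymmetry n l' q) then some [] else none
    else
      match contractCodes n e l (q % 10 ^ 9) with
      | none => none
      | some (b, l') =>
        bif listBeq l' (tab.getD (q / 10 ^ 9 - 1) []) then some [(b, q / 10 ^ 9 - 1)] else none

/-- The value of a signed sum of variables. -/
def rowSum (z : ℕ → ℝ) (r : List (Bool × ℕ)) : ℝ := (r.map fun p => boolSign p.1 * z p.2).sum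

theorem codeDegree_beq_zero [NeZero n] {l : List ℕ} (hl : l.all (validCode n) = true) {i : ℕ}
    (h1 : 0 < i) (h2 : i ≤ n) : Nat.beq (codeDegree i l) 0 = true ↔
      ∀ e ∈ l.map (dec n), Fin.ofNat n (i - 1) ∉ e := by
  have := codeDegree_eq hl (Fin.ofNat n (i - 1))
  rw [Fin.val_ofNat, Nat.mod_eq_of_lt (by omega), Nat.sub_add_cancel h1] at this
  rw [Nat.beq_eq, this, vdeg, List.countP_eq_zero]
  simp

/-- If both ends meet other edges, the factor is 2 and the contraction is either zero or in the
table. If exactly one end is free, the factor is zero. If both are free, the computation is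
rejected, so that case needs no value. -/
theorem termRow_spec [NeZero n] {tab : List (List ℕ)} {e : ℕ} {l : List ℕ} {q : ℕ}
    {r : List (Bool × ℕ)} (h : termRow tab n e l q = some r) (he : validCode (n + 1) e = true)
    (hl : l.all (validCode (n + 1)) = true) (x : GraphSpace) :
    contractTerm x (dec (n + 1) e) (l.map (dec (n + 1))) =
      2 * rowSum (fun i => coeff x ((tab.getD i []).map (dec n))) r := by
  classical
  obtain ⟨h1, h2, h3, h4, -⟩ := validCode_iff.1 he
  have hne := not_isDiag_dec he
  have hne' := hne
  rw [dec, Sym2.mk_isDiag_iff] at hne'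
  have hfree : freeEnds (dec (n + 1) e) (l.map (dec (n + 1))) =
      (if Nat.beq (codeDegree (e / 10) l) 0 = true then 1 else 0) +
      (if Nat.beq (codeDegree (e % 10) l) 0 = true then 1 else 0) := by
    rw [dec, freeEnds_mk hne']
    have k₁ := codeDegree_beq_zero hl h1 h2
    have k₂ := codeDegree_beq_zero hl h3 h4
    congr 1
    · by_cases hc : Nat.beq (codeDegree (e / 10) l) 0 = true
      · rw [if_pos hc, if_pos (k₁.1 hc)]
      · rw [if_neg hc, if_neg fun h => hc (k₁.2 h)]
    · by_cases hc : Nat.beq (codeDegree (e % 10) l) 0 = true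
      · rw [if_pos hc, if_pos (k₂.1 hc)]
      · rw [if_neg hc, if_neg fun h => hc (k₂.2 h)]
  have hzero : freeEnds (dec (n + 1) e) (l.map (dec (n + 1))) = 1 →
      contractTerm x (dec (n + 1) e) (l.map (dec (n + 1))) = 0 := by
    intro hf
    rw [contractTerm, if_neg hne, hf]
    ring
  rw [termRow] at h
  cases ha : Nat.beq (codeDegree (e / 10) l) 0 <;> cases hb : Nat.beq (codeDegree (e % 10) l) 0 <;>
    simp only [ha, hb] at h hfree
  · cases hq : Nat.blt q (10 ^ 9)
    · simp only [hq, cond_false] at h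
      cases hc : contractCodes n e l (q % 10 ^ 9) with
      | none => simp only [hc, reduceCtorEq] at h
      | some p =>
        obtain ⟨b, l'⟩ := p
        simp only [hc] at h
        cases ht : listBeq l' (tab.getD (q / 10 ^ 9 - 1) [])
        · simp only [ht, cond_false, reduceCtorEq] at h
        · simp only [ht, cond_true, Option.some.injEq] at h
          rw [contractCodes_spec hc he hl, hfree, ← h]
          simp only [rowSum, List.map_cons, List.map_nil, List.sum_cons, List.sum_nil]
          rw [← eq_of_listBeq ht]
          simp
    · simp only [hq, cond_true] at h
      -- The map is obtained from the digits `987654321` of the identity: the digit at place `b` is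
      -- lowered to `a`, and the digit at the last place to `b`. Its properties need no proof, as
      -- `contractCodes` tests it.
      cases hc : contractCodes n e l (contractionDigits (n + 1) (e / 10) (e % 10)) with
      | none => simp only [hc, reduceCtorEq] at h
      | some p =>
        obtain ⟨b, l'⟩ := p
        simp only [hc] at h
        have hx : coeff x (l'.map (dec n)) = 0 := by
          cases h0 : Nat.beq q 0
          · simp only [h0, cond_false] at h
            cases hv : l'.all (validCode n) && isOddSymmetry n l' q
            · simp only [hv, cond_false, reduceCtorEq] at h
            · rw [Bool.and_eq_true] at hv
              exact coeff_of_isOddSymmetry hv.2 hv.1 x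
          · simp only [h0, cond_true] at h
            cases hr : hasRepetition l'
            · simp only [hr, cond_false, reduceCtorEq] at h
            · exact coeff_eq_zero_of_not_nodup x fun hn => not_nodup_of_hasRepetition hr hn.of_map
        have hr : r = [] := by
          cases hv : (bif Nat.beq q 0 then hasRepetition l' else
            l'.all (validCode n) && isOddSymmetry n l' q)
          · simp only [hv, cond_false, reduceCtorEq] at h
          · simpa [hv] using h.symm
        rw [contractCodes_spec hc he hl, hx, hr]
        simp [rowSum]
  · rw [hzero (by simp [hfree])]
    simp only [Option.some.injEq] at h
    simp [← h, rowSum]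
  · rw [hzero (by simp [hfree])]
    simp only [Option.some.injEq] at h
    simp [← h, rowSum]
  · simp at h

/-- The value of the differential at the graph with edges `l₀ ++ l`, restricted to the
contractions of edges in `l`. -/
def sumRow (tab : List (List ℕ)) (n : ℕ) : List ℕ → List ℕ → List ℕ → Option (List (Bool × ℕ))
  | _, [], _ => some []
  | _, _ :: _, [] => none
  | l₀, e :: l, q :: qs =>
    match termRow tab n e (l₀ ++ l) q with
    | none => none
    | some r =>
      match sumRow tab n (l₀ ++ [e]) l qs with
      | none => none
      | some r' => some (r ++ r'.map fun p => (!p.1, p.2))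

theorem rowSum_append (z : ℕ → ℝ) (r r' : List (Bool × ℕ)) :
    rowSum z (r ++ r') = rowSum z r + rowSum z r' := by
  simp [rowSum]

theorem rowSum_neg (z : ℕ → ℝ) (r : List (Bool × ℕ)) :
    rowSum z (r.map fun p => (!p.1, p.2)) = -rowSum z r := by
  induction r with
  | nil => simp [rowSum]
  | cons p r ih =>
    simp only [rowSum, List.map_cons, List.sum_cons] at ih ⊢
    rw [ih]
    obtain ⟨_ | _, i⟩ := p <;> simp [boolSign] <;> ring

/-- The prefix `l₀` collects the edges already passed, since a contraction needs all other edges in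
their order. Each edge passed flips the sign, as in `altSum`. -/
theorem altSum_of_sumRow [NeZero n] {tab : List (List ℕ)} {l₀ l qs : List ℕ}
    {r : List (Bool × ℕ)} (h : sumRow tab n l₀ l qs = some r)
    (hl₀ : l₀.all (validCode (n + 1)) = true) (hl : l.all (validCode (n + 1)) = true)
    (x : GraphSpace) :
    altSum (fun e l' => contractTerm x e (l₀.map (dec (n + 1)) ++ l')) (l.map (dec (n + 1))) =
      2 * rowSum (fun i => coeff x ((tab.getD i []).map (dec n))) r := by
  induction l generalizing l₀ qs r with
  | nil =>
    simp only [sumRow, Option.some.injEq] at h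
    simp [← h, rowSum, altSum]
  | cons e l ih =>
    rw [List.all_cons, Bool.and_eq_true] at hl
    cases qs with
    | nil => simp [sumRow] at h
    | cons q qs =>
      rw [sumRow] at h
      cases h₁ : termRow tab n e (l₀ ++ l) q with
      | none => simp only [h₁, reduceCtorEq] at h
      | some r₁ =>
        cases h₂ : sumRow tab n (l₀ ++ [e]) l qs with
        | none => simp only [h₁, h₂, reduceCtorEq] at h
        | some r₂ =>
          simp only [h₁, h₂, Option.some.injEq] at h
          have e₁ := termRow_spec h₁ hl.1 (by rw [List.all_append, hl₀, hl.2]; rfl) x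
          have e₂ := ih h₂ (by rw [List.all_append, hl₀, List.all_cons, hl.1]; rfl) hl.2
          simp only [List.map_append, List.map_cons, List.map_nil, List.append_assoc,
            List.cons_append, List.nil_append] at e₁ e₂
          rw [List.map_cons, altSum, e₁, e₂, ← h, rowSum_append, rowSum_neg]
          ring

theorem coeff_d_of_sumRow [NeZero n] {tab : List (List ℕ)} {l qs : List ℕ} {r : List (Bool × ℕ)}
    (h : sumRow tab n [] l qs = some r) (hl : l.all (validCode (n + 1)) = true) (x : GraphSpace) :
    coeff (d x) (l.map (dec (n + 1))) =
      2 * rowSum (fun i => coeff x ((tab.getD i []).map (dec n))) r := by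
  rw [coeff_d, ← altSum_of_sumRow h rfl hl x]
  rfl

end Rows

/-! ### Solving the linear equations one variable at a time. -/

section Elimination

variable {n : ℕ}

/-- The entries of a number in base `B`, the least significant first. -/
def unpack (B : ℕ) : ℕ → ℕ → List ℕ
  | 0, _ => []
  | k + 1, N => force (Nat.mod N B) fun a => a :: force (Nat.div N B) (unpack B k)

/-- The linear form in the coefficients of the graphs in `tab` that gives the coefficient of the
differential at a graph with `k` edges, where `p` encodes the graph and the certificates for its
contractions. -/
def equationRow (tab : List (List ℕ)) (n k : ℕ) (p : ℕ × ℕ) : Option (List (Bool × ℕ)) :=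
  bif (unpack 100 k p.1).all (validCode (n + 1)) then
    sumRow tab n [] (unpack 100 k p.1) (unpack (10 ^ 12) k p.2)
  else none

theorem coeff_d_of_equationRow [NeZero n] {tab : List (List ℕ)} {k : ℕ} {p : ℕ × ℕ}
    {r : List (Bool × ℕ)} (h : equationRow tab n k p = some r) (x : GraphSpace) :
    coeff (d x) ((unpack 100 k p.1).map (dec (n + 1))) =
      2 * rowSum (fun i => coeff x ((tab.getD i []).map (dec n))) r := by
  rw [equationRow] at h
  cases hv : (unpack 100 k p.1).all (validCode (n + 1))
  · simp only [hv, cond_false, reduceCtorEq] at h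
  · rw [hv, cond_true] at h
    exact coeff_d_of_sumRow h hv x

/-- A linear combination of the linear forms given by a list of equations. -/
def combinedRow (tab : List (List ℕ)) (n k : ℕ) (eqs : List (ℕ × ℕ)) :
    List (ℤ × ℕ) → Option (List (ℤ × ℕ))
  | [] => some []
  | c :: cs =>
    match eqs[c.2]? with
    | none => none
    | some p =>
      match equationRow tab n k p with
      | none => none
      | some r =>
        match combinedRow tab n k eqs cs with
        | none => none
        | some r' => some (r.map (fun p => (boolSign p.1 * c.1, p.2)) ++ r')

/-- The value of a linear form. -/
def linearSum (z : ℕ → ℝ) (r : List (ℤ × ℕ)) : ℝ := (r.map fun p => p.1 * z p.2).sum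

theorem linearSum_append (z : ℕ → ℝ) (r r' : List (ℤ × ℕ)) :
    linearSum z (r ++ r') = linearSum z r + linearSum z r' := by
  simp [linearSum]

theorem linearSum_map_mul (z : ℕ → ℝ) (r : List (Bool × ℕ)) (m : ℤ) :
    linearSum z (r.map fun p => (boolSign p.1 * m, p.2)) = m * rowSum z r := by
  rw [rowSum, linearSum, ← List.sum_map_mul_left, List.map_map]
  congr 1
  refine List.map_congr_left fun p _ => ?_
  simp only [Function.comp_apply]
  push_cast
  ring

theorem linearSum_combinedRow [NeZero n] {tab : List (List ℕ)} {k : ℕ} {eqs : List (ℕ × ℕ)}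
    {cs : List (ℤ × ℕ)} {r : List (ℤ × ℕ)} (h : combinedRow tab n k eqs cs = some r)
    {x : GraphSpace} (hx : ∀ p ∈ eqs, coeff (d x) ((unpack 100 k p.1).map (dec (n + 1))) = 0) :
    linearSum (fun i => coeff x ((tab.getD i []).map (dec n))) r = 0 := by
  induction cs generalizing r with
  | nil =>
    simp only [combinedRow, Option.some.injEq] at h
    simp [← h, linearSum]
  | cons c cs ih =>
    rw [combinedRow] at h
    cases h₀ : eqs[c.2]? with
    | none => simp only [h₀, reduceCtorEq] at h
    | some p =>
      cases h₁ : equationRow tab n k p with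
      | none => simp only [h₀, h₁, reduceCtorEq] at h
      | some r₁ =>
        cases h₂ : combinedRow tab n k eqs cs with
        | none => simp only [h₀, h₁, h₂, reduceCtorEq] at h
        | some r₂ =>
          simp only [h₀, h₁, h₂, Option.some.injEq] at h
          have := coeff_d_of_equationRow h₁ x
          rw [hx p (List.mem_of_getElem? h₀)] at this
          rw [← h, linearSum_append, ih h₂, linearSum_map_mul]
          linear_combination (-(c.1 : ℝ) / 2) * this

/-- The coefficient of the `i`-th variable in a linear form. -/
def rowCoeff (i : ℕ) : List (ℤ × ℕ) → ℤ
  | [] => 0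
  | p :: r => bif Nat.beq p.2 i then p.1 + rowCoeff i r else rowCoeff i r

theorem rowCoeff_eq (i : ℕ) (r : List (ℤ × ℕ)) :
    rowCoeff i r = (r.map fun p => if p.2 = i then p.1 else 0).sum := by
  induction r with
  | nil => rfl
  | cons p r ih =>
    rw [rowCoeff, List.map_cons, List.sum_cons, ih]
    cases h : Nat.beq p.2 i
    · rw [cond_false, if_neg (Nat.ne_of_beq_eq_false h), zero_add]
    · rw [cond_true, if_pos (Nat.eq_of_beq_eq_true h)]

theorem linearSum_eq_sum (z : ℕ → ℝ) (r : List (ℤ × ℕ)) {S : Finset ℕ} (hS : ∀ p ∈ r, p.2 ∈ S) :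
    linearSum z r = ∑ i ∈ S, rowCoeff i r * z i := by
  induction r with
  | nil => simp [linearSum, rowCoeff]
  | cons p r ih =>
    have h₁ := ih fun p' hp' => hS p' (List.mem_cons_of_mem _ hp')
    rw [linearSum] at h₁ ⊢
    rw [List.map_cons, List.sum_cons, h₁]
    simp only [rowCoeff_eq, List.map_cons, List.sum_cons, Int.cast_add, add_mul,
      Finset.sum_add_distrib]
    congr 1
    rw [Finset.sum_eq_single_of_mem p.2 (hS p List.mem_cons_self)]
    · simp
    · intro i _ hi
      simp [hi.symm]

/-- Whether every variable in the linear form other than the `t`-th one is known to vanish or has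
coefficient zero, and the `t`-th one does not. -/
def isolates (known : List ℕ) (t : ℕ) (r : List (ℤ × ℕ)) : Bool :=
  !(rowCoeff t r == 0) &&
    r.all fun p => Nat.beq p.2 t || known.any (Nat.beq p.2) || rowCoeff p.2 r == 0

theorem eq_zero_of_isolates {known : List ℕ} {t : ℕ} {r : List (ℤ × ℕ)}
    (h : isolates known t r = true) {z : ℕ → ℝ} (hz : ∀ i ∈ known, z i = 0)
    (hr : linearSum z r = 0) : z t = 0 := by
  classical
  rw [isolates, Bool.and_eq_true] at h
  rw [linearSum_eq_sum z r (S := (insert t (r.map Prod.snd).toFinset)) (by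
    intro p hp
    simp only [Finset.mem_insert, List.mem_toFinset, List.mem_map]
    exact Or.inr ⟨p, hp, rfl⟩)] at hr
  rw [Finset.sum_eq_single_of_mem t (Finset.mem_insert_self _ _)] at hr
  · have h0 : rowCoeff t r ≠ 0 := by simpa using h.1
    exact (mul_eq_zero.1 hr).resolve_left (by exact_mod_cast h0)
  · intro i hi hit
    simp only [Finset.mem_insert, List.mem_toFinset, List.mem_map] at hi
    obtain ⟨p, hp, rfl⟩ := hi.resolve_left hit
    have := List.all_eq_true.1 h.2 p hp
    simp only [Bool.or_eq_true, Nat.beq_eq, List.any_eq_true, beq_iff_eq] at this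
    rcases this with (h | ⟨j, hj, h⟩) | h
    · exact absurd h hit
    · rw [h, hz j hj, mul_zero]
    · rw [h, Int.cast_zero, zero_mul]

/-- Whether the equations determine the variables one after another. -/
def eliminates (tab : List (List ℕ)) (n k : ℕ) (eqs : List (ℕ × ℕ)) :
    List ℕ → List (ℕ × List (ℤ × ℕ)) → Bool
  | _, [] => true
  | known, (t, cs) :: steps =>
    (match combinedRow tab n k eqs cs with
    | none => false
    | some r => isolates known t r) && eliminates tab n k eqs (t :: known) steps

/-- The system is solved in triangular form: each step produces an equation whose only undetermined
variable is `t`, which then joins the known ones. -/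
theorem coeff_eq_zero_of_eliminates [NeZero n] {tab : List (List ℕ)} {k : ℕ} {eqs : List (ℕ × ℕ)}
    {known : List ℕ} {steps : List (ℕ × List (ℤ × ℕ))}
    (h : eliminates tab n k eqs known steps = true) {x : GraphSpace}
    (hx : ∀ p ∈ eqs, coeff (d x) ((unpack 100 k p.1).map (dec (n + 1))) = 0)
    (hz : ∀ i ∈ known, coeff x ((tab.getD i []).map (dec n)) = 0) :
    ∀ i ∈ known ++ steps.map Prod.fst, coeff x ((tab.getD i []).map (dec n)) = 0 := by
  induction steps generalizing known with
  | nil => simpa using hz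
  | cons s steps ih =>
    obtain ⟨t, cs⟩ := s
    rw [eliminates, Bool.and_eq_true] at h
    have ht : coeff x ((tab.getD t []).map (dec n)) = 0 := by
      cases hc : combinedRow tab n k eqs cs with
      | none => simp [hc] at h
      | some r =>
        simp only [hc] at h
        exact eq_zero_of_isolates h.1 hz (linearSum_combinedRow hc hx)
    have := ih h.2 (List.forall_mem_cons.2 ⟨ht, hz⟩)
    intro i hi
    refine this i ?_
    simp only [List.map_cons, List.mem_append, List.mem_cons] at hi ⊢
    tauto

/-- Whether the graph `l` has an odd symmetry or is isomorphic to one of the graphs in `R`. -/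
def vanishTest (n : ℕ) (R : List (List ℕ)) (l : List ℕ) (q : ℕ) : Bool :=
  bif Nat.blt q (10 ^ 9) then isOddSymmetry n l q else isoTest n R l (q - 10 ^ 9)

theorem coeff_eq_zero_of_vanishTest [NeZero n] {R : List (List ℕ)} {l : List ℕ} {q : ℕ}
    (h : vanishTest n R l q = true) (hl : l.all (validCode n) = true) {x : GraphSpace}
    (hx : ∀ T ∈ R, coeff x (T.map (dec n)) = 0) : coeff x (l.map (dec n)) = 0 := by
  rw [vanishTest] at h
  cases hq : Nat.blt q (10 ^ 9)
  · rw [hq, cond_false] at h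
    obtain ⟨T, hT, φ, hφ⟩ := exists_of_isoTest h hl
    rw [← coeff_map_equiv x φ, coeff_perm_eq_zero x hφ, hx T hT]
  · rw [hq, cond_true] at h
    exact coeff_of_isOddSymmetry h hl x

end Elimination

/-! ### Exhaustive search for isomorphisms, and symmetry numbers. -/

section Search

variable {n : ℕ}

/-- Whether `l` lists the edges of a simple graph on the labels `1, …, n` in increasing order. -/
def isGraph (n : ℕ) (l : List ℕ) : Bool :=
  l.all (fun c => validCode n c && Nat.blt (c / 10) (c % 10)) && decide (l.Pairwise (· < ·))

/-- The set of the entries of a list, as a bit mask. -/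
def codeMask : List ℕ → ℕ
  | [] => 0
  | c :: l => 2 ^ c ||| codeMask l

/-- The sum of `f` over the neighbours with labels at most `u` of the vertex `v` in the graph with
the edge set `M`. -/
def neighbourSum (M v : ℕ) (f : ℕ → ℕ) : ℕ → ℕ
  | 0 => 0
  | u + 1 => neighbourSum M v f u + bif Nat.testBit M (edgeCode v (u + 1)) then f (u + 1) else 0

/-- A colouring of the vertices that is invariant under isomorphisms. -/
def colour (n M v : ℕ) : ℕ :=
  neighbourSum M v (fun u => 1000 + neighbourSum M u (fun _ => 1) n ^ 2) n

/-- Whether the partial map given by `p` on the labels `1, …, k` can be extended by `w ↦ v`. -/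
def compatible (M M' p w v : ℕ) : ℕ → Bool
  | 0 => true
  | i + 1 => !Nat.beq (digit p (i + 1)) v &&
      (Nat.testBit M (edgeCode (i + 1) w) == Nat.testBit M' (edgeCode (digit p (i + 1)) v)) &&
      compatible M M' p w v i

/-- The partial isomorphisms, defined on the labels `1, …, k`, from the graph with edge set `M` to
the graph with edge set `M'`. -/
def partialIsos (n M M' : ℕ) : ℕ → List ℕ
  | 0 => [0]
  | k + 1 => (partialIsos n M M' k).flatMap fun p =>
      ((List.range' 1 n).filter fun v => Nat.beq (colour n M (k + 1)) (colour n M' v) &&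
        compatible M M' p (k + 1) v k).map fun v => p + v * 10 ^ k

/-- The isomorphisms between two graphs, encoded by digits. -/
def isos (n : ℕ) (l l' : List ℕ) : List ℕ := partialIsos n (codeMask l) (codeMask l') n

theorem testBit_codeMask (l : List ℕ) (c : ℕ) : (codeMask l).testBit c = true ↔ c ∈ l := by
  induction l with
  | nil => simp [codeMask]
  | cons a l ih =>
    rw [codeMask, Nat.testBit_or, Bool.or_eq_true, ih, Nat.testBit_two_pow, decide_eq_true_eq,
      List.mem_cons, eq_comm]

/-- The number whose decimal digits are the values of a map of vertices at `0, …, k - 1`. -/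
def encode (φ : Fin n → Fin n) : ℕ → ℕ
  | 0 => 0
  | k + 1 => encode φ k + (if h : k < n then (φ ⟨k, h⟩ : ℕ) + 1 else 0) * 10 ^ k

theorem encode_lt (hn : n < 10) (φ : Fin n → Fin n) (k : ℕ) : encode φ k < 10 ^ k := by
  induction k with
  | zero => simp [encode]
  | succ k ih =>
    rw [encode, pow_succ]
    have : (if h : k < n then (φ ⟨k, h⟩ : ℕ) + 1 else 0) ≤ 9 := by
      split_ifs <;> omega
    nlinarith

theorem digit_encode (hn : n < 10) (φ : Fin n → Fin n) (k : ℕ) (i : Fin n) (hi : (i : ℕ) < k) :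
    digit (encode φ k) (i + 1) = φ i + 1 := by
  induction k with
  | zero => omega
  | succ k ih =>
    rw [digit_eq, encode, Nat.add_sub_cancel]
    have h10 : 0 < 10 ^ (i : ℕ) := by positivity
    rcases Nat.lt_succ_iff_lt_or_eq.1 hi with h | h
    · obtain ⟨t, rfl⟩ : ∃ t, k = i + 1 + t := ⟨k - (i + 1), by omega⟩
      rw [show ∀ v, v * 10 ^ ((i : ℕ) + 1 + t) = (v * 10 ^ t * 10) * 10 ^ (i : ℕ) by intro v; ring,
        Nat.add_mul_div_right _ _ h10, Nat.add_mul_mod_self_right]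
      have := ih h
      rwa [digit_eq, Nat.add_sub_cancel] at this
    · subst h
      rw [Nat.add_mul_div_right _ _ h10, Nat.div_eq_of_lt (encode_lt hn φ _), dif_pos i.2, zero_add,
        Nat.mod_eq_of_lt]
      have := (φ i).2
      omega

theorem encode_injective (hn : n < 10) {φ ψ : Fin n → Fin n} (h : encode φ n = encode ψ n) :
    φ = ψ := by
  funext i
  have h₁ := digit_encode hn φ n i i.2
  rw [h, digit_encode hn ψ n i i.2] at h₁
  exact Fin.ext (by omega)

/-- `φ` is an isomorphism of the graphs with edge sets `M` and `M'`. -/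
def IsMaskIso (M M' : ℕ) (φ : Fin n ≃ Fin n) : Prop :=
  ∀ i j : Fin n, Nat.testBit M (edgeCode (i + 1) (j + 1)) =
    Nat.testBit M' (edgeCode (φ i + 1) (φ j + 1))

theorem neighbourSum_eq (M v : ℕ) (f : ℕ → ℕ) (n : ℕ) : neighbourSum M v f n =
    ∑ u : Fin n, bif Nat.testBit M (edgeCode v (u + 1)) then f (u + 1) else 0 := by
  induction n with
  | zero => rfl
  | succ n ih => rw [neighbourSum, ih, Fin.sum_univ_castSucc]; rfl

theorem IsMaskIso.neighbourSum_eq {M M' : ℕ} {φ : Fin n ≃ Fin n} (h : IsMaskIso M M' φ) (i : Fin n)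
    {f g : ℕ → ℕ} (hfg : ∀ j : Fin n, f (j + 1) = g (φ j + 1)) :
    neighbourSum M (i + 1) f n = neighbourSum M' (φ i + 1) g n := by
  rw [GraphComplex.neighbourSum_eq, GraphComplex.neighbourSum_eq]
  refine Fintype.sum_equiv φ _ _ fun j => ?_
  rw [h i j, hfg j]

theorem IsMaskIso.colour_eq {M M' : ℕ} {φ : Fin n ≃ Fin n} (h : IsMaskIso M M' φ) (i : Fin n) :
    colour n M (i + 1) = colour n M' (φ i + 1) :=
  h.neighbourSum_eq i fun j => by rw [h.neighbourSum_eq j (g := fun _ => 1) fun _ => rfl]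

theorem IsMaskIso.compatible (hn : n < 10) {M M' : ℕ} {φ : Fin n ≃ Fin n} (h : IsMaskIso M M' φ)
    {m : ℕ} (hm : m < n) {k : ℕ} (hk : k ≤ m) :
    compatible M M' (encode φ m) (m + 1) (φ ⟨m, hm⟩ + 1) k = true := by
  induction k with
  | zero => rfl
  | succ k ih =>
    have hd := digit_encode hn φ m ⟨k, by omega⟩ hk
    simp only at hd
    rw [GraphComplex.compatible, hd, ih (by omega), h ⟨k, by omega⟩ ⟨m, hm⟩]
    simp only [beq_self_eq_true, Bool.and_true, Bool.not_eq_true']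
    refine Bool.eq_false_iff.2 fun hc => ?_
    have h₁ := Nat.eq_of_beq_eq_true hc
    have h₂ : φ ⟨k, by omega⟩ = φ ⟨m, hm⟩ := Fin.ext (by omega)
    have h₃ := φ.injective h₂
    simp only [Fin.mk.injEq] at h₃
    omega

/-- The restrictions of an isomorphism survive the pruning, because colours are invariant and
adjacency is preserved. This completeness is what proves non-isomorphism; it is not claimed that all
codes found are isomorphisms. -/
theorem IsMaskIso.encode_mem (hn : n < 10) {M M' : ℕ} {φ : Fin n ≃ Fin n} (h : IsMaskIso M M' φ)
    {k : ℕ} (hk : k ≤ n) : encode φ k ∈ partialIsos n M M' k := by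
  induction k with
  | zero => simp [encode, partialIsos]
  | succ k ih =>
    rw [partialIsos, List.mem_flatMap]
    refine ⟨_, ih (by omega), List.mem_map.2 ⟨φ ⟨k, by omega⟩ + 1, ?_, ?_⟩⟩
    · rw [List.mem_filter, List.mem_range'_1, Bool.and_eq_true, h.compatible hn (by omega) le_rfl,
        Nat.beq_eq, ← h.colour_eq ⟨k, by omega⟩]
      refine ⟨?_, rfl, rfl⟩
      omega
    · rw [encode, dif_pos (show k < n by omega)]

theorem isGraph_iff {l : List ℕ} : isGraph n l = true ↔
    (∀ c ∈ l, validCode n c = true ∧ c / 10 < c % 10) ∧ l.Pairwise (· < ·) := by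
  rw [isGraph, Bool.and_eq_true, List.all_eq_true, decide_eq_true_eq]
  simp only [Bool.and_eq_true, Nat.blt_eq]

theorem all_validCode_of_isGraph {l : List ℕ} (h : isGraph n l = true) : l.all (validCode n) = true :=
  List.all_eq_true.2 fun c hc => ((isGraph_iff.1 h).1 c hc).1

theorem dec_eq_iff [NeZero n] (hn : n < 10) {c : ℕ} (hc : validCode n c = true)
    (hc' : c / 10 < c % 10) (i j : Fin n) :
    dec n c = s(i, j) ↔ c = edgeCode (i + 1) (j + 1) := by
  obtain ⟨h1, h2, h3, h4, -⟩ := validCode_iff.1 hc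
  rw [dec, Sym2.eq_iff, Fin.ext_iff, Fin.ext_iff, Fin.ext_iff, Fin.ext_iff, Fin.val_ofNat,
    Fin.val_ofNat, Nat.mod_eq_of_lt (by omega), Nat.mod_eq_of_lt (by omega), edgeCode_eq]
  cases h : Nat.blt (i + 1) (j + 1)
  · have := Bool.eq_false_iff.1 h
    rw [Ne, Nat.blt_eq] at this
    rw [cond_false]
    omega
  · rw [Nat.blt_eq] at h
    rw [cond_true]
    omega

theorem mem_map_dec_iff [NeZero n] (hn : n < 10) {l : List ℕ} (hl : isGraph n l = true)
    (i j : Fin n) : s(i, j) ∈ l.map (dec n) ↔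
      (codeMask l).testBit (edgeCode (i + 1) (j + 1)) = true := by
  rw [testBit_codeMask, List.mem_map]
  have h := (isGraph_iff.1 hl).1
  constructor
  · rintro ⟨c, hc, h'⟩
    rwa [← (dec_eq_iff hn (h c hc).1 (h c hc).2 i j).1 h']
  · intro hc
    exact ⟨_, hc, (dec_eq_iff hn (h _ hc).1 (h _ hc).2 i j).2 rfl⟩

theorem nodup_map_dec [NeZero n] (hn : n < 10) {l : List ℕ} (hl : isGraph n l = true) :
    (l.map (dec n)).Nodup := by
  have h := isGraph_iff.1 hl
  refine List.Nodup.map_on (fun a ha b hb hab => ?_) (h.2.imp fun h => h.ne)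
  induction hd : dec n a with | _ i j =>
  rw [(dec_eq_iff hn (h.1 a ha).1 (h.1 a ha).2 i j).1 hd,
    (dec_eq_iff hn (h.1 b hb).1 (h.1 b hb).2 i j).1 (hab ▸ hd)]

theorem encode_mem_isos [NeZero n] (hn : n < 10) {l l' : List ℕ} (hl : isGraph n l = true)
    (hl' : isGraph n l' = true) {φ : Fin n ≃ Fin n}
    (h : ∀ i j, s(i, j) ∈ l.map (dec n) ↔ s(φ i, φ j) ∈ l'.map (dec n)) :
    encode φ n ∈ isos n l l' := by
  refine IsMaskIso.encode_mem hn (fun i j => ?_) le_rfl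
  rw [Bool.eq_iff_iff, ← mem_map_dec_iff hn hl, ← mem_map_dec_iff hn hl', h]

theorem mem_iff_of_map_perm {V : Type} {φ : V ≃ V} {l l' : List (Sym2 V)}
    (h : (l.map (Sym2.map φ)).Perm l') (i j : V) : s(i, j) ∈ l ↔ s(φ i, φ j) ∈ l' := by
  rw [← h.mem_iff, ← Sym2.map_mk, List.mem_map_of_injective (Sym2.map.injective φ.injective)]

variable {k : ℕ}

theorem coeff_cls_eq_zero_of_isos [NeZero n] (hn : n < 10) {l l' : List ℕ}
    (hl : isGraph n l = true) (hl' : isGraph n l' = true) (h : isos n l l' = [])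
    {g : OrderedGraph (Fin n) k} (hg : List.ofFn g.edge = l'.map (dec n)) :
    coeff g.cls (l.map (dec n)) = 0 := by
  by_contra hc
  obtain ⟨φ, hφ⟩ := exists_equiv_of_coeff_cls_ne_zero hc
  rw [hg] at hφ
  have := encode_mem_isos hn hl hl' (mem_iff_of_map_perm hφ)
  rw [h] at this
  simp at this

theorem isEmpty_iso_of_isos [NeZero n] (hn : n < 10) {l l' : List ℕ}
    (hl : isGraph n l = true) (hl' : isGraph n l' = true) (h : isos n l l' = [])
    {g g' : OrderedGraph (Fin n) k} (hg : List.ofFn g.edge = l.map (dec n))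
    (hg' : List.ofFn g'.edge = l'.map (dec n)) :
    IsEmpty (g.toSimpleGraph ≃g g'.toSimpleGraph) := by
  refine ⟨fun φ => ?_⟩
  have := encode_mem_isos hn hl hl' (φ := φ.toEquiv) fun i j => by
    rw [← hg, ← hg', ← toSimpleGraph_adj, ← toSimpleGraph_adj]
    exact φ.map_rel_iff.symm
  rw [h] at this
  simp at this

/-- The sequence of edges of `a` recognised in the list `l`, as a sign. -/
noncomputable def listSign {E : Type*} (a : Fin k → E) (l : List E) : ℝ :=
  if h : l.length = k then matchSign (fun i => l.get (Fin.cast h.symm i)) a else 0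

theorem listSign_ofFn {E : Type*} (a b : Fin k → E) : listSign a (List.ofFn b) = matchSign b a := by
  rw [listSign, dif_pos (List.length_ofFn)]
  congr 1
  funext i
  simp

theorem listSign_swap {E : Type*} (a : Fin k → E) (l₁ l₂ : List E) (b c : E) :
    listSign a (l₁ ++ b :: c :: l₂) = -listSign a (l₁ ++ c :: b :: l₂) := by
  refine apply_get_swap (fun m (b : Fin m → E) =>
    if h : m = k then matchSign (fun i => b (Fin.cast h.symm i)) a else 0) ?_ l₁ l₂ b c
  intro m b i j hij
  by_cases h : m = k
  · subst h
    rw [dif_pos rfl, dif_pos rfl]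
    have := matchSign_comp_left b a (Equiv.swap i j)
    rw [Equiv.Perm.sign_swap hij] at this
    refine Eq.trans this ?_
    simp
  · rw [dif_neg h, dif_neg h, neg_zero]

theorem matchSign_self {E : Type*} {a : Fin k → E} (ha : Function.Injective a) :
    matchSign a a = 1 := by
  classical
  have : (Matrix.of fun i j => if a i = a j then (1 : ℝ) else 0) = 1 := by
    ext i j
    rw [Matrix.of_apply, Matrix.one_apply]
    simp only [ha.eq_iff]
  rw [← Matrix.det_one (n := Fin k) (R := ℝ), ← this, matchSign]

/-- The number with the same first `n` digits as `q`. -/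
def truncateDigits (q : ℕ) : ℕ → ℕ
  | 0 => 0
  | k + 1 => truncateDigits q k + digit q (k + 1) * 10 ^ k

/-- Whether all symmetries of the graph `l` induce even permutations of the edges and their number
is `m`. -/
def hasEvenSymmetries (n m : ℕ) (l : List ℕ) : Bool :=
  (isos n l l).all (fun q => (match isoSign n l l q with
    | some b => !b
    | none => false) && Nat.beq (truncateDigits q n) q) &&
  decide (isos n l l).Nodup && Nat.beq (isos n l l).length m

theorem labelMap_encode [NeZero n] (hn : n < 10) (φ : Fin n → Fin n) :
    labelMap n n (encode φ n) = φ := by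
  funext i
  rw [labelMap, digit_encode hn φ n i i.2, Nat.add_sub_cancel]
  exact Fin.ext (by rw [Fin.val_ofNat, Nat.mod_eq_of_lt (φ i).2])

theorem digit_of_isOnto {m q : ℕ} (h : isOnto m n q = true) {i : ℕ} (hi : i < m) :
    1 ≤ digit q (i + 1) ∧ digit q (i + 1) ≤ n := by
  have hb := (testBit_digitMask q m (digit q (i + 1))).2 ⟨i, hi, rfl⟩
  rw [Nat.eq_of_beq_eq_true h,
    show 2 ^ (n + 1) - 2 = 2 * (2 ^ n - 1) by rw [pow_succ]; omega] at hb
  cases hd : digit q (i + 1) with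
  | zero => simp [hd] at hb
  | succ j =>
    rw [hd, Nat.testBit_succ, Nat.mul_div_cancel_left _ (by norm_num),
      Nat.testBit_two_pow_sub_one, decide_eq_true_eq] at hb
    omega

theorem encode_labelMap [NeZero n] {q : ℕ} (h : isOnto n n q = true) {k : ℕ} (hk : k ≤ n) :
    encode (labelMap n n q) k = truncateDigits q k := by
  induction k with
  | zero => rfl
  | succ k ih =>
    have := digit_of_isOnto h hk
    rw [encode, truncateDigits, ih (by omega), dif_pos (show k < n by omega), labelMap,
      Fin.val_ofNat, Nat.mod_eq_of_lt (by simp only; omega)]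
    simp only
    rw [Nat.sub_add_cancel this.1]

/-- The nonzero terms of the pairing belong to the symmetries. The search finds all of them, and
when all are even each contributes 1, so the coefficient is their number. -/
theorem coeff_cls_self [NeZero n] (hn : n < 10) {l : List ℕ} (hl : isGraph n l = true) {m : ℕ}
    (h : hasEvenSymmetries n m l = true) {g : OrderedGraph (Fin n) k}
    (hg : List.ofFn g.edge = l.map (dec n)) : coeff g.cls (l.map (dec n)) = m := by
  classical
  simp only [hasEvenSymmetries, Bool.and_eq_true, decide_eq_true_eq, List.all_eq_true,
    Nat.beq_eq] at h
  obtain ⟨⟨h₁, h₂⟩, h₃⟩ := h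
  rw [← hg, coeff_ofFn, pairing_cls]
  have hmem : ∀ φ : Fin n ≃ Fin n, matchSign (fun i => (g.edge i).map φ) g.edge ≠ 0 →
      encode φ n ∈ isos n l l := by
    intro φ hφ
    refine encode_mem_isos hn hl hl (mem_iff_of_map_perm ?_)
    rw [← hg, List.map_ofFn]
    exact perm_of_matchSign_ne_zero hφ
  have hone : ∀ φ : Fin n ≃ Fin n, encode φ n ∈ isos n l l →
      matchSign (fun i => (g.edge i).map φ) g.edge = 1 := by
    intro φ hφ
    obtain ⟨h₄, -⟩ := h₁ _ hφ
    cases hb : isoSign n l l (encode φ n) with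
    | none => simp [hb] at h₄
    | some b =>
      obtain rfl : b = false := by simpa [hb] using h₄
      -- The relabelled list sorts to `l` itself with even parity, so its sign relative to `g.edge`
      -- is that of `g.edge` relative to itself, namely 1.
      have h₅ := map_dec_relabel (n := n) (encode φ n) (all_validCode_of_isGraph hl)
      rw [labelMap_encode hn, ← hg, List.map_ofFn] at h₅
      have h₆ := apply_sortSign (listSign_swap g.edge) (dec n) (l.map (relabel (encode φ n))) []
      rw [(eq_of_isoSign hb).2, List.nil_append, h₅, listSign_ofFn, List.nil_append, ← hg,
        listSign_ofFn, matchSign_self g.injective] at h₆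
      simpa [boolSign, Function.comp_def] using h₆
  -- For the exact count the codes found must come from permutations. `isoSign` tests bijectivity,
  -- and the comparison with `truncateDigits` excludes superfluous digits.
  have hsurj : ∀ q ∈ isos n l l, ∃ φ : Fin n ≃ Fin n, encode φ n = q := by
    intro q hq
    obtain ⟨h₄, h₅⟩ := h₁ _ hq
    cases hb : isoSign n l l q with
    | none => simp [hb] at h₄
    | some b =>
      have h₆ := (eq_of_isoSign hb).1
      exact ⟨Equiv.ofBijective _ (bijective_of_isOnto h₆), by
        rw [Equiv.coe_ofBijective, encode_labelMap h₆ le_rfl, h₅]⟩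
  have hfilter : (Finset.univ.filter fun φ : Fin n ≃ Fin n =>
      matchSign (fun i => (g.edge i).map φ) g.edge ≠ 0).image (fun φ : Fin n ≃ Fin n => encode φ n)
        = (isos n l l).toFinset := by
    ext q
    simp only [Finset.mem_image, Finset.mem_filter, Finset.mem_univ, true_and, List.mem_toFinset]
    constructor
    · rintro ⟨φ, hφ, rfl⟩
      exact hmem φ hφ
    · intro hq
      obtain ⟨φ, rfl⟩ := hsurj q hq
      exact ⟨φ, by rw [hone φ hq]; exact one_ne_zero, rfl⟩
  rw [← Finset.sum_filter_ne_zero, Finset.sum_congr rfl fun φ hφ =>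
    hone φ (hmem φ (Finset.mem_filter.1 hφ).2), Finset.sum_const, nsmul_one, ← h₃,
    ← List.toFinset_card_of_nodup h₂, ← hfilter, Finset.card_image_of_injective]
  intro φ ψ hφψ
  exact DFunLike.coe_injective (encode_injective hn hφψ)

/-- An odd symmetry makes the class equal to its negative, hence zero. -/
theorem not_isZeroGraph_of_coeff_ne_zero {g : OrderedGraph (Fin n) k}
    (h : coeff g.cls (List.ofFn g.edge) ≠ 0) : ¬ g.IsZeroGraph := by
  rintro ⟨φ, τ, hg, hτ⟩
  apply h
  have h₁ : g.cls = 0 := by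
    have := cls_reorder (g.map φ) τ
    rw [hg, cls_map, hτ] at this
    simp only [Units.val_neg, Units.val_one, Int.cast_neg, Int.cast_one, neg_smul, one_smul] at this
    have h₂ : (2 : ℝ) • g.cls = 0 := by
      rw [two_smul]
      nth_rewrite 1 [this]
      exact neg_add_cancel _
    exact (smul_eq_zero.1 h₂).resolve_left two_ne_zero
  rw [h₁, coeff_zero]

end Search

/-! ### Expansions of graphs: the inverse of edge contraction. -/

section Splits

variable {V W : Type} {n : ℕ}

/-- The edges upstairs can be reordered so that their images are literally the given list, which can
then be lifted entry by entry. -/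
theorem exists_perm_map_eq {α β : Type*} {f : α → β} {l : List α} {m : List β}
    (h : (l.map f).Perm m) : ∃ l', l.Perm l' ∧ l'.map f = m := by
  have h₁ : List.Forall₂ (fun a b => f a = b) l (l.map f) := by
    rw [List.forall₂_map_right_iff]
    exact List.forall₂_same.2 fun _ _ => rfl
  have h₂ : Relation.Comp (List.Forall₂ fun a b => f a = b) List.Perm l m := ⟨_, h₁, h⟩
  rw [List.forall₂_comp_perm_eq_perm_comp_forall₂] at h₂
  obtain ⟨l', hl', h₃⟩ := h₂
  refine ⟨l', hl', ?_⟩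
  rw [← List.forall₂_eq_eq_eq, List.forall₂_map_left_iff]
  exact h₃

/-- The first edge in the list that contains `a` or `b` contains `a`. -/
def Precedes (a b : V) : List (Sym2 V) → Prop
  | [] => True
  | e :: l => a ∈ e ∨ (b ∉ e ∧ Precedes a b l)

/-- The two ends of a contracted edge are interchangeable. Naming them so that the first edge at
either end is an edge at `a` avoids listing mirror images among the expansions. -/
theorem precedes_total (a b : V) (l : List (Sym2 V)) : Precedes a b l ∨ Precedes b a l := by
  induction l with
  | nil => exact Or.inl trivial
  | cons e l ih =>
    rw [Precedes, Precedes]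
    tauto

theorem precedes_map (φ : V ≃ W) (a b : V) (l : List (Sym2 V)) :
    Precedes (φ a) (φ b) (l.map (Sym2.map φ)) ↔ Precedes a b l := by
  have h : ∀ (a : V) e, φ a ∈ Sym2.map φ e ↔ a ∈ e := by
    intro a e
    simp [Sym2.mem_map]
  induction l with
  | nil => exact Iff.rfl
  | cons e l ih => exact or_congr (h a e) (and_congr (not_congr (h b e)) ih)

/-- Whether the code denotes an edge at the vertex with label `v`. -/
def touches (v c : ℕ) : Bool := Nat.beq (c / 10) v || Nat.beq (c % 10) v

/-- Whether the first edge that touches one of the vertices with labels `v` and `w` touches `v`. -/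
def precedes (v w : ℕ) : List ℕ → Bool
  | [] => true
  | c :: l => touches v c || (!touches w c && precedes v w l)

theorem precedes_iff [NeZero n] {l : List ℕ} (hl : l.all (validCode n) = true) (v w : Fin n) :
    precedes (v + 1) (w + 1) l = true ↔ Precedes v w (l.map (dec n)) := by
  induction l with
  | nil => exact iff_of_true rfl trivial
  | cons c l ih =>
    rw [List.all_cons, Bool.and_eq_true] at hl
    rw [List.map_cons, precedes, Precedes, mem_dec_iff hl.1, mem_dec_iff hl.1, ← ih hl.2]
    simp only [touches, Bool.or_eq_true, Nat.beq_eq, Bool.and_eq_true, Bool.not_eq_true',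
      ← Bool.not_eq_true, not_or]

/-- The lifts of the edge with code `c` when an end of a new edge with labels `v` and `N` is
contracted to `v`. -/
def liftCodes (v N c : ℕ) : List ℕ :=
  c :: (bif Nat.beq (c / 10) v then [10 * (c % 10) + N] else
    bif Nat.beq (c % 10) v then [10 * (c / 10) + N] else [])

/-- The lifts of a list of edges. -/
def splits (v N : ℕ) : List ℕ → List (List ℕ)
  | [] => [[]]
  | c :: l => (splits v N l).flatMap fun s => (liftCodes v N c).map (· :: s)

theorem mem_liftCodes {v N c c' : ℕ} : c' ∈ liftCodes v N c ↔ c' = c ∨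
    (c / 10 = v ∧ c' = 10 * (c % 10) + N) ∨ (c / 10 ≠ v ∧ c % 10 = v ∧ c' = 10 * (c / 10) + N) := by
  rw [liftCodes, List.mem_cons]
  refine or_congr Iff.rfl ?_
  cases h : Nat.beq (c / 10) v
  · cases h' : Nat.beq (c % 10) v
    · simp [Nat.ne_of_beq_eq_false h, Nat.ne_of_beq_eq_false h']
    · simp [Nat.ne_of_beq_eq_false h, Nat.eq_of_beq_eq_true h']
  · simp [Nat.eq_of_beq_eq_true h]

theorem validCode_of_mem_liftCodes (hn : n < 9) {v c c' : ℕ} (hc : validCode n c = true)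
    (h : c' ∈ liftCodes v (n + 1) c) : validCode (n + 1) c' = true := by
  rw [validCode_iff] at hc ⊢
  rcases mem_liftCodes.1 h with rfl | ⟨-, rfl⟩ | ⟨-, -, rfl⟩ <;> omega

theorem valid_of_mem_splits (hn : n < 9) {v : ℕ} {T s : List ℕ} (hT : T.all (validCode n) = true)
    (h : s ∈ splits v (n + 1) T) : s.all (validCode (n + 1)) = true := by
  induction T generalizing s with
  | nil =>
    rw [splits, List.mem_singleton] at h
    rw [h]
    rfl
  | cons c T ih =>
    rw [List.all_cons, Bool.and_eq_true] at hT
    rw [splits, List.mem_flatMap] at h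
    obtain ⟨s', hs', h⟩ := h
    obtain ⟨c', hc', rfl⟩ := List.mem_map.1 h
    rw [List.all_cons, ih hT.2 hs', validCode_of_mem_liftCodes hn hT.1 hc']
    rfl

/-- The bijection that sends `b` to the last vertex and the other vertices along the contraction. -/
theorem IsContraction.exists_equiv {a b : V} (hab : a ≠ b) {q : V → Fin n}
    (hq : IsContraction s(a, b) q) : ∃ σ : V ≃ Fin (n + 1), σ b = Fin.last n ∧
      ∀ u, u ≠ b → σ u = (q u).castSucc := by
  classical
  have hqab : q a = q b := (hq.ker a b).2 (by simp)
  have hbij : Function.Bijective fun u => if u = b then Fin.last n else (q u).castSucc := by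
    constructor
    · intro u w h
      simp only at h
      split_ifs at h with h₁ h₂ h₂
      · rw [h₁, h₂]
      · exact absurd h.symm (Fin.castSucc_ne_last _)
      · exact absurd h (Fin.castSucc_ne_last _)
      · have := (hq.ker u w).1 (Fin.castSucc_injective _ h)
        simp only [Sym2.mem_iff, h₁, h₂, or_false] at this
        rcases this with h | ⟨rfl, rfl⟩
        · exact h
        · rfl
    · intro j
      induction j using Fin.lastCases with
      | last => exact ⟨b, if_pos rfl⟩
      | cast j =>
        obtain ⟨u, rfl⟩ := hq.surj j
        by_cases hu : u = b
        · refine ⟨a, ?_⟩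
          simp only
          rw [if_neg hab, hqab, hu]
        · exact ⟨u, if_neg hu⟩
  exact ⟨Equiv.ofBijective _ hbij, if_pos rfl, fun u hu => if_neg hu⟩

/-- An edge at `b` becomes an edge at the new label `n + 1` while its other end keeps its label;
every other edge keeps its code. -/
theorem exists_liftCode [NeZero n] (hn : n < 9) {b : V} {q : V → Fin n} {σ : V ≃ Fin (n + 1)}
    (hb : σ b = Fin.last n) (hσ : ∀ u, u ≠ b → σ u = (q u).castSucc) {c : ℕ}
    (hc : validCode n c = true) {e : Sym2 V} (he : e.map q = dec n c) :
    ∃ c' ∈ liftCodes (q b + 1) (n + 1) c, dec (n + 1) c' = e.map σ := by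
  have hdiag := not_isDiag_dec hc
  have key : ∀ w, w ≠ b → s(q b, q w) = dec n c →
      ∃ c' ∈ liftCodes (q b + 1) (n + 1) c, dec (n + 1) c' = s(Fin.last n, σ w) := by
    intro w hw h
    obtain ⟨h1, h2, h3, h4, h5⟩ := validCode_iff.1 hc
    refine ⟨10 * (q w + 1) + (n + 1), mem_liftCodes.2 (Or.inr ?_), ?_⟩
    · rw [dec, Sym2.eq_iff, Fin.ext_iff, Fin.ext_iff, Fin.ext_iff, Fin.ext_iff, Fin.val_ofNat,
        Fin.val_ofNat, Nat.mod_eq_of_lt (by omega), Nat.mod_eq_of_lt (by omega)] at h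
      omega
    · rw [dec_last hn, hσ w hw]
  induction e with | _ u w =>
  rw [Sym2.map_mk] at he ⊢
  by_cases hu : u = b
  · subst hu
    by_cases hw : w = u
    · subst hw
      rw [← he] at hdiag
      simp at hdiag
    · rw [hb]
      exact key w hw he
  · by_cases hw : w = b
    · subst hw
      rw [hb, Sym2.eq_swap]
      exact key u hu (by rw [Sym2.eq_swap, he])
    · refine ⟨c, mem_liftCodes.2 (Or.inl rfl), ?_⟩
      rw [dec_succ hc, ← he, Sym2.map_mk, hσ u hu, hσ w hw]

theorem exists_mem_splits [NeZero n] (hn : n < 9) {b : V} {q : V → Fin n} {σ : V ≃ Fin (n + 1)}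
    (hb : σ b = Fin.last n) (hσ : ∀ u, u ≠ b → σ u = (q u).castSucc) {T : List ℕ}
    (hT : T.all (validCode n) = true) {l : List (Sym2 V)}
    (hl : l.map (Sym2.map q) = T.map (dec n)) :
    ∃ s ∈ splits (q b + 1) (n + 1) T, s.map (dec (n + 1)) = l.map (Sym2.map σ) := by
  induction T generalizing l with
  | nil =>
    rw [List.map_nil, List.map_eq_nil_iff] at hl
    exact ⟨[], by simp [splits], by rw [hl]; rfl⟩
  | cons c T ih =>
    rw [List.all_cons, Bool.and_eq_true] at hT
    cases l with
    | nil => simp at hl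
    | cons e l =>
      rw [List.map_cons, List.map_cons, List.cons.injEq] at hl
      obtain ⟨s, hs, h⟩ := ih hT.2 hl.2
      obtain ⟨c', hc', h'⟩ := exists_liftCode hn hb hσ hT.1 hl.1
      refine ⟨c' :: s, List.mem_flatMap.2 ⟨s, hs, List.mem_map_of_mem hc'⟩, ?_⟩
      rw [List.map_cons, List.map_cons, h, h']

/-- The graphs of minimal valency at least 3 from which the graph `T` arises by contracting an
edge; the two ends of this edge are interchangeable. -/
def expansions (n : ℕ) (T : List ℕ) : List (List ℕ) :=
  (List.range' 1 n).flatMap fun v => ((splits v (n + 1) T).filter fun s =>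
      precedes v (n + 1) s && Nat.ble 2 (codeDegree v s) && Nat.ble 2 (codeDegree (n + 1) s)).map
    ((10 * v + (n + 1)) :: ·)

/-- A cochain supported on given graphs of minimal valency at least 3 is a cocycle if its
differential vanishes on the expansions of these graphs. -/
theorem d_eq_zero_of_expansions [NeZero n] (hn : n < 9) {x : GraphSpace} (R : List (List ℕ))
    (hv : ∀ T ∈ R, T.all (validCode n) = true)
    (hR : ∀ (W : Type) (l : List (Sym2 W)), coeff x l ≠ 0 →
      ∃ T ∈ R, ∃ φ : W ≃ Fin n, (l.map (Sym2.map φ)).Perm (T.map (dec n)))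
    (hdeg : ∀ T ∈ R, hasMinDegree n 3 T = true)
    (h : ∀ T ∈ R, ∀ s ∈ expansions n T, s.all (validCode (n + 1)) = true →
      coeff (d x) (s.map (dec (n + 1))) = 0) : d x = 0 := by
  have hx : ∀ (W : Type) [DecidableEq W] (l : List (Sym2 W)) (v : W), vdeg v l ≤ 2 →
      coeff x l = 0 := by
    intro W _ l v hvl
    by_contra hc
    obtain ⟨T, hT, φ, hφ⟩ := hR W l hc
    have h₁ := List.all_eq_true.1 (hdeg T hT) (φ v + 1) (by rw [List.mem_range'_1]; omega)
    rw [Nat.ble_eq, codeDegree_eq (hv T hT), ← vdeg_perm _ hφ, vdeg_map φ.injective] at h₁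
    omega
  refine eq_zero_of_coeff fun m l => ?_
  by_contra hl
  have hl' := hl
  rw [coeff_d] at hl'
  refine hl' (altSum_eq_zero fun l₁ e l₂ hle => ?_)
  by_contra hT
  rw [contractTerm] at hT
  split_ifs at hT with he
  · exact hT rfl
  obtain ⟨T, hTR, φ, hφ⟩ := hR _ _ (right_ne_zero_of_mul hT)
  -- The quotient map followed by the isomorphism to `T` contracts `e` directly onto `Fin n`, so `l`
  -- is an expansion of `T`.
  obtain ⟨q, hq, hqe⟩ : ∃ q : Fin m → Fin n, IsContraction e q ∧
      ((l₁ ++ l₂).map (Sym2.map q)).Perm (T.map (dec n)) := by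
    refine ⟨fun u => φ (Quotient.mk (contractSetoid e) u),
      ⟨φ.surjective.comp Quotient.mk_surjective, fun u w => ?_⟩, ?_⟩
    · rw [φ.apply_eq_iff_eq]
      exact (isContraction_mk e).ker u w
    · refine (List.Perm.of_eq ?_).trans hφ
      rw [List.map_map]
      refine List.map_congr_left fun e' _ => ?_
      rw [Function.comp_apply, Sym2.map_map]
      rfl
  obtain ⟨L, hL, hLT⟩ := exists_perm_map_eq hqe
  obtain ⟨a, b, rfl, hab⟩ : ∃ a b, e = s(a, b) ∧ Precedes a b L := by
    induction e with | _ a b =>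
    rcases precedes_total a b L with h | h
    · exact ⟨a, b, rfl, h⟩
    · exact ⟨b, a, Sym2.eq_swap, h⟩
  rw [Sym2.mk_isDiag_iff] at he
  obtain ⟨σ, hb, hσ⟩ := hq.exists_equiv he
  obtain ⟨s, hs, hsL⟩ := exists_mem_splits hn hb hσ (hv T hTR) hLT
  have hqab : q a = q b := (hq.ker a b).2 (by simp)
  have hsv := valid_of_mem_splits hn (hv T hTR) hs
  have hsv' : ((10 * (q b + 1 : ℕ) + (n + 1)) :: s).all (validCode (n + 1)) = true := by
    rw [List.all_cons, hsv, Bool.and_true, validCode_iff]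
    omega
  have hp : (l.map (Sym2.map σ)).Perm
      (((10 * (q b + 1 : ℕ) + (n + 1)) :: s).map (dec (n + 1))) := by
    rw [hle, List.map_cons, dec_last hn, hsL]
    refine (List.perm_middle.map _).trans ?_
    rw [List.map_cons, Sym2.map_mk, hb, hσ a he, hqab, Sym2.eq_swap]
    exact (hL.map _).cons _
  apply hl
  rw [← coeff_map_equiv _ σ, coeff_perm_eq_zero _ hp]
  -- At vertices of valency at most two `d x` vanishes. The contracted edge counts once at each of
  -- its ends, so at least two further edges are needed there.
  have hdeg₁ : ∀ v : Fin (n + 1), 2 ≤ codeDegree ((v : ℕ) + 1) s ∨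
      v ∉ dec (n + 1) (10 * (q b + 1 : ℕ) + (n + 1)) := by
    intro v
    by_contra! hv2
    apply hl
    rw [← coeff_map_equiv _ σ, coeff_perm_eq_zero _ hp]
    refine coeff_d_eq_zero_of_vdeg_le_two hx _ v ?_
    rw [← codeDegree_eq hsv', codeDegree_cons]
    cases (Nat.beq ((10 * (q b + 1 : ℕ) + (n + 1)) / 10) (v + 1) ||
      Nat.beq ((10 * (q b + 1 : ℕ) + (n + 1)) % 10) (v + 1)) <;> simp <;> omega
  have hb₁ := (hdeg₁ (q b).castSucc).resolve_right (by rw [dec_last hn]; simp)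
  have hb₂ := (hdeg₁ (Fin.last n)).resolve_right (by rw [dec_last hn]; simp)
  rw [Fin.val_castSucc] at hb₁
  rw [Fin.val_last] at hb₂
  refine h T hTR _ (List.mem_flatMap.2 ⟨q b + 1, ?_, List.mem_map_of_mem
    (List.mem_filter.2 ⟨hs, ?_⟩)⟩) hsv'
  · rw [List.mem_range'_1]
    omega
  · have := precedes_iff hsv (q b).castSucc (Fin.last n)
    rw [Fin.val_castSucc, Fin.val_last] at this
    rw [Bool.and_eq_true, Bool.and_eq_true, this, hsL, ← hb, ← hqab, ← hσ a he, precedes_map,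
      Nat.ble_eq, Nat.ble_eq]
    exact ⟨⟨hab, hqab ▸ hb₁⟩, hb₂⟩

end Splits

/-! ### Representatives of small graphs up to isomorphism. -/

section Graphs

variable {n k D : ℕ}

theorem IsCover.mono [NeZero n] {D' : ℕ} {R : List (List ℕ)} (h : IsCover n k D R) (hD : D ≤ D') :
    IsCover n k D' R :=
  fun l hl => h l ⟨hl.nodup, hl.loopless, hl.length_eq, fun v => hD.trans (hl.le_vdeg v)⟩

/-- The base of the enumeration: a simple graph is a subset of the complete list `E` of edges, and
each subset of size `k` has a certificate. -/
theorem isCover_of_sublistsLen [NeZero n] (E : List ℕ) (hE : ∀ e : Sym2 (Fin n), ¬ e.IsDiag →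
    e ∈ E.map (dec n)) (hE' : (E.map (dec n)).Nodup) (hv : E.all (validCode n) = true)
    {R : List (List ℕ)} (qs : List ℕ) (h : checkAll (isoTest n R) (E.sublistsLen k) qs = true) :
    IsCover n k D R := by
  classical
  intro l hl
  have hp : l.Perm ((E.filter fun c => dec n c ∈ l).map (dec n)) := by
    rw [List.perm_ext_iff_of_nodup hl.nodup ((List.filter_sublist.map _).nodup hE')]
    intro e
    simp only [List.mem_map, List.mem_filter, decide_eq_true_eq]
    constructor
    · intro he
      obtain ⟨c, hc, rfl⟩ := List.mem_map.1 (hE e (hl.loopless e he))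
      exact ⟨c, ⟨hc, he⟩, rfl⟩
    · rintro ⟨c, ⟨-, hc⟩, rfl⟩
      exact hc
  obtain ⟨q, hq⟩ := exists_of_checkAll h (E.filter fun c => dec n c ∈ l)
    (List.mem_sublistsLen.2 ⟨List.filter_sublist, by
      rw [← hl.length_eq, hp.length_eq, List.length_map]⟩)
  obtain ⟨T, hT, φ, hφ⟩ := exists_of_isoTest hq (List.all_eq_true.2 fun c hc =>
    List.all_eq_true.1 hv c (List.mem_of_mem_filter hc))
  exact ⟨T, hT, φ, (hp.map _).trans hφ⟩

/-- The valencies `d` with `d * (n + 1) ≤ 2 * k` form a finite range, so one list of certificates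
for each `d` suffices. -/
theorem isCover_of_certs [NeZero n] (hn : n < 9) (R : ℕ → List (List ℕ)) {R' : List (List ℕ)}
    (css : List (List ℕ))
    (hR : ∀ d, D ≤ d → d * (n + 1) ≤ 2 * k → IsCover n (k - d) (d - 1) (R d))
    (hv : ∀ d, ∀ T ∈ R d, T.all (validCode n) = true)
    (h : ((List.range (2 * k / (n + 1) + 1)).all fun d => Nat.blt d D ||
      checkAll (isoTest (n + 1) R') (extensions n d (R d)) (css.getD d [])) = true) :
    IsCover (n + 1) k D R' := by
  refine isCover_succ hn R (fun d hd hd' => ⟨hR d hd hd', css.getD d [], ?_⟩) hv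
  have := List.all_eq_true.1 h d (List.mem_range.2 (Nat.lt_succ_of_le
    ((Nat.le_div_iff_mul_le (Nat.succ_pos n)).2 hd')))
  rw [Bool.or_eq_true, Nat.blt_eq] at this
  exact this.resolve_left (by omega)

theorem forall_mem_getD_valid {Ls : List (List (List ℕ))}
    (h : (Ls.all fun L => L.all fun T => T.all (validCode n)) = true) (d : ℕ) :
    ∀ T ∈ Ls.getD d [], T.all (validCode n) = true := by
  obtain hd | hd := Nat.lt_or_ge d Ls.length
  · rw [List.getD_eq_getElem _ _ hd]
    exact List.all_eq_true.1 (List.all_eq_true.1 h _ (List.getElem_mem hd))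
  · rw [List.getD_eq_default _ _ hd]
    simp

/-- The simple graphs with 4 vertices, by the number of edges. -/
def graphs4 (k : ℕ) : List (List ℕ) :=
  [[[]],
   [[34]],
   [[12, 34], [24, 34]],
   [[13, 24, 34], [23, 24, 34], [14, 24, 34]],
   [[12, 13, 24, 34], [14, 23, 24, 34]],
   [[13, 14, 23, 24, 34]],
   [[12, 13, 14, 23, 24, 34]]].getD k []

/-- The simple graphs with 5 vertices and at least 6 edges, by the number of edges. -/
def graphs5 (k : ℕ) : List (List ℕ) :=
  [[],
   [],
   [],
   [],
   [],
   [],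
   [[14, 15, 24, 25, 34, 35],
    [12, 14, 25, 34, 35, 45],
    [13, 24, 25, 34, 35, 45],
    [23, 24, 25, 34, 35, 45],
    [12, 15, 25, 34, 35, 45],
    [15, 24, 25, 34, 35, 45]],
   [[12, 13, 24, 25, 34, 35, 45],
    [13, 15, 24, 25, 34, 35, 45],
    [15, 23, 24, 25, 34, 35, 45],
    [14, 15, 24, 25, 34, 35, 45]],
   [[12, 13, 15, 24, 25, 34, 35, 45],
    [14, 15, 23, 24, 25, 34, 35, 45]],
   [[13, 14, 15, 23, 24, 25, 34, 35, 45]],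
   [[12, 13, 14, 15, 23, 24, 25, 34, 35, 45]]].getD k []

/-- The simple graphs with 6 vertices and 9 edges without isolated vertices. -/
def graphs69 : List (List ℕ) :=
  List.map (unpack 100 9)
    [464536352625141312, 464536353426251615, 564645353426231612, 564645362523141312,
     564645363524231612, 564645363426251513, 564645363526241312, 564645363526241513,
     564645363526242315, 564645363526241514, 564645363534261512, 564645363526251413,
     564645363534262512, 564645363534262514, 564645363526241613, 564645363526242316,
     564645363534261612, 564645363526251614, 564645363534262516, 564645363526251615]

/-- The simple graphs with 6 vertices and 8 edges of minimal valency at least 2. -/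
def graphs68 : List (List ℕ) :=
  List.map (unpack 100 8)
    [4645363526251413, 4645363526251615, 5645363526241614, 5646353426251413, 5646453534261612,
     5646453625231413, 5646453635241312, 5646363526241514, 5646453635261412, 5646453635261512,
     5646453635261612]

/-- The simple graphs with 6 vertices and 11 edges. -/
def graphs6_11 : List (List ℕ) :=
  List.map (unpack 100 11)
    [5646453635262423151413, 5646453635342625141312, 5646453635342625241312,
     5646363534262524161514, 5646453635342625161412, 5646453635342625241613,
     5646453635342625242316, 5646453635342625161512, 5646453635342625241615]

/-- The simple graphs with 6 vertices and 12 edges. -/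
def graphs6_12 : List (List ℕ) :=
  List.map (unpack 100 12)
    [564645363526242315141312, 564645363534262524161312, 564645363534262524161513,
     564645363534262524231615, 564645363534262524161514]

/-- The simple graphs with 7 vertices and 11 edges of minimal valency at least 2. -/
def graphs7_11 : List (List ℕ) :=
  List.map (unpack 100 11)
    [5756474637352624231716, 5756474637362524231716, 5756474637353427261612,
     5756474637363427251615, 5756474645373627231612, 5756474645373627261312,
     5756474637353427261716, 5756474645373627261713, 5756474645373627261716,
     6756474537352624231716, 6747464537363527251615, 6756474645373627251715,
     6757564645373427231612, 6757564645373427261713, 6757564645373627251714,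
     6757474536352624231716, 6757474645363526251713, 6757564736342524231716,
     6757474536353427261612, 6757474636353427251615, 6757474645363527261513,
     6757564745363427231612, 6757564745363427261513, 6757564746353427231612,
     6757564746353427261513, 6757474536353427261716, 6757564736353427241712,
     6757564745363427261713, 6757564746353427231712, 6757564746353427261713,
     6757564746363527241713, 6757564746363534271712, 6757564746453627231713,
     6757564746453635271712, 6757474637352625141312, 6757474637353426251615,
     6757474645373626251513, 6757474645373635261512, 6757564737262423151413,
     6757564737342625141312, 6757564745373426231612, 6757564745373626241312,
     6757564745373626241513, 6757564746372523141312, 6757564746373524231612,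
     6757564746373426251513, 6757564746373526241312, 6757564746373526241513,
     6757564746373526241514, 6757564746373534261512, 6757564746373526251413,
     6757564746453726231312, 6757564746453726231513, 6757564746373625241312,
     6757564746373625241513, 6757564746373625241514, 6757564746373634251512,
     6757564746453736251312, 6757564746453736251412, 6757564746373524231712,
     6757564746373526251714, 6757474645373627251615, 6757564745373427261613,
     6757564745373627261614, 6757564746373527241312, 6757564746453727231312,
     6757564746373527231614, 6757564746373527241613, 6757564746373534271612,
     6757564746373527251614, 6757564746453727231613, 6757564746373527261413,
     6757564746373627251413, 6757564746373627251514, 6757564746453736271312,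
     6757564746453736271512, 6757564746373627251614, 6757564746373627251615,
     6757564746453736271612, 6757564746373627261514, 6757564745373627261714,
     6757564746373527241713, 6757564746373534271712, 6757564746453727231713,
     6757564746373627251714, 6757564746373627251715, 6757564746453736271712,
     6757564746373627261715, 6757564746373627261716]

theorem valid_graphs4 (k : ℕ) : ∀ T ∈ graphs4 k, T.all (validCode 4) = true :=
  forall_mem_getD_valid (by decide +kernel) k

theorem valid_graphs5 (k : ℕ) : ∀ T ∈ graphs5 k, T.all (validCode 5) = true :=
  forall_mem_getD_valid (by decide +kernel) k

theorem isCover_graphs4 (k D : ℕ) : IsCover 4 k D (graphs4 k) := by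
  refine isCover_of_sublistsLen [12, 13, 14, 23, 24, 34] (by decide) (by decide) (by decide +kernel)
    (List.getD (
      [[4321],
      [4321, 4231, 2431, 4213, 2413, 2143],
      [1000004321, 1000003421, 1000003241, 1000004312, 1000004132, 2431, 1000003412, 4231,
       1000001432, 1000003214, 4321, 1000003142, 1000001342, 1000003124, 1000001324],
      [1000004321, 2000004321, 3421, 3241, 4321, 2000003421, 2341, 1000004312, 3214, 2314, 4231,
       2431, 2000003241, 4213, 1000004132, 2134, 2413, 2143, 1000001432, 2000003214],
      [1000004321, 1000003421, 1000004312, 1000003412, 3241, 1000003241, 1000004132, 3421,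
       1000003142, 4321, 1000001432, 1000001342, 1000003214, 1000003124, 1000001324],
      [4321, 4231, 2431, 4213, 2413, 2143],
      [4321]] : List (List ℕ)) k []) ?_
  obtain h | h := Nat.lt_or_ge k 7
  · revert k
    decide +kernel
  · rw [List.sublistsLen_of_length_lt (by simp; omega)]
    rfl

/-- The range of `k` is the one needed for the covers with six vertices, where 6 to 12 edges remain
after the deletion of a vertex. -/
theorem isCover_graphs5 (k : ℕ) (h₁ : 6 ≤ k) (h₂ : k ≤ 12) : IsCover 5 k 0 (graphs5 k) := by
  refine isCover_of_certs (by norm_num) (fun d => graphs4 (k - d)) (List.getD (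
    [[],
    [],
    [],
    [],
    [],
    [],
    
      [[3000015432],
      [5000015432, 5000014532, 2000015432, 2000015423],
      [1000035421, 1000035241, 32541, 35214, 1000032514, 1000032154, 4000025431, 1000024531,
       1000024351]],
    
      [[],
      [2000015432, 2000014532, 2000014352, 2000014325],
      [3000035421, 1000025341, 1000023541, 1000025314, 1000023514, 15432]],
    
      [[],
      [],
      [1000015432, 1000015342, 1000013542, 1000015324, 1000013524, 1000013254],
      [35241, 32541]],
    
      [[],
      [],
      [],
      [25431, 25413, 25143, 21543]],
    
      [[],
      [],
      [],
      [],
      [54321]],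
    
      [[],
      [],
      [],
      [],
      []],
    
      [[],
      [],
      [],
      [],
      []]] : List (List (List ℕ))) k [])
    (fun d _ _ => isCover_graphs4 _ _) (fun d => valid_graphs4 _) ?_
  interval_cases k <;> decide +kernel

theorem isCover_graphs69 : IsCover 6 9 1 graphs69 :=
  isCover_of_certs (by norm_num) (fun d => graphs5 (9 - d))
    [[],
      [15000165432, 8000165432, 8000164523, 8000164253, 8000162435, 18000165432, 18000156432,
       13000165432, 13000165342, 12000165432],
      [11000265431, 5000264531, 5000246531, 5000264351, 5000246351, 1000243651, 4000165432,
       4000156432, 2000154632, 2000154362, 17000365421, 17000364512, 9000346521, 14000265341,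
       7000256341, 5000164532, 14000263514, 5000165423, 7000253614, 6000165432, 16000265431,
       10000256431, 10000254631, 10000254361, 19000465321, 17000165432, 17000156432, 17000165342,
       17000156342, 11000165432, 17000165324, 17000156324, 11000165423, 11000165243],
      [432651, 3000354621]]
    (fun d h h' => (isCover_graphs5 _ (by omega) (by omega)).mono (Nat.zero_le _))
    (fun d => valid_graphs5 _) (by decide +kernel)

theorem isCover_graphs68 : IsCover 6 8 2 graphs68 :=
  isCover_of_certs (by norm_num) (fun d => graphs5 (8 - d))
    [[],
      [],
      [1000465321, 2000364521, 2000346521, 2000364251, 2000346251, 243651, 2000364215, 2000346215,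
       243615, 243165, 9000465321, 8000364521, 8000346512, 7000364251, 2000256341, 5000264531,
       2000265314, 7000346215, 5000246513, 3000243165, 8000265431, 8000256431, 4000254631,
       6000265341, 10000465321, 10000463521, 4000365421, 10000462153, 7000165342, 7000163542,
       10000462135, 7000165324, 7000163524, 4000362154, 10000265431, 9000256431, 8000165432,
       8000165342]]
    (fun d h h' => (isCover_graphs5 _ (by omega) (by omega)).mono (Nat.zero_le _))
    (fun d => valid_graphs5 _) (by decide +kernel)

theorem isCover_graphs6_11 : IsCover 6 11 0 graphs6_11 :=
  isCover_of_certs (by norm_num) (fun d => graphs5 (11 - d))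
    [[],
      [6000165432, 6000156432, 6000154632, 6000154362, 6000154326],
      [8000165432, 8000164532, 8000146532, 5000165432, 5000156432, 5000154632, 5000165423,
       5000156423, 5000154623, 2000165432],
      [4000365421, 4000365241, 3000362541, 256431, 3000365214, 4000362514, 254613, 4000362154,
       254163, 251436, 7000265431, 4000264531, 4000246531, 4000264351, 4000246351, 1000243651]]
    (fun d h h' => (isCover_graphs5 _ (by omega) (by omega)).mono (Nat.zero_le _))
    (fun d => valid_graphs5 _) (by decide +kernel)

theorem isCover_graphs6_12 : IsCover 6 12 0 graphs6_12 :=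
  isCover_of_certs (by norm_num) (fun d => graphs5 (12 - d))
    [[],
      [],
      [3000165432, 3000164532, 3000146532, 3000164352, 3000146352, 3000143652, 3000164325,
       3000146325, 3000143625, 3000143265],
      [4000365421, 2000265341, 2000263541, 2000236541, 2000265314, 2000263514, 2000236514,
       1000165432, 1000156432, 1000154632],
      [436521]]
    (fun d h h' => (isCover_graphs5 _ (by omega) (by omega)).mono (Nat.zero_le _))
    (fun d => valid_graphs5 _) (by decide +kernel)

/-- The inequality `7 * d ≤ 22` leaves `d = 2` and `d = 3`. Deleting the vertex leaves 9 edges with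
valencies at least 1, or 8 edges with valencies at least 2. -/
theorem isCover_graphs7_11 : IsCover 7 11 2 graphs7_11 :=
  isCover_of_certs (by norm_num) (fun d => [[], [], graphs69, graphs68].getD d [])
    [[],
      [],
      [1001765432, 9001756432, 9001576432, 9001754632, 9001574632, 1001547623, 9001754362,
       9001574362, 1001547263, 1001542763, 1001725436, 1001275436, 9001437526, 9001435726,
       9001435276, 8003765421, 11003756421, 11003576421, 11003754621, 11003574621, 55003547621,
       7001765432, 7001675432, 16001657432, 16001654732, 7001765423, 7001675423, 16001657423,
       16001654723, 5001765432, 13002765431, 13002756431, 24002576431, 7002754631, 20002574631,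
       20002547631, 25002754361, 19001764352, 19001746352, 3002643751, 26001765342, 12001765432,
       12001756432, 4001754632, 18001754362, 17001765432, 17001756423, 17001576243, 15001754632,
       1573642, 1537624, 1753462, 15001574362, 1357264, 17001432765, 1735426, 1375246, 15001547326,
       17001423756, 17001243576, 29002765431, 27002756431, 22002576431, 27002754631, 22002574631,
       16002746531, 6002735461, 10002674351, 19002647351, 19002643751, 28001765432, 23001765432,
       21001756432, 21001754632, 2001735462, 63003765421, 73003756421, 14003576421, 61003754621,
       11002674531, 48003647521, 67002765341, 30002675341, 42002756341, 36001764532, 27001765423,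
       13001675423, 22001765423, 20001764523, 41001765432, 71002765431, 71002756341, 50002765431,
       62002754631, 45002764531, 36002746531, 62002745361, 36002764351, 45002746351, 35002743651,
       59001765432, 44001765432, 44001756342, 40001754632, 40001745362, 76003765421, 69003765421,
       60003675421, 60003764512, 69003674512, 48001765432, 66002765431, 30001675432, 47002756341,
       45001764532, 30001764523, 66002674513, 45001675423, 47002573614, 46001765432, 68002765431,
       31002675431, 49002756341, 49002753641, 37002754361, 77004765321, 77004756231, 77004576213,
       60001765432, 60001675423, 14001657432, 60001756342, 14001675342, 60001657243, 50001765432,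
       14001765324, 60001576324, 60001567234, 50001675423, 50001657243, 78003765421, 75003756421,
       75003576412, 75003754621, 75003574612, 58003547621, 70002765431, 32002675431, 52002756431,
       52002754631, 32002765413, 70002675413, 52002576413, 52002574613, 51001765432, 79003765421,
       73002765431, 73002675431, 73002764531, 73002674531, 55002765431, 72002764351, 72002674351,
       54002765341, 54002763541, 29001765423, 29001675423, 24001765423, 24001764523, 53001765432,
       74002765431, 74002675431, 57002765431, 57002764531, 56002764351, 75002765431, 75002675431,
       33002657431, 58002764531, 57001765432, 84003765421, 80003756421, 60002765431, 80003754612,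
       60002764513, 61001746532, 81002756341, 67001765432, 66001756342, 62001754632, 81002753614,
       67001764523, 62001756423, 66001753624, 64001765432, 82002765431, 68001765432, 68001756342,
       68001753642, 68001735462, 86003765421, 86003756421, 33003765421, 86003754621, 33003764521,
       33003746521, 83002765431, 70001765432, 70001756432, 70001754632, 83002765413, 70001765423,
       70001756423, 70001754623, 65001765432, 87004765321, 85002765431, 77002675431, 84002764531,
       76002674531, 73001765432, 84002764351, 76002674351, 73001765342, 72001765432, 80001765324,
       63001765324, 69001756324, 71001765423, 71001765243, 86002765431, 78002675431, 75001765432,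
       75001764532, 74001765432, 88005764321, 87001765432, 87001675432, 87001764532, 87001674532,
       79001765432, 87001764352, 87001674352, 79001765342, 79001763542, 87001764325, 87001674325,
       79001765324, 79001763524, 79001763254],
      [38005724361, 38005274361, 38005437216, 38005432716, 38002751643, 43004753261, 43004572361,
       43004327516, 43004235716, 39002743165, 38004765321, 34004573261, 34004537216, 43006321754,
       43003765421, 43003675421, 39004657231, 39004652713, 34002743651, 43002764531]]
    (fun d h h' => by
      obtain rfl | rfl : d = 2 ∨ d = 3 := by omega
      · exact isCover_graphs69
      · exact isCover_graphs68)
    (forall_mem_getD_valid (by decide +kernel)) (by decide +kernel)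

end Graphs

/-! ### Cocycles with 8 vertices and 14 edges are determined by 36 coefficients. -/

section Cocycles

/-- Graphs with 8 vertices and 14 edges: the graphs in `γ₇`, the other graphs of minimal valency at
least 3 without odd symmetries, and the graphs without odd symmetries with two adjacent bivalent
vertices or with a bivalent vertex next to a leaf. -/
def table8 : List (List ℕ) :=
  List.map (unpack 100 14)
    [7868585748463834282523181716, 7868575647464538372625181312, 7868675857484637352723181412,
     7868675857484537362523161412, 7868675756484637282523181413, 7868675848453735262524171613,
     7868675857484636352724151312, 7868575648463837282623171514, 7868585756474638372624181312,
     7858575647463836342827181612, 7867585648463735262523181714, 7868574746453836352827161512,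
     7868575647464538352726181312, 7868675857464536352723181412, 7867585756484638362723181412,
     7867585748463837282623161514, 7868675857484636352723151412, 7868675756484637342823181512,
     7868585756474638362827141312, 7868585756484638372623171412, 7868675856484736342725181312,
     7868574846453736352725181612, 7868675857474538362625141312, 7868575648474636352725181312,
     7868675756484738362824151312, 7868675857473836342825181412, 7868675857564846372823141312,
     7867584846453736352725181612, 7868674847453836352625171512, 7868675857474638352723181412,
     7868575647463837282624181513, 7868675857484638362723151412, 7867575648473836282625181413,
     7868675857484636342725181312, 7868675756484637352823181412, 7868574847463836352725161512,
     7867585756474638362823181412, 7868675857484737342825161312, 7867584847463836352725161512,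
     7868675848464537352625171312, 7868585756474637362823181412, 7868675857484638352723171412,
     7868675848474536352726151312, 7868675847464537352826151312, 7868675857474638352824181312,
     7867585756484738362623181412, 6758575648473837342826181612, 6867585748473837342625161512,
     6867585756484738372824171312, 6867585756484738372824181312, 7867585648464538372726181312,
     7867585748464538362726181312, 7858575648463836342827171612, 7867585648464538372826171312,
     7867585756484638372824161312, 7868575648474538362726151312, 7868574847463837352625161512,
     7868675847463835342725161512, 7868675847464538352725161312, 7868675857474645382823161312,
     7868675848473635342725161512, 7868675848473735342625161512, 7868675857484637352624151312,
     7868675857484637362524151312, 7868585748463736272623181514, 7868585756484737362823161412,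
     7868585748473836272625161413, 7868585748474538362726161312, 7868585756484738362724161312,
     7868585756484738372624161312, 7868675856484738352724161312, 7868675857484638352724161312,
     7868675857484738352624161312, 7868675857484745382623161312, 7868675857564847382823141312,
     7868675756484745383635281412, 7868675857474645383635281412, 7868675857484645373635241312,
     7868675856484745373635281712, 7868675857484645373635281412, 7868675857484645373635281712,
     7868675857564847463534281712, 7868585756484746383736251412, 7868675856484746383735271512,
     7868675857564847383634251412, 7868675857484746383635271512, 7868675857564847383634271512,
     7868675857564847453836271612, 7868675857564847463835271312, 7868675857564847463835271412,
     7868675857564847463835271612, 7868675857484746383735261512, 7868675857564847463837251312,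
     7868675857564847463837251412, 7868675857564847463837261512, 7868675857484746383635281512,
     7868675857564847383634281512, 7868675857564847383634281712, 7868675857564847463835281712,
     7868675857564847383734281612, 7868675857564847463837281512, 7868675857564847463835342712,
     7868675857564847463837352412, 7868675857564847463837352612]

/-- Graphs with 9 vertices and 15 edges, with certificates that express the value of the differential
at these graphs by the coefficients of the graphs in `table8`. -/
def equations8 : List (ℕ × ℕ) :=
  [(897978696859494539272523161413, 1852746831000057486321000087653421026825163774000045678321000087634521026821536747),
   (897978696859574946392523141312, 1823547861045835172674000000000000045831527647000000000000000000000000),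
   (897969595749463837362825181412, 1883547261000000000000000000000000000000000000000000000000000000000000000000000000042875634721073867543721073865734712000000000000018874261365000000000000018872416356000000000000),
   (897969675949383735282624181514, 1882376541000000000000000000000000000000000000026872183546026871238456030786452813000087564312005874162635030784625183000084657123005871426365042782156348018871264536018872146356),
   (897969675957493836342825181412, 1883247561000000000000000000000000000000000000000000000000000000000000045871328546003783526814073865734712035871426635000000000000005874162365000000000000000017654328000000000000),
   (897969675957494638352824181312, 1882354761000000000000000000000000000000000000000000000000000000000000000000000000000000000000000000000000035874162635000000000000035871426365000000000000000000000000000000000000),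
   (897969685857494638352724171312, 45878563412000000000000000000000000000000000000035768583421000000000000000000000000000000000000000000000000000000000000043856437172000000000000002876341525000000000000),
   (897969685857494637352724181312, 26878562314000000000000000000000000071786482513000000000000000000000000000000000000000000000000000000000000000087614325040857436162054786351428002876341525011568243177),
   (897969685957484738362723151412, 5687458132035678548321000000000000000000000000033768543281056876432551000081654327002785346126036758243166),
   (897969685957484638352724171312, 46786451823063865472713000000000000024685437172000000000000002785341626000000000000),
   (897969685958484737362723151412, 87645321000000000000000000000000000000000000000000000000073786458213000078654321000000000000023756842831000000000000000000000000044865274137002658247137022758234166),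
   (897969685958474637352824171312, 26878653241000000000000000000000000000000000000000000000000037768548132064865747231000000000000004765382814016786352184002658427173000000000000000000000000000021654387),
   (897969685958484637352724171312, 45878654321000000000000000000000000000000000000000000000000000000000000000000000000000000000000063865472713000000000000002658427173000000000000000000000000000000000000),
   (897969686759584847372523141312, 27687548312000078654321037768543812040865472371000000000000002567428318000000000000000000000000),
   (897969686759584738342724151312, 46786543821002567428831000000000000000000000000043875461236057876432515036867432155),
   (897978696859574945382623141312, 3785632841035864712573000000000000008862437517000000000000000000000000),
   (897978696759564938352824141312, 26875218463000085674321000036754812003785326184000000000000000000000000033874132656000000000000),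
   (797869685957494539342826181312, 3788653241045875831264000000000000000000000000000000000000000000000000000000000000000000000000000000000000000000000000000000000000000000000000033863214757000000000000),
   (897978695956494638372825141312, 3786352481071874563261031862317457037875213646000087645321),
   (797869685957494639352824181312, 42877563421000000000000003785836241000000000000000000000000000000000000000000000000000000000000000000000000000000000000037863527174000000000000052864351727000000000000),
   (797869685958494739342826151312, 38788564321000087624351000000000000045875683142003785683241000000000000000000000000000000000000000000000000000000000000000000000000033863271457010861352747000087564321),
   (897978696859574837342624151312, 25786458321025768543812064687435521004875643261043786425351004857462316043768243515029867342155),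
   (897978696857474539352824161312, 71867542813004857463621071687524183004587436261064875621436040867431525040687413255),
   (897978696859474538342725161312, 32876583241025768548321023758466231072786524813017687435521005678541382004857463261017785621436000087652341000027634581),
   (897969685857494537362724181312, 26878652314000000000000000000000000000087456231005678584213020876358241004765388241015768532814017765832814052768245183059856347172000087624351056576421838000021645387),
   (897978695949463836352825171412, 82654371000000000000000000000000038786453821032875634621025863472751042786251384018864172573005876124356066865427137015875134266),
   (897978696859574938342524161312, 87354621038784536812073875436612020865473271008862437571005864712537046874513626010872513466),
   (897978695957493836342826151412, 83645721000000000000000000000000026875328641038784536821025874623651072875436621030786542381005864712573066865274137000015674328000087456321),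
   (897978696759493835282423161514, 45875382641045875328461000000000000005864172753000000000000005864127573000000000000070865743217008873264516008873246156),
   (897978696857564945382723141312, 27678584321000087564321000078564231000047658123072687421853005768523481000000000000061876435215000000000000000000000000),
   (896968675958494737352724181312, 5678854213000000000000000000000000020876538241000000000000000087564321044765483812000000000000000000000000010786524138036685341727022576324188),
   (897968675958484737362923151412, 87645321032786854321000000000000000000000000000000000000071687458213005768458132000000000000000000000000031876435281059857432661044875364126013758346126000017354628),
   (897969685857474638352924171312, 45878563412000000000000000000000000000000000000005768582431046768538241000087456321000000000000000000000000008876352184043856437172051768251438056685341727058857324166),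
   (897969675958484738362723151412, 5687548231018678458321000087652341023756842831052768523481056867432551059865374127024685347127012758243166),
   (897978696857494638352725141312, 34687453821063687452531000000000000000000000000040867415235062786423515006768143255),
   (897978696859564745382723141312, 60768458132000047658123071786421853035768532481000000000000006768135245000000000000000000000000),
   (897969685857494738362725141312, 25786485231000000000000000000000000000000000000000000000000000000000000000000000000000000000000006857436216039875423616036758234166),
   (897969685857484637352924171312, 45878654321000000000000000000000000071687583412000000000000000000000000000000000000000000000000000000000000068876524183000027614385000000000000000000000000006857432166),
   (897969685857474538362924171312, 45878653412000000000000000000000000072786584321000000000000000000000000000000000000000000000000000000000000067867325184000082654371033768531248013758431626006857431266),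
   (897969685857564947382723141312, 27678584321000000000000000000000000000000000000052786542831033768524381000000000000006856427317000000000000000000000000),
   (897969685857564938342724171312, 87651324000000000000000000000000000000000000000078653412000000000000067876528431016786325814062875436621000000000000006856427371000000000000011786143525000000000000),
   (896968595756494838372724171312, 37768584312000000000000000000000000000000000000067786524813000000000000000000000000006765138284000000000000000000000000000000000000),
   (896968595756494738372824171312, 55768583412000000000000008867238541000087654231031687245813000000000000053786215483006765138284000000000000000000000000036576213488),
   (896968585756494739372824171312, 15678583421000000000000067876528341033768528431000087651324000000000000010786215483006675138284000000000000000000000000000087653421),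
   (897978696759584846372523141312, 27687548312000067854321018678453812007876452351000000000000044687425315000000000000000000000000),
   (897978696859474638352725141312, 32867382451000078634512000078654231000087562341000057684321018678541382007867452351059678415235061786423515058768423155),
   (897978696859474538352724161312, 87354621000000000000023758466231073786542813000057684321000000000000000000000000007785621436040687421535059678413255),
   (897978685956494638352724171312, 73786854321073876583412064875664321071867538142007875646231071687351824007785462613000000000000017758326164000000000000017578231646000000000000),
   (897969685857494837362725141312, 87564231000000000000000000000000032687384251000000000000000000000000000000000000037768534821007865734712000000000000000000000000061875426316000087456321022758243166),
   (897969685857494737362825141312, 78652341000000000000000000000000046768534821007856734712000000000000000000000000058857326416039857324616012876243155),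
   (897968675857494839362725141312, 87564231000087653421025678845321032786385241000000000000000000000000000000000000009876543821007865734712000000000000000000000000061865317427000017624358028857234166),
   (897969685857474537362924181312, 26878652314000000000000000000000000021786485321000000000000000000000000000000000000015768541823007765831824000087154326059856347172016786341258013758431626061875421366),
   (897969685857484537362924171312, 45878564321000000000000000000000000000000000000018768584132000000000000000000000000000000000000007756831824067876425183044865247173000000000000000000000000058857321466),
   (897968675857494638352923171412, 26887653214045878563421072687854312071678845213000000000000000087352641009867548213007756838124000000000000000000000000031867541283000027154386016768243158044857436126061856314277),
   (897978695957494638362823151412, 25874623651000000000000000000000000009865173247008873426156052875143266),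
   (897978696759564938342823151412, 45875318642000000000000035864127753000000000000000000000000008873264156065875146326033874132566),
   (897978696859574938262423151413, 26875628431030786542831025874623561009873516462046874513662019865372417008862437517016873524616),
   (897969685857474645392823171312, 87564321000000000000000000000000000078456123000000000000000000000000000078654312000000000000008867451823016786541382000000000000052768231548000000000000000000000000),
   (897969685857474637352924181312, 26878562314000000000000000000000000072687482513000000000000055768548231000087456321000000000000000000000000008867253184040857436162000087254361056685341727061875423166),
   (696867595849474539382827171312, 8867823451067786852431031678842531000000000000000087456321000000000000000087564321000000000000010876521843053786521843010687534182000000000000000000000000000078645321000000000000),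
   (896968595748473937282524171613, 67876482351051768285341000000000000052678248351008876345812000000000000000000000000043675284381000000000000000000000000040675823418000000000000),
   (896968595756484739372824171312, 46768583421000000000000000000000000033678528341008876325814000000000000000000000000000000000000000000000000000000000000036576214388),
   (897978696859574946382523141312, 42875634721009875361462000000000000009873516426000000000000000000000000),
   (897978696859574938342624151312, 86724351000087456321073875436621072875634261009873516462066875462316016873524616010872513466),
   (897978695956493836282423171514, 45875218463000000000000000035674821000000000000018864127573000000000000073867354127070865473217009865137247),
   (897978695956494638352823171412, 25863472751000000000000000000000000035876124356009865317247037875213466),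
   (897969686758574845392723141312, 27768584321000000000000000000000000009867542831046768532481000000000000039786435215000000000000000000000000),
   (896968675957494838372725141312, 25768845321019867583421000000000000000000000000000000000000009786543821037678534821000000000000000000000000029685327417036685314727000081456327),
   (896968675857494739352724181312, 72768845231009786584321015678584312066867538241000000000000000087564321044765483812000000000000000000000000010786514238029685342717028675324188),
   (896967585756494738372924181312, 50887654321009867853412000000000000009687584321000000000000000000000000000000000000016768328451000000000000016678234815000000000000000000000000000000000000000000000000029675213488),
   (896967585756494839372824171312, 69876854321000000000000009786583412000000000000000000000000000000000000000000000000067867523814000000000000000000000000000000000000000000000000000000000000039675124388),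
   (896968675957484739352724181312, 71768845231000000000000055768584321009687548231000000000000000000000000000000000000000000000000000000000000053786514238029865342717039586314277),
   (897978696859574938342625141312, 83614725038784635812000000000000000025674183000086754321000000000000000000000000010872513466),
   (797869685958494739282623151413, 87645321000082653471000000000000045875683241030786584231000000000000000000000000050874632851000000000000000000000000015864531772016862473517000085674321010861352747),
   (896967585756494839372823171412, 20867854321000000000000066786584321000000000000000000000000000000000000000000000000000087652341052768542831010786432581058765214883000078564231061675128348039675124388),
   (896967585756484739372924181312, 50887654321066867853421000000000000066687584312000000000000000000000000031786428531000087654231031876245813000087651324010876345182061675128384010786431528061765213848029675214388),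
   (897969685857564847392723141312, 75878654321000000000000000000000000000000000000027768584321000000000000000078564231060678458132031867245831033768523481000000000000011786145325000000000000000000000000),
   (897969685857484739362725141312, 87564231000000000000000000000000000087652341000000000000034687458321035768548312000000000000000000000000000000000000000000000000011568247317000017624358000087645321),
   (897969685857494637352824171312, 26878653241000000000000000000000000034687483512000000000000000000000000000000000000000000000000000000000000000087614325000027614385000000000000000000000000011568243177),
   (896968675957494738372825141312, 32678834521019876583421000087654231066867548312055768538412041786534821015678534821000087564321000057683421028765328418012576413828000087645321),
   (896968675957494738352724181312, 73768845231069867584321046768584312070867548231000000000000000000000000044765483812000000000000000000000000000000000000000000000000012576413288),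
   (897968675857494638352924171312, 26887562314045878563412071786854321034768845321000000000000073678482513000000000000000087456321000000000000000000000000000000000000000000000000054768251438013876241535061856314277),
   (897969686758574847392523141312, 27786584321027768584321027786548312027768548312041876534821013576482381000000000000013576428318000000000000000000000000),
   (897969686758574839342724151312, 87651324000078653412000087624351066876534812040865427731015768543281013576428381056758461236000078652341039768431255),
   (897978696859484537352724161312, 32867483521032687438251000057684321018678543821017867453521018768534281017687435251014786521345059768421535059678412355),
   (897978675856494639352824171312, 21678845321021687483512014678553421021867438152014768535241021876341825014786352514021786314285014876325154021768132458014867231545014687213455),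
   (897969685857484739352726141312, 87564231000000000000000000000000032687385421000078653421021687548321018768548312066876453812017865473712015768534281014765834281000041638527000087645321028857423166),
   (897978695956493836342827151412, 45876318542038785436821000087645321071874536621000000000000000000000000000087456321031862137547015875143266),
   (897978695956493836342825171412, 26876218543000084657321032875634621072864537712030785462183021865471372018876214356041875216346015875143266),
   (797869685958494739362824151312, 38788465321000000000000000087634521026876583241042875673421000000000000000000000000000000000000000000000000049876435271015865437172052863471527000087564321000086753421),
   (897969686759474538352824171312, 20867583421055768538142000087654231055786531824000087651324015786523184056758426163015768521348056785421636024876413255),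
   (896968675857494739352824171312, 21678845321066786583421015678583421066876538241015768538241000087564321059765482813000087456321059675428183000078632541028765342818028675324188),
   (897978696859574938352624141312, 26876538421000037651824027865472713071865734172000000000000000000000000016873524616000000000000),
   (797869685957493934282624181513, 42788562134026876832154000000000000000000000000000000000000000000000000000000000000000000000000000000000000000000000000055864527371049876352417046865371427016862435717),
   (797869685957494539282623181413, 30788564231026875821364000000000000000000000000000000000000000000000000000000000000050874621853000000000000000000000000037863521774000084657321016862437517033863214757),
   (897969685857494537362824171312, 26878563241000000000000000000000000073786485231018678584132070876458231064865477231000000000000017756832814016786523184044865247173000000000000000000000000000021645387),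
   (896967585756494739372824181312, 50887654321070867854321000000000000041786583421000000000000000000000000067867528431016768328541067867524813016768325814000000000000061675128384000000000000061675123848000000000000),
   (897978696759584837342624151312, 78634521000078456321064678435521017867543251044687425351017876452315044678243515029867432155),
   (897978696859494538352724161312, 38786543812032864375712072867435172020865437271018864712537055873542616000086754321),
   (896968675958494738342725171312, 18678854312000000000000000000000000070876548321037768548312000087456321000047658321000000000000059765482183000000000000022576324818000000000000),
   (897968675958484739362723151412, 87645321032687845321025768853421000000000000000000000000072786458213018768458321019867534821023756842831052768423581059857432661000017254368056576248138028857243166),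
   (897978696859493835272524161413, 87354621026875618423000085674321000086754312032876534261019865372471020865437271000014657328066874526316000087645321),
   (897978696859494538272523161413, 42785621834025867342571019865372471055875342661025863724517019863527417055873524616),
   (897969686758574938342724151312, 78652143000078653412019867548321055786543812040865427731055768543182040856427371024867451325039786432515039768432155),
   (896967585756494839372827141312, 19867853241000000000000019687583421000000000000000000000000000000000000000000000000031876243851052768542831031786423581052678452381029675218348039765214838039675124388),
   (897978696859493835342725161412, 83652741000087314625000085674321032863475721032864357712021867541372066875462361021865714327066874526316000086754321),
   (897969686759484537352824171312, 69876584321000000000000043875466321000000000000043857463612000000000000000000000000000000000000000000000000024867413255),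
   (897968675958494738362723151412, 25678853421000000000000000000000000000000000000000000000000000000000000000000000000051768523481024567432881040875364126043856347127039857234166),
   (897978696859574837342625141312, 25687358412025678534812000000000000000082654173000027651384000000000000000000000000029867342155),
   (897978696859574939342624151312, 26852716374045831527674026825173647045813256747050821436577),
   (897978696759493836352824151412, 83654721026876318452000037652841027875642631000036754812030786425183000000000000031873162546000000000000000000000000),
   (897978695956493837362824151412, 45876218453000000000000000000000000027875642631042785216384000000000000067863475127000000000000000000000000),
   (897978696859493837352624151412, 75876483512045876528431000000000000000000000000027865472713034864715372000000000000067875463216000000000000000000000000),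
   (897978695956493837342826151412, 87154326000000000000000000000000000037564812030785642381034864751372067863574127031862137457054873542166),
   (897978696759494538362825141312, 87645312000037645812042875364271071865374172031873126546052875413626051873154266),
   (896968595749473837282625171413, 68876583241033768584321067867348215000000000000031786354812000000000000000000000000000000000000000057683421000000000000000000000000000000000000),
   (896968675957484739352824171312, 34678845321000000000000046768583421000000000000046678538241000000000000000000000000000000000000000000000000047768542318039856341727039586314277),
   (897978696859574846372523141312, 35678543812063867452351000000000000043786425315000000000000000000000000),
   (896968675958494738352724171312, 35678854312000000000000000000000000069876548231000000000000000000000000000000000000000000000000000000000000000000000000036685341727000000000000),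
   (897969685857494538362724171312, 45878653412000000000000000000000000073786584321035678584312069876458231063865477231000000000000000000000000000000000000000082654371000000000000056576421838000000000000),
   (897969686759584745382723141312, 87564321000078654231055786531842037768541382000000000000036867435125000000000000000000000000),
   (897978695956494738362825141312, 42876534721072875643621042876354271072875463261041875216346052875314626052875134266),
   (897969686759484538352724171312, 70876584321046786548132043875466231046786541823043875462613000000000000056758426163000000000000056758421636000000000000),
   (897978696859574938362524141312, 45875638412000000000000000000000000069875463261000000000000000000000000046874513626000000000000),
   (896968675957494745382823171312, 74768854213000000000000000000000000000000000000000000000000000000000000000000000000000000000000000000000000047768543218000000000000000000000000),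
   (897968675857564847392923141312, 75887654321075878654321000000000000000000000000000000000000000000000000000000000000074687548213074678548213000000000000000000000000000000000000048687435215000000000000000000000000),
   (797869686759584945392823141312, 57684231000000000000000000000000050876542831049876542371000000000000053864357217000000000000000000000000),
   (797869686759494539282523181413, 50876521843049876542371000087653421051865431772049876524317000087634521051865413727),
   (797869685957493934282625181413, 87564321000082654371000000000000000000000000000000000000000000000000000000000000000000000000000000000000000000000000000086754321049874326517000000000000000000000000),
   (897978696859574939342625141312, 57684321000086754321000000000000000000000000050821436577),
   (897978696859494538372524161312, 60875632416000086754321053872543166),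
   (696867595849484539372827171312, 68876854321068786854231065768832541000000000000000000000000000000000000000000000000000000000000053867543812000000000000053687543182000000000000000000000000000000000000000000000000),
   (897969685857494645382723171312, 87564321000000000000000000000000074786584321060768485132000000000000000000000000000087645321054786321854000000000000000000000000000000000000000000000000000000000000),
   (896967595756494838372824171312, 65786325814000000000000000000000000000000000000000000000000000000000000057685214377),
   (896967585756494839382724171312, 70876854321000000000000070786584321000000000000000000000000000000000000000000000000000000000000000000000000000000000000058765218483000000000000058765214838000000000000),
   (897978695956493837282423161514, 82654371000000000000000000000000000000000000060875326461000000000000000000000000000000000000068863547127),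
   (897978696859564845372723141312, 74786548213000057684321000000000000000000000000000000000000062786435215000000000000000000000000),
   (897978696859574847362523141312, 64876543521064867453251000000000000064687435215000000000000000000000000),
   (897978696867594938352524141312, 75876583421000087614325000037651824074875463621068875463261000000000000000000000000000087645321000000000000),
   (897978696859584947362523141312, 73875643621073875463261000000000000070875436216000000000000000000000000),
   (897978696867595857493834261512, 94786547321094876543721094786543321082876452143082876542134082876542133),
   (897978675958574948463936281612, 87645321000000000000000000000000000000000000000000000000000000000000088875646321084876543821084876543521000027654183000067854231000027654183),
   (897978696867595857493834271612, 95786547321095876543721095786543321091768542183091768542135091768542133),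
   (897978696867595857493928241613, 101876548231099876542813101876543271101876543231099876542315099876542313)]

/-- The indices of graphs whose coefficients determine a cocycle. -/
def freeIndices8 : List ℕ :=
  [0, 5, 11, 18, 20, 24, 30, 32, 39, 69, 73, 75, 76, 77, 78, 79, 80, 81, 82, 83, 84, 85, 86, 88,
   89, 91, 92, 94, 95, 96, 97, 99, 100, 101, 102, 103]

/-- The order in which the equations determine the other coefficients. -/
def steps8 : List (ℕ × List (ℤ × ℕ)) :=
  [(48, [(1, 128)]), (49, [(1, 129)]), (52, [(1, 126)]), (50, [(1, 127)]), (59, [(1, 130)]),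
   (67, [(1, 135)]), (64, [(1, 131)]), (56, [(1, 133)]), (63, [(1, 137)]), (87, [(1, 141)]),
   (25, [(1, 0)]), (44, [(1, 1)]), (34, [(1, 5)]), (46, [(1, 124)]), (53, [(1, 132)]),
   (61, [(1, 136)]), (74, [(1, 138)]), (47, [(1, 125)]), (70, [(1, 35)]), (93, [(1, 140)]),
   (90, [(1, 142)]), (57, [(1, 134)]), (72, [(1, 139)]), (3, [(1, 22)]), (28, [(1, 108)]),
   (42, [(1, 21)]), (1, [(1, 6)]), (62, [(1, 117)]), (33, [(1, 34)]), (10, [(1, 77)]),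
   (2, [(1, 16)]), (7, [(1, 55)]), (26, [(1, 76)]), (66, [(1, 115)]), (15, [(1, 40)]),
   (36, [(1, 41)]), (29, [(1, 113)]), (8, [(1, 65)]), (41, [(1, 62)]), (17, [(1, 64)]),
   (4, [(1, 3)]), (51, [(1, 114)]),
   (9, [(60, 20), (-90, 27), (1, 85), (6, 51), (90, 25), (-36, 30), (84, 8), (36, 10), (-120, 26), (-120, 14), (84, 24), (36, 23), (-60, 38), (-66, 31), (-6, 29), (6, 44), (6, 84)]),
   (37, [(1, 20)]), (14, [(1, 43)]), (45, [(1, 56)]), (35, [(1, 67)]), (54, [(1, 102)]),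
   (38, [(1, 104)]), (68, [(1, 70)]), (23, [(1, 107)]), (55, [(1, 119)]), (19, [(1, 90)]),
   (6, [(1, 49)]), (43, [(1, 80)]), (21, [(1, 30)]), (16, [(1, 95)]), (58, [(1, 24)]),
   (22, [(1, 33)]), (13, [(1, 85)]), (31, [(1, 84)]), (71, [(1, 23)]), (65, [(1, 25)]),
   (12, [(1, 31)]), (60, [(1, 45)]), (27, [(1, 50)]), (40, [(1, 96)]), (98, [(1, 143)])]

/-- The variables are the coefficients at the 104 graphs of `table8`, of which 36 are free. Most
steps use one equation; the variable 9 is isolated by a combination of 17 equations in which the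
other undetermined variables cancel. -/
theorem eliminates_steps8 : eliminates table8 8 15 equations8 freeIndices8 steps8 = true := by
  decide +kernel

/-- Passage from abstract new vertices to codes: the inner new vertex receives the label 7 and the
outer one the label 8. -/
theorem coeff_star_star_eq_zero_iff (x : GraphSpace) {T : List ℕ}
    (hT : T.all (validCode 6) = true) {rest : List (Sym2 (Fin 6))} (φ : Fin 6 ≃ Fin 6)
    (h : (rest.map (Sym2.map φ)).Perm (T.map (dec 6))) (a : Fin 6) (ys : List (Option (Fin 6))) :
    coeff x (star ys (star [a] rest)) = 0 ↔ coeff x ((extend 7 (extend 6 T [(φ a : ℕ) + 1])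
      (ys.map fun y => (finSuccEquivLast.symm (y.map φ) : ℕ) + 1)).map (dec 8)) = 0 := by
  let σ : Option (Option (Fin 6)) ≃ Fin 8 :=
    ((φ.optionCongr.trans finSuccEquivLast.symm).optionCongr.trans finSuccEquivLast.symm)
  rw [← coeff_map_equiv x σ]
  apply coeff_perm_eq_zero
  have hT' : (extend 6 T [(φ a : ℕ) + 1]).all (validCode 7) = true := by
    rw [extend, List.all_append, List.map_singleton, List.all_cons]
    simp only [List.all_eq_true, validCode_iff, Bool.and_eq_true, List.all_nil, and_true] at hT ⊢
    refine ⟨fun c hc => ?_, ?_⟩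
    · have := hT c hc
      omega
    · omega
  have h₁ : ((star [a] rest).map (Sym2.map (φ.optionCongr.trans finSuccEquivLast.symm))).Perm
      ((extend 6 T [(φ a : ℕ) + 1]).map (dec 7)) := by
    refine List.Perm.trans ?_ (map_dec_extend (by norm_num) hT (ys := [φ a]) (List.Perm.refl _))
    have : (star [a] rest).map (Sym2.map (φ.optionCongr.trans finSuccEquivLast.symm)) =
        ((star [a] rest).map (Sym2.map (Option.map φ))).map (Sym2.map finSuccEquivLast.symm) := by
      rw [List.map_map]
      refine List.map_congr_left fun e _ => ?_
      rw [Function.comp_apply, Sym2.map_map]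
      rfl
    rw [this, star_map]
    exact ((h.map _).append_left _).map _
  refine List.Perm.trans ?_ (map_dec_extend (by norm_num) hT'
    (ys := ys.map (φ.optionCongr.trans finSuccEquivLast.symm)) (List.Perm.of_eq ?_))
  · have : (star ys (star [a] rest)).map (Sym2.map σ) = ((star ys (star [a] rest)).map
        (Sym2.map (Option.map (φ.optionCongr.trans finSuccEquivLast.symm)))).map
          (Sym2.map finSuccEquivLast.symm) := by
      rw [List.map_map]
      refine List.map_congr_left fun e _ => ?_
      rw [Function.comp_apply, Sym2.map_map]
      rfl
    rw [this, star_map]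
    exact ((h₁.map _).append_left _).map _
  · rw [List.map_map]
    rfl

theorem valid_extend_extend {T : List ℕ} (hT : T.all (validCode 6) = true) {a : ℕ} (ha : a ∈ List.range' 1 6)
    {S : List ℕ} (hS : ∀ s ∈ S, s ∈ List.range' 1 7) :
    (extend 7 (extend 6 T [a]) S).all (validCode 8) = true := by
  simp only [extend, List.all_append, List.map_singleton, List.all_eq_true, validCode_iff,
    Bool.and_eq_true, List.mem_range'_1, List.mem_map, List.mem_singleton] at hT ha hS ⊢
  refine ⟨⟨fun c hc => ?_, ?_⟩, ?_⟩
  · have := hT c hc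
    omega
  · rintro _ rfl
    omega
  · rintro _ ⟨s, hs, rfl⟩
    have := hS s hs
    omega

/-- The graphs with a bivalent vertex next to a leaf. -/
def leafExtensions : List (List ℕ) :=
  graphs6_12.flatMap fun T => (List.range' 1 6).map fun w => extend 7 (extend 6 T [w]) [7]

/-- The graphs with two adjacent bivalent vertices. -/
def bivalentExtensions : List (List ℕ) :=
  graphs6_11.flatMap fun T => (List.range' 1 6).flatMap fun a =>
    (List.range' 1 6).map fun b => extend 7 (extend 6 T [a]) [7, b]

theorem exists_vanishTest_leafExtensions :
    ∀ l ∈ leafExtensions, ∃ q, vanishTest 8 table8 l q = true :=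
  exists_of_checkAll (qs :=
    [87645231, 87456123, 87564312, 87564312, 87456123, 87645231, 87645321, 87645321, 87645321,
     102012867543, 102012876543, 87645321, 103012875634, 103012876543, 104012875634, 104012876543,
     87653412, 87653412, 87653421, 87653421, 87652341, 87654231, 87653421, 87653421, 87654231,
     87654123, 87654312, 87654231, 87654231, 87654231])
    (by decide +kernel)

theorem exists_vanishTest_bivalentExtensions :
    ∀ l ∈ bivalentExtensions, ∃ q, vanishTest 8 table8 l q = true :=
  exists_of_checkAll (qs :=
    [78654321, 78021876543, 76021675834, 76021678534, 80021786534, 77021876534, 78021786534,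
     78654321, 76021765843, 76021768543, 77021786543, 80021876543, 76012675834, 76012765843,
     87564312, 87564312, 79021685734, 79021865743, 76012678534, 76012768543, 87564312, 87564312,
     79021687534, 79021867543, 80012786534, 77012786543, 79012685734, 79012687534, 78654321,
     81021876543, 77012876534, 80012876543, 79012865743, 79012867543, 81021786534, 78654321,
     87653421, 87564321, 87564321, 87564321, 87653421, 87653421, 87653421, 87564321, 87564321,
     87564321, 87653421, 87653421, 87564321, 87564321, 87564321, 87564321, 78436512, 78345612,
     87564321, 87564321, 87564321, 87564321, 78345612, 78436512, 87653421, 87653421, 78436512,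
     78345612, 87653421, 87653421, 87653421, 87653421, 78345612, 78436512, 87653421, 87653421,
     87564321, 87564321, 87564321, 87564321, 87456321, 87645321, 87564321, 87564321, 87564321,
     87564321, 87456321, 87645321, 87564321, 87564321, 87564321, 87564321, 87456321, 87645321,
     87564321, 87564321, 87564321, 87564321, 82021687543, 82021867543, 87456321, 87456321,
     87456321, 82021678543, 87456321, 82021876543, 87645321, 87645321, 87645321, 82021768543,
     82021786543, 87645321, 87654231, 83021876354, 83021876534, 87654231, 87654231, 87654231,
     83021876345, 87654123, 83021876543, 87654123, 87654123, 87654123, 83021876435, 83021876453,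
     87654312, 87654312, 87654312, 87654312, 87654231, 87654123, 87654312, 87654231, 87654231,
     87654231, 87654231, 87654123, 87654312, 87654231, 87654231, 87654231, 87654231, 87654123,
     87654312, 87654231, 87654231, 87654231, 78654321, 78645312, 85021867534, 86021867435,
     84021876435, 96021867435, 78645312, 78654321, 85021876543, 84021867453, 86021876453,
     96021876453, 85012867534, 85012876543, 78654321, 87021867534, 87021876543, 97021876543,
     86012867435, 84012867453, 87012867534, 78654321, 78645312, 98021867534, 84012876435,
     86012876453, 87012876543, 78645312, 78654321, 98021876543, 96012867435, 96012876453,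
     97012876543, 98012867534, 98012876543, 78654321, 87645321, 87645321, 87645321, 89021867543,
     89021876543, 87645321, 87645321, 87645321, 87645321, 90021867543, 90021876543, 87645321,
     87645321, 87645321, 87645321, 88021857643, 88021875643, 87645321, 89012867543, 90012867543,
     88012857643, 78654321, 91021876543, 99021867543, 89012876543, 90012876543, 88012875643,
     91021867543, 78654321, 99021876543, 87645321, 87645321, 87645321, 99012867543, 99012876543,
     87645321, 87645321, 87645321, 87645321, 87634521, 87653421, 87645321, 87645321, 87645321,
     87645321, 87634521, 87653421, 87645321, 87645321, 87645321, 87645321, 87624351, 87652341,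
     87645321, 87634521, 87634521, 87624351, 87634521, 87654231, 87634521, 87653421, 87653421,
     87652341, 87654231, 87653421, 87653421, 87645321, 87645321, 87645321, 87634521, 87653421,
     87645321, 78654321, 78654312, 92021874635, 92021876435, 100021784356, 100021874356, 78654312,
     78654321, 92021874653, 92021876453, 100021784365, 100021874365, 92021873546, 92021873564,
     78654321, 78653421, 100021785643, 100021875643, 92021875346, 92021875364, 78653421, 78654321,
     100021786543, 100021876543, 100012784356, 100012784365, 100012785643, 100012786543, 87652143,
     87652143, 100012874356, 100012874365, 100012875643, 100012876543, 87652143, 87652143,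
     87654231, 93021876453, 93021876543, 87654231, 87654231, 87654231, 93012876453, 78654321,
     94021876543, 95021876453, 101021786453, 101021876453, 93012876543, 94021876453, 78654321,
     95021876543, 101021786543, 101021876543, 87654231, 95012876453, 95012876543, 87654231,
     87654231, 87654231, 87654231, 101012786453, 101012786543, 87654231, 87654231, 87654231,
     87654231, 101012876453, 101012876543, 87654231, 87654231, 87654231])
    (by decide +kernel)

/-- This is the completeness of `table8` in minimal valency three: an extension has an odd symmetry,
or its certificate points to the table. -/
theorem exists_vanishTest_extensions :
    ∀ l ∈ extensions 7 3 graphs7_11, ∃ q, vanishTest 8 table8 l q = true :=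
  exists_of_checkAll (qs :=
    [49068743215, 16038674512, 52056873214, 52058637124, 16036847152, 15476328, 10028653741,
     27651384, 61046581723, 28028647531, 37614825, 10026835471, 28026874351, 61045618273,
     12025643781, 86754321, 87653421, 87653421, 87634521, 87634521, 27654183, 87645321, 87645321,
     27651384, 27614385, 87645321, 87645321, 87653421, 87634521, 87645321, 87645321, 16058672341,
     33046872531, 16058627341, 33046827531, 13025876431, 87645321, 87645321, 44027584631,
     44027548631, 87645321, 87645321, 11045763281, 11045736281, 87645321, 51018675432, 51016875423,
     65017683254, 24016758432, 24016754832, 49038765421, 55038675421, 46046875321, 55038657421,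
     46046857321, 87645321, 27654381, 51036854721, 56028574631, 56028547631, 53028643571,
     47027843561, 39028674351, 39028647351, 62046521873, 86754321, 87654231, 87654231, 87654231,
     87654231, 87645321, 54038654721, 54036854721, 13037654821, 13037645821, 54038654271,
     54036854271, 13037654281, 13037645281, 48028743651, 87654312, 87654312, 87654312, 87654312,
     87645321, 50028765341, 49027865341, 15028675431, 15028657431, 54018654723, 86754321, 87653421,
     87653421, 15674328, 17456328, 87624351, 86745231, 17354628, 87624351, 86732541, 87624351,
     87653421, 12654378, 87653421, 86732541, 86745231, 87653421, 87653421, 87653421, 86754312,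
     86754312, 87654312, 42067853214, 18048765123, 73056874213, 15038756412, 9036857421,
     7045786312, 27654381, 52037854621, 59028674531, 24037846521, 67058631472, 51057831264,
     58028674351, 39018746352, 6018542673, 45038764251, 42047853261, 18038675142, 55018756432,
     67018752643, 87564231, 87645231, 8028764513, 52047862315, 8028746153, 52047826135,
     58048576213, 52048731625, 8027851643, 86732541, 12017845632, 52048713265, 8027815463,
     12017854362, 86732541, 58045821763, 41028765431, 15017865342, 15017685342, 14028657431,
     13015764823, 86753421, 17564238, 15672348, 8038647512, 16027856413, 61038765214, 16028754613,
     8036845712, 61037862514, 86753421, 10018753462, 10017854362, 58037682154, 22028647351,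
     22026843751, 27654381, 67048675231, 33037865241, 67048657231, 33037856241, 87645321,
     54028754631, 65056832741, 2027854631, 2027845631, 60058632174, 74056821374, 6038654271,
     6038645271, 62036821574, 31018672435, 52017865423, 33017685243, 59018756432, 56018764532,
     9018765432, 46017865342, 37017685342, 7028657341, 2015674823, 30068753214, 47658123,
     5047865231, 66048657321, 15047856321, 17047586321, 27654381, 31036824751, 25674381,
     56037548621, 31028731564, 54057831264, 61028674351, 17456328, 11028714653, 72038764251,
     5016875243, 18016784352, 17018675342, 44016874523, 87645321, 21058764312, 72056874213,
     21058746312, 72056847213, 14047865321, 87645321, 87645321, 59037684521, 59037648521, 87645321,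
     87645321, 61018764352, 61018746352, 87645321, 73038764251, 73037864251, 86754321, 86754321,
     86754321, 87654312, 87654312, 87654312, 87654312, 87654312, 45058762413, 45058672413,
     87564321, 27654381, 31058627431, 31058267431, 50038654721, 37048753621, 37048573621,
     51028547631, 75068324175, 67028634175, 67028364175, 60048326175, 53018435672, 26028763451,
     30048753261, 21038765241, 66018756342, 16018732654, 87645321, 26058673412, 18058674321,
     26058637412, 18058647321, 41048576321, 87645321, 87645321, 52028574631, 52028547631, 87645321,
     87645321, 31048371562, 31048317562, 87645321, 87645321, 87645321, 37652841, 37624851,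
     87645321, 45018765432, 30028765431, 5038674512, 34038756241, 46028754613, 87645321, 87645321,
     60018765432, 60018756432, 87645321, 87654312, 37654821, 87654312, 87654312, 87654312,
     87564321, 19058673241, 87436512, 20058367421, 59048756321, 20058634721, 87436512, 59048573621,
     19058326714, 59048637512, 59048365712, 55058743261, 55058472361, 24045673281, 67854321,
     40047836152, 12048376251, 57684321, 12048732651, 40047381652, 17654328, 47658321, 37654821,
     27654381, 55058327416, 40047618325, 12048267315, 55058234716, 12048623715, 40047163825,
     24045326718, 87563421, 39045823176, 39045281376, 39045318267, 39045132867, 87563421, 87654312,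
     87654312, 87654312, 87654312, 66028765431, 55027865341, 37027685431, 17028657431, 40018654723,
     87653421, 87653421, 87653421, 87564312, 87564312, 87653421, 66058746231, 66058476213,
     87564312, 66058742631, 66058472613, 87564312, 41058217634, 27654381, 17654328, 87653421,
     67854321, 87653421, 15058417362, 56046835271, 28047368251, 15058413762, 56046832571,
     28047362851, 13048317652, 57684321, 87653421, 87653421, 15058147326, 28047638215, 56046385217,
     15058143726, 28047632815, 56046382517, 13048137625, 47658321, 87653421, 87653421, 87564312,
     87564312, 87564321, 69058746321, 69058476321, 87564321, 69058743621, 69058473621, 87564321,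
     87653421, 87653421, 87653421, 57684321, 67854321, 87564321, 53058437261, 36037845261,
     36037485261, 53058432761, 36037842561, 36037482561, 87653421, 53058724316, 53058274316,
     87564321, 37654821, 36037528416, 36037258416, 47658321, 36037524816, 36037254816, 87653421,
     47058432176, 57045732186, 57045372186, 57045217368, 57045213768, 3067853214, 73048675312,
     35047865321, 70038657421, 37037856412, 64038576421, 8048732651, 27654381, 40028764531,
     43028547631, 33028741365, 68056831274, 6027861354, 36018746352, 52381674, 37654821,
     32048763521, 35674821, 19038756241, 27654381, 23048675321, 71048653712, 34056843712,
     7038764521, 40038645721, 16048732561, 67037852461, 44036874251, 2035647281, 62027843651,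
     21018674532, 18026875413, 18026784531, 7018675432, 7018764523, 27058674231, 27058647213,
     67854321, 87645312, 70058743621, 9058371642, 44048672531, 9058317624, 44048627513, 87645312,
     57684321, 46058471362, 43046782351, 10058217364, 29046837251, 39037486251, 37058231764,
     22047532861, 2048371652, 17654328, 47658321, 10058271346, 29046873215, 46058417326,
     43046728315, 39037468215, 37058213746, 22047523816, 27654381, 2048317625, 37654821, 87645312,
     36045271386, 36045217368, 87645312, 38057846312, 32038765412, 25046873512, 72048756312,
     71057846213, 17038765412, 20048753621, 55047853612, 4047683521, 27654381, 10038725164,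
     53047825163, 29028764351, 6047618352, 36028643751, 5028674153, 71037864251, 35017685342,
     4028765431, 43018764523, 38067845321, 37654821, 25037864521, 25038746251, 27654381,
     23027856431, 69038754621, 46037854612, 63038674521, 43038746521, 46038745162, 69037845261,
     43037864251, 63036847251, 57028743651, 34018674532, 35026874513, 35026785431, 63027856341,
     63027583614, 23017856432, 87563412, 60037865421, 60037684512, 17645328, 27354681, 87563421,
     25026873541, 25026785341, 64027865341, 64027683541, 86754231, 27048765231, 27047865321,
     27048756231, 27047856321, 87645321, 68038754621, 27654381, 27564381, 27456381, 37654821,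
     68037854261, 35674821, 34657821, 86754231, 37654821, 25674183, 16754238, 34657821, 87564312,
     87645321, 32058673421, 32056873421, 32058637421, 32056837421, 86754321, 87645321, 87645321,
     86754321, 86754321, 87645321, 87645321, 86754321, 86754321, 86754321, 87653412, 87653412,
     86754321, 86754321, 86754321, 86754321, 74038765421, 74037865421, 86754321, 86754321,
     86754321, 27028675431, 27026875431, 86754321, 86754321, 86754321, 86754321, 57684123,
     67851324, 87563421, 26068527143, 5058647132, 66038576412, 26068251743, 66038754612,
     5058461732, 87563421, 50068214375, 10048725163, 10048271563, 33058417362, 33058143762,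
     25018764352, 19018675324, 26038752164, 3047853261, 72028675341, 20028756431, 8018623745,
     87654231, 87645231, 37654821, 25058764321, 27654381, 25058746231, 19048567321, 45068351724,
     9048753612, 35058461723, 8058236741, 45068315274, 9048735162, 8058263471, 35058416273,
     65038154762, 75048765321, 75048675321, 87564321, 75048657321, 87456321, 87645321, 27654381,
     68028754631, 68028574631, 68028547631, 37654821, 68028754361, 68028574361, 68028547361,
     87654231, 45028756314, 3028765413, 71018764532, 35038647125, 69028653741, 26018765324,
     42028765431, 72018765432, 71028657341, 9028753614, 87645321, 87645321, 17563428, 17436528,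
     87645321, 87654231, 37654821, 26754183, 17564238, 17456238, 68018754632, 37624851,
     38038756241, 32028674531, 73028756341, 70028753641, 87653421, 87653421, 87653421, 73018756432,
     73018754632, 32018673452, 75038765421, 26754381, 27038675421, 27038657421, 74028754631,
     27018675423, 38017845632, 86754312, 87654231, 87654231, 1078342651, 26048756231, 26048572613,
     45048537162, 45048351726, 87645321, 87645321, 87354621, 87354621, 87645321, 37654821,
     87654312, 87654312, 87654312, 87654312, 87645312, 75018765432])
    (by decide +kernel)

/-- A cocycle is determined by its coefficients at the graphs with the indices `freeIndices8`. -/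
theorem eq_zero_of_coeff_free {x : GraphSpace} (hx : x ∈ connectedPart 8 14) (hdx : d x = 0)
    (h : ∀ i ∈ freeIndices8, coeff x ((table8.getD i []).map (dec 8)) = 0) : x = 0 := by
  have hz := coeff_eq_zero_of_eliminates eliminates_steps8 (x := x)
    (fun p _ => by rw [hdx, coeff_zero]) h
  have hz' : ∀ T ∈ table8, coeff x (T.map (dec 8)) = 0 := by
    intro T hT
    obtain ⟨i, hi, rfl⟩ := List.mem_iff_getElem.1 hT
    rw [← List.getD_eq_getElem _ [] hi]
    refine hz i ?_
    have hlen : table8.length = 104 := rfl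
    rw [hlen] at hi
    clear hz h hT
    revert i
    decide +kernel
  refine eq_zero_of_cocycle hx hdx ?_ ?_ ?_
  · intro w rest hn hl hlen
    obtain ⟨T, hT, φ, hφ⟩ := isCover_graphs6_12 rest ⟨hn, hl, hlen, fun _ => Nat.zero_le _⟩
    have hv : T.all (validCode 6) = true :=
      List.all_eq_true.1 (by decide +kernel : (graphs6_12.all (·.all (validCode 6))) = true) T hT
    have hw : (φ w : ℕ) + 1 ∈ List.range' 1 6 := by rw [List.mem_range'_1]; omega
    obtain ⟨q, hq⟩ := exists_vanishTest_leafExtensions (extend 7 (extend 6 T [(φ w : ℕ) + 1]) [7])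
      (List.mem_flatMap.2 ⟨T, hT, List.mem_map.2 ⟨_, hw, rfl⟩⟩)
    refine (coeff_star_star_eq_zero_iff x hv φ hφ w [none]).2 ?_
    refine coeff_eq_zero_of_vanishTest hq (valid_extend_extend hv hw ?_) hz'
    simp
  · intro a b rest hn hl hlen
    obtain ⟨T, hT, φ, hφ⟩ := isCover_graphs6_11 rest ⟨hn, hl, hlen, fun _ => Nat.zero_le _⟩
    have hv : T.all (validCode 6) = true :=
      List.all_eq_true.1 (by decide +kernel : (graphs6_11.all (·.all (validCode 6))) = true) T hT
    have ha : (φ a : ℕ) + 1 ∈ List.range' 1 6 := by rw [List.mem_range'_1]; omega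
    have hb : (φ b : ℕ) + 1 ∈ List.range' 1 6 := by rw [List.mem_range'_1]; omega
    obtain ⟨q, hq⟩ := exists_vanishTest_bivalentExtensions
      (extend 7 (extend 6 T [(φ a : ℕ) + 1]) [7, (φ b : ℕ) + 1])
      (List.mem_flatMap.2 ⟨T, hT, List.mem_flatMap.2 ⟨_, ha, List.mem_map.2 ⟨_, hb, rfl⟩⟩⟩)
    refine (coeff_star_star_eq_zero_iff x hv φ hφ a [none, some b]).2 ?_
    have he : ([none, some b].map fun y => (finSuccEquivLast.symm (Option.map φ y) : ℕ) + 1) =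
        [7, (φ b : ℕ) + 1] := by
      simp
    rw [he]
    refine coeff_eq_zero_of_vanishTest hq (valid_extend_extend hv ha ?_) hz'
    intro s hs
    rw [List.mem_range'_1] at hb ⊢
    simp only [List.mem_cons, List.not_mem_nil, or_false] at hs
    omega
  · intro l hn hl hlen hdeg
    refine coeff_eq_zero_of_extensions (n := 7) (k := 14) (D := 3) (by norm_num) x
      (fun d => [[], [], [], graphs7_11].getD d []) (fun d h₁ h₂ => ?_)
      (forall_mem_getD_valid (by decide +kernel)) ⟨hn, hl, hlen, hdeg⟩
    -- From `3 ≤ d` and `8 * d ≤ 28`.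
    obtain rfl : d = 3 := by omega
    refine ⟨isCover_graphs7_11, fun l hl hv => ?_⟩
    obtain ⟨q, hq⟩ := exists_vanishTest_extensions l hl
    exact coeff_eq_zero_of_vanishTest hq hv hz'

end Cocycles

/-! ### A test for connectedness. -/

section Reachability

variable {n k : ℕ}

/-- Add to a set of labels the neighbours along the edges in the list, one edge after another. -/
def grow : List ℕ → ℕ → ℕ
  | [], M => M
  | c :: l, M => grow l (bif M.testBit (c / 10) || M.testBit (c % 10) then
      M ||| 2 ^ (c / 10) ||| 2 ^ (c % 10) else M)

/-- Whether all labels can be reached from the label 1, where `n` rounds are made. -/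
def isConnected (n : ℕ) (l : List ℕ) : Bool := Nat.beq ((grow l)^[n] 2) (2 ^ (n + 1) - 2)

theorem grow_spec [NeZero n] {l : List ℕ} (hl : l.all (validCode n) = true) {P : Fin n → Prop}
    (hP : ∀ a b, s(a, b) ∈ l.map (dec n) → P a → P b) {M : ℕ}
    (hM : ∀ i : Fin n, M.testBit (i + 1) = true → P i) (i : Fin n)
    (hi : (grow l M).testBit (i + 1) = true) : P i := by
  induction l generalizing M with
  | nil => exact hM i hi
  | cons c l ih =>
    rw [List.all_cons, Bool.and_eq_true] at hl
    refine ih hl.2 (fun a b hab => hP a b (List.mem_cons_of_mem _ hab)) (fun j hj => ?_) hi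
    cases hc : M.testBit (c / 10) || M.testBit (c % 10)
    · rw [hc] at hj
      exact hM j hj
    · rw [hc, cond_true, Nat.testBit_or, Nat.testBit_or, Nat.testBit_two_pow,
        Nat.testBit_two_pow] at hj
      simp only [Bool.or_eq_true, decide_eq_true_eq] at hj hc
      obtain ⟨h1, h2, h3, h4, -⟩ := validCode_iff.1 hl.1
      have e₁ : c / 10 = (Fin.ofNat n (c / 10 - 1) : ℕ) + 1 := by
        have : c / 10 - 1 < n := by omega
        rw [Fin.val_ofNat, Nat.mod_eq_of_lt this]
        omega
      have e₂ : c % 10 = (Fin.ofNat n (c % 10 - 1) : ℕ) + 1 := by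
        have : c % 10 - 1 < n := by omega
        rw [Fin.val_ofNat, Nat.mod_eq_of_lt this]
        omega
      have key : P (Fin.ofNat n (c / 10 - 1)) ∧ P (Fin.ofNat n (c % 10 - 1)) := by
        rcases hc with hc | hc
        · have := hM _ (e₁ ▸ hc)
          exact ⟨this, hP _ _ (List.mem_cons_self) this⟩
        · have := hM _ (e₂ ▸ hc)
          exact ⟨hP _ _ (by rw [Sym2.eq_swap]; exact List.mem_cons_self) this, this⟩
      rcases hj with (hj | hj) | hj
      · exact hM j hj
      · rw [e₁, Nat.add_right_cancel_iff, ← Fin.ext_iff] at hj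
        exact hj ▸ key.1
      · rw [e₂, Nat.add_right_cancel_iff, ← Fin.ext_iff] at hj
        exact hj ▸ key.2

/-- Only labels reachable from the label 1 are ever marked, so a full mask proves connectedness.
That `n` rounds always suffice is not needed. -/
theorem connected_of_isConnected [NeZero n] {l : List ℕ} (hl : l.all (validCode n) = true)
    (h : isConnected n l = true) {g : OrderedGraph (Fin n) k}
    (hg : List.ofFn g.edge = l.map (dec n)) : g.toSimpleGraph.Connected := by
  have key : ∀ m, ∀ i : Fin n, ((grow l)^[m] 2).testBit (i + 1) = true →
      g.toSimpleGraph.Reachable 0 i := by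
    intro m
    induction m with
    | zero =>
      intro i hi
      rw [Function.iterate_zero, id, show (2 : ℕ) = 2 ^ 1 from rfl, Nat.testBit_two_pow,
        decide_eq_true_eq] at hi
      rw [show i = 0 from Fin.ext (by rw [Fin.val_zero]; omega)]
    | succ m ih =>
      rw [Function.iterate_succ_apply']
      exact grow_spec hl (fun a b hab ha =>
        ha.trans ((toSimpleGraph_adj g a b).2 (hg ▸ hab)).reachable) ih
  refine (SimpleGraph.connected_iff_exists_forall_reachable _).2 ⟨0, fun i => key n i ?_⟩
  rw [Nat.eq_of_beq_eq_true h, show 2 ^ (n + 1) - 2 = 2 * (2 ^ n - 1) by rw [pow_succ]; omega,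
    Nat.testBit_succ, Nat.mul_div_cancel_left _ (by norm_num), Nat.testBit_two_pow_sub_one]
  simp

end Reachability

/-! ### The 46 graphs, and the cocycle property of their sum. -/

section HeptagonWheelCocycle

theorem ofFn_gamma7Graph (r : Fin 46) :
    List.ofFn (gamma7Graph r).edge = (table8.getD r []).map (dec 8) := by
  have h : ∀ r : Fin 46, List.ofFn (gamma7Table r).1 = table8.getD r [] := by
    decide +kernel
  rw [← h r, List.map_ofFn]
  rfl

theorem isGraph_table8 : ∀ i < 75, isGraph 8 (table8.getD i []) = true := by
  decide +kernel

theorem valid_table8 {i : ℕ} (hi : i < 75) : (table8.getD i []).all (validCode 8) = true :=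
  all_validCode_of_isGraph (isGraph_table8 i hi)

theorem connected_gamma7Graph (r : Fin 46) : (gamma7Graph r).toSimpleGraph.Connected := by
  refine connected_of_isConnected (valid_table8 (by omega)) ?_ (ofFn_gamma7Graph r)
  revert r
  decide +kernel

/-- The numbers of symmetries of the graphs in `γ₇`. -/
def symmetryCounts : List ℕ :=
  [14, 1, 2, 2, 1, 1, 1, 1, 1, 1, 2, 2, 2, 4, 1, 1, 1, 1, 2, 2, 2, 2, 2, 2, 1, 1, 1, 2, 2, 2, 1, 1,
   1, 2, 1, 1, 1, 2, 1, 1, 4, 2, 1, 1, 1, 1]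

theorem coeff_gamma7Graph_self (r : Fin 46) :
    coeff (gamma7Graph r).cls ((table8.getD r []).map (dec 8)) = (symmetryCounts.getD r 0 : ℕ) := by
  refine coeff_cls_self (by norm_num) (isGraph_table8 r (by omega)) ?_ (ofFn_gamma7Graph r)
  revert r
  decide +kernel

/-- One search serves two purposes: pairwise non-isomorphism of the 46 graphs, and the evaluation of
`gamma7` at the first 75 graphs of the table. -/
theorem isos_table8 : ∀ r < 46, ∀ i < 75, r ≠ i →
    isos 8 (table8.getD i []) (table8.getD r []) = [] := by
  decide +kernel

theorem not_isZeroGraph_gamma7Graph (r : Fin 46) : ¬ (gamma7Graph r).IsZeroGraph := by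
  apply not_isZeroGraph_of_coeff_ne_zero
  rw [ofFn_gamma7Graph, coeff_gamma7Graph_self, Nat.cast_ne_zero]
  revert r
  decide +kernel

theorem gamma7Coeff_ne_zero (r : Fin 46) : gamma7Coeff r ≠ 0 := by
  revert r
  decide +kernel

theorem isEmpty_iso_gamma7Graph {r s : Fin 46} (h : r ≠ s) :
    IsEmpty ((gamma7Graph r).toSimpleGraph ≃g (gamma7Graph s).toSimpleGraph) :=
  isEmpty_iso_of_isos (by norm_num) (isGraph_table8 r (by omega)) (isGraph_table8 s (by omega))
    (isos_table8 s (by omega) r (by omega) fun h' => h (Fin.ext h'.symm)) (ofFn_gamma7Graph r)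
    (ofFn_gamma7Graph s)

instance : DecidableRel (wheel 7).Adj
  | some i, some j => inferInstanceAs (Decidable ((SimpleGraph.cycleGraph 7).Adj i j))
  | none, none => .isFalse id
  | none, some _ => .isTrue trivial
  | some _, none => .isTrue trivial

/-- The bijection of vertices from the first graph of `γ₇` to the heptagon wheel. -/
def wheelEquiv : Fin 8 ≃ Option (Fin 7) where
  toFun := ![some 0, some 4, some 3, some 2, some 5, some 1, some 6, none]
  invFun o := o.elim 7 ![0, 5, 3, 2, 1, 4, 6]
  left_inv := by decide
  right_inv := by decide

theorem nonempty_iso_wheel : Nonempty ((gamma7Graph 0).toSimpleGraph ≃g wheel 7) := by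
  refine ⟨⟨wheelEquiv, fun {a b} => ?_⟩⟩
  rw [toSimpleGraph_adj, ofFn_gamma7Graph]
  revert a b
  decide +kernel

/-- The coefficients of `γ₇` multiplied by 16 and by the numbers of symmetries. -/
def weights : List ℤ :=
  [224, -112, -84, 308, -308, -112, -70, 196, 98, -294, 308, -84, -420, -280, 14, -196, 70, 210,
   -196, -196, 280, 98, -238, 224, 98, -112, 308, -154, -196, 616, -196, 280, -196, -420, -112,
   -112, -112, -294, 98, -308, 392, -196, -112, -28, 112, -112]

/-- Among the 46 graphs only the `i`-th one contributes, with its number of symmetries. The factor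
16 clears the denominators of the coefficients. -/
theorem coeff_gamma7 {i : ℕ} (hi : i < 75) :
    16 * coeff gamma7 ((table8.getD i []).map (dec 8)) = (weights.getD i 0 : ℤ) := by
  have hzero : ∀ r : Fin 46, (r : ℕ) ≠ i →
      coeff (gamma7Graph r).cls ((table8.getD i []).map (dec 8)) = 0 := fun r hr =>
    coeff_cls_eq_zero_of_isos (by norm_num) (isGraph_table8 i hi) (isGraph_table8 r (by omega))
      (isos_table8 r r.2 i hi hr) (ofFn_gamma7Graph r)
  rw [gamma7, coeff_sum]
  by_cases h : i < 46
  · rw [Finset.sum_eq_single ⟨i, h⟩ (fun r _ hr => by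
      rw [coeff_smul, hzero r fun h' => hr (Fin.ext h'), mul_zero]) (by simp), coeff_smul,
      coeff_gamma7Graph_self ⟨i, h⟩]
    have key : ∀ r : Fin 46, 16 * (gamma7Coeff r * (symmetryCounts.getD r 0 : ℕ)) =
        (weights.getD r 0 : ℤ) := by
      decide +kernel
    exact_mod_cast key ⟨i, h⟩
  · rw [Finset.sum_eq_zero fun r _ => by
      rw [coeff_smul, hzero r (by omega), mul_zero], List.getD_eq_default _ _ (by
        change 46 ≤ i
        omega)]
    simp

theorem exists_of_coeff_gamma7_ne_zero {V : Type} {l : List (Sym2 V)} (h : coeff gamma7 l ≠ 0) :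
    ∃ T ∈ table8.take 46, ∃ φ : V ≃ Fin 8, (l.map (Sym2.map φ)).Perm (T.map (dec 8)) := by
  rw [gamma7, coeff_sum] at h
  obtain ⟨r, -, hr⟩ := Finset.exists_ne_zero_of_sum_ne_zero h
  rw [coeff_smul] at hr
  obtain ⟨φ, hφ⟩ := exists_equiv_of_coeff_cls_ne_zero (right_ne_zero_of_mul hr)
  rw [ofFn_gamma7Graph] at hφ
  refine ⟨_, ?_, φ, hφ⟩
  have key : ∀ r : Fin 46, table8.getD r [] ∈ table8.take 46 := by
    decide +kernel
  exact key r

theorem gamma7_mem_connectedPart : gamma7 ∈ connectedPart 8 14 :=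
  Submodule.sum_mem _ fun r _ => Submodule.smul_mem _ _
    (Submodule.subset_span ⟨gamma7Graph r, connected_gamma7Graph r, rfl⟩)

/-- The value of a linear form at integers. -/
def rowValue (w : List ℤ) (r : List (Bool × ℕ)) : ℤ := (r.map fun p => boolSign p.1 * w.getD p.2 0).sum

theorem rowSum_eq_rowValue {z : ℕ → ℝ} {w : List ℤ} {c : ℝ} {r : List (Bool × ℕ)}
    (h : ∀ p ∈ r, c * z p.2 = (w.getD p.2 0 : ℤ)) : c * rowSum z r = rowValue w r := by
  induction r with
  | nil => simp [rowSum, rowValue]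
  | cons p r ih =>
    have h₁ := ih fun p' hp' => h p' (List.mem_cons_of_mem _ hp')
    have h₂ := h p List.mem_cons_self
    simp only [rowSum, rowValue, List.map_cons, List.sum_cons] at h₁ ⊢
    push_cast at h₁ ⊢
    rw [← h₁, ← h₂]
    ring

/-- Whether the linear form given by an equation involves only the first `m` variables and vanishes
at `w`. -/
def rowVanishes (w : List ℤ) (m : ℕ) (p : ℕ × ℕ) : Bool :=
  match equationRow table8 8 15 p with
  | none => false
  | some r => r.all (fun p => Nat.blt p.2 m) && rowValue w r == 0

/-- The numerical core of the cocycle condition, in integers. These 124 equations involve only the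
first 75 graphs, where the coefficients of `gamma7` are known. -/
theorem rowVanishes_equations8 : ((equations8.take 124).all (rowVanishes weights 75)) = true := by
  decide +kernel

theorem coeff_d_gamma7 {p : ℕ × ℕ} (hp : p ∈ equations8.take 124) :
    coeff (d gamma7) ((unpack 100 15 p.1).map (dec 9)) = 0 := by
  have h := List.all_eq_true.1 rowVanishes_equations8 p hp
  rw [rowVanishes] at h
  cases hr : equationRow table8 8 15 p with
  | none => simp [hr] at h
  | some r =>
    simp only [hr, Bool.and_eq_true, List.all_eq_true, Nat.blt_eq, beq_iff_eq] at h
    have := rowSum_eq_rowValue (z := fun i => coeff gamma7 ((table8.getD i []).map (dec 8)))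
      fun p hp => coeff_gamma7 (h.1 p hp)
    rw [h.2, Int.cast_zero] at this
    rw [coeff_d_of_equationRow hr, (mul_eq_zero.1 this).resolve_left (by norm_num), mul_zero]

/-- It ensures that the 124 graphs are all that has to be tested for `d gamma7 = 0`. -/
theorem exists_vanishTest_expansions : ∀ l ∈ (table8.take 46).flatMap (expansions 8),
    ∃ q, vanishTest 9 ((equations8.take 124).map fun p => unpack 100 15 p.1) l q = true :=
  exists_of_checkAll (qs :=
    [2396745218, 387654921, 2398562147, 6896543127, 2395826417, 287654391, 6895634217, 1397621458,
     5895623417, 5896532147, 6983254671, 1398265417, 487659321, 5897354126, 2397281465, 5897261435,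
     6897361245, 6981436752, 1394217865, 3895326417, 4896325147, 5982453671, 3897231465,
     3982456371, 5981547632, 2932456871, 587694321, 1392856147, 5893745216, 1392471685, 4893652417,
     3893562147, 5984235761, 2392718645, 6893716425, 5892716345, 6984163572, 3892713645,
     5985174362, 3984265731, 2934265781, 187654329, 4891347625, 4893174265, 4985432671, 5893162574,
     4984617352, 5984617523, 978654321, 5891326754, 5986471253, 4986471532, 967854321, 3986745213,
     1936485271, 1934658721, 8398715624, 7398715624, 487659321, 157283469, 10389175624, 9489175623,
     13472986153, 12472986153, 11471985263, 937654821, 15437896251, 14417896352, 17298746135,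
     287154396, 5398647125, 21895764213, 587694321, 20698745213, 19892576314, 18798564213,
     983654721, 16893765214, 187624359, 17289471653, 5389461752, 21859672431, 687954321,
     18789652431, 947658321, 20689472531, 19829753641, 16839672541, 24579824613, 23579834612,
     22689724513, 23597386421, 24597286431, 22698275431, 25594786213, 12593786124, 481569237,
     25549872631, 327561984, 12539871642, 5298517346, 4598317246, 26798124356, 29395827146,
     28692837145, 27691837245, 24278965314, 32479856213, 33579863241, 34847965231, 9487956213,
     25578964132, 947658321, 31678954132, 30729863451, 739645812, 987645321, 36479812536,
     35279815436, 39197286534, 38297186543, 37497186532, 187654329, 41492786351, 40491786352,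
     44428971536, 43429871536, 42429871536, 967834521, 46597826341, 45598726341, 48698475231,
     487259163, 47689173254, 51693874512, 50693784512, 49693874512, 54649781523, 53639781524,
     52639871524, 56198524763, 55498126753, 29598134762, 57194836572, 16491836572, 27492836571,
     59297851463, 287654391, 62398741652, 937654821, 567892143, 43497832561, 61938745612,
     60697823451, 33928751643, 58937856124, 57298463715, 64498263715, 63598273614, 66194872635,
     65491872536, 55591872436, 54497865132, 69589764321, 71589763412, 937654821, 72487965231,
     70587964321, 68839765421, 587694321, 51938765421, 67937865241, 73198263475, 64298163475,
     27198263475, 21193852647, 74391852647, 287614395, 69189764235, 76298745613, 44289743165,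
     789653421, 60287964513, 60398762154, 75829736541, 386745912, 31819764253, 729653481,
     287654391, 41389715426, 77489715326, 8298174536, 79298174536, 78498173526, 79271895463,
     8271895463, 78471895362, 41317984562, 187654329, 77417983562, 34197824563, 186754239,
     50298715463, 34179285463, 50289174563, 157682349, 81281974635, 287651394, 80381974625,
     81218796435, 287654193, 80318796425, 82397815264, 82398715264, 487659321, 39379186524,
     52379186524, 32479185623, 39371986524, 52371986524, 32471985623, 84427896351, 84428796351,
     83528796341, 86578963421, 187624359, 85698713245, 86578693421, 187254369, 85698173245,
     481659327, 87692785413, 87692875413, 327654981, 87629784531, 87629874531, 26198274536,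
     89298175436, 88298175436, 74293867514, 90492876513, 587694321, 91289761453, 52379865124,
     25379861542, 80738964521, 69578964312, 92578963421, 87729864531, 44578963421, 647958321,
     84729865431, 57198364752, 93398164752, 64398164752, 95194836572, 94391846572, 74591836472,
     96289761453, 54179825463, 41389741652, 937654821, 486729153, 97479832651, 52819725634,
     70479823651, 12829751643, 58829765314, 24487936521, 85597836421, 98697825431, 987456123,
     48279481653, 24689173254, 87593876412, 481569327, 481659327, 327561984, 96639781542,
     25639871542, 3298517364, 4598134267, 89798124365, 65294837156, 26592837146, 99691837245,
     46278965314, 87479865312, 53579864213, 34748956321, 978645123, 96578964213, 101749856321,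
     100678954312, 85738965421, 45738956412, 103298573461, 102598273461, 57598173462, 103295873641,
     102592873641, 57591873642, 101398764251, 68598763241, 105589763241, 68957863421, 80597863241,
     105587963421, 80958763421, 587694321, 101937864521, 104947865321, 102298475613, 99498275613,
     27598274613, 102294876531, 99492876531, 27592876431, 25498752631, 31498762531, 75698753412,
     31947865213, 387652941, 75697854321, 947658123, 587694321, 25947856213, 91957863421,
     287154396, 89598267134, 106798256134, 381654927, 89592876314, 106792865314, 86678945321,
     567892143, 52589746321, 87847965321, 52587964231, 478639512, 87849756231, 92678945321,
     729654381, 637954821, 11197825436, 49297814536, 287651394, 11179284563, 187654239,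
     49279185463, 31281976435, 100381976425, 367854921, 31218794653, 100318794652, 485679321,
     47497852631, 24597842631, 386712945, 24579486231, 47479586231, 457189236, 101693872541,
     34693872541, 11693872541, 101639785241, 11639785241, 34639785241, 107297816435, 91298716435,
     104597816324, 157382649, 10489276153, 34489175263, 152683479, 10482976513, 34481975623,
     108327896541, 108328796451, 487659321, 55398627451, 28698327451, 57698237451, 66395826741,
     26593826741, 103792835641, 24479865321, 37589746231, 101679853421, 947658321, 51678945321,
     108678953421, 637945812, 68679845321, 109847953612, 22849756321, 1293571486, 110692481375,
     587294163, 102498673125, 111498723615, 89498732165, 52798651342, 187456329, 17498273165,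
     59798561342, 4598132476, 54897651432, 82897561342, 90958762431, 587694321, 687954321,
     978561234, 94698721543, 8978561342, 96978562431, 28948372651, 95698271354, 25978651342,
     79978652431, 927654381, 12978652431, 57948673251, 93948763521, 112398675241, 111698375241,
     587694321, 113395876142, 93593876142, 587694321, 30578964321, 67579864321, 77579864321,
     14847965312, 978654231, 40578964321, 83859764321, 587694321, 45847965312, 647958312,
     101179824536, 87279814635, 51279815436, 101197285463, 51297184563, 87297186453, 69281796435,
     92391786524, 80491786325, 69218974653, 92319875642, 80419873652, 22297815643, 98297816543,
     109297815643, 69389176524, 72398176524, 68489176325, 69381975642, 72391875642, 68481973652,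
     76218974365, 70219874356, 105419873256, 89298751634, 111298471635, 4398571624, 74895672413,
     687954321, 95798652413, 28892673514, 587392641, 114892763514, 57893672514, 111289746153,
     89289576143, 4389756142, 74859764231, 587694321, 687945123, 114829675341, 95789564231,
     28829765341, 57839765241, 115198432756, 287654391, 111598132746, 19194823675, 114491823576,
     88491832576, 54297865134, 116389754612, 76489736251, 937654821, 567893412, 43387945162,
     105938725461, 60678935241, 77937845261, 32928746531, 89398674521, 26698374521, 102798264531,
     106395846721, 99593847612, 481659327, 46597823641, 51589742631, 387624951, 101867945321,
     87587943621, 49587924631, 32869754321, 80678934521, 85957836421, 24958762431, 987564321,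
     17398127546, 56298137546, 18193824765, 95391824765, 21591823764, 367845912, 39179862534,
     187654329, 947658321, 116579864321, 44479863251, 77729863451, 62478962351, 40729864351,
     9729865431, 987456321, 114698275134, 113698274135, 985674321, 114692857314, 113692847315,
     186732549, 79589763142, 82679845321, 78847956321, 82678954231, 79587936412, 78849765231,
     117678945321, 35837956421, 35839765241, 6398517246, 5498316257, 66798124356, 56394827156,
     985674321, 16692837145, 187654329, 78479865312, 7579863421, 9748965321, 978645123,
     120578964312, 947658321, 119678954312, 36729863541, 118738965412, 987624351, 15297816543,
     121497816523, 9179285463, 37279184563, 157682349, 31381975624, 119381975624, 68381974625,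
     43128793465, 62218794365, 487659321, 987456123, 66298173465, 19398172465, 95293861754,
     20492861753, 587694321, 121279865314, 187645329, 12479865213, 68738964521, 386754921,
     100479865312, 49739864521, 42579864312, 927654381, 14739865412, 26398765241, 28398476251,
     88398467251, 984657321, 90798564231, 21798546231, 27893476152, 587294361, 99893756142,
     73893674152, 26389756421, 88389476521, 28389467521, 957684321, 21789564321, 90789546321,
     27839467512, 487359621, 73839647512, 99839765412, 84179826534, 104389716542, 67489716532,
     108197284563, 50397184652, 37398176452, 72281794635, 117391785624, 487659321, 75128974356,
     71218974356, 105319874265, 47187936254, 23397816524, 35497816235, 59497286513, 8497286513,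
     108598174623, 84493876251, 104493876251, 14592876341, 487659321, 216753498, 61618973452,
     89198472365, 89498173256, 122498173256, 89194872365, 89491873256, 122491873256, 187645329,
     80389765412, 97589763421, 80837964521, 80387965412, 97587963421, 80839764521, 587694321,
     927634581, 83938764521, 115298756413, 122398675412, 3398674521, 90895673421, 90598764312,
     20798654312, 115892574631, 20798563421, 122893764521, 63893674521, 26289751364, 112289471365,
     4189543267, 957684321, 687954321, 94789652134, 26829573146, 94789561243, 112829743156,
     103839762145, 167832549, 22489726351, 118489716352, 123498576231, 107598476321, 15598176234,
     33492786513, 7492786513, 108491785623, 61528974361, 487659321, 216753498, 178632549,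
     98487926351, 45487916352, 185273469, 54497186523, 32598174623, 53492875163, 96492875163,
     11591874263, 69539876412, 81539876412, 31539876412, 986754321, 2592371846, 110492361857,
     187654329, 88498732615, 112498723165, 39798653412, 56498372615, 65498273165, 33798563412,
     5498132657, 82798563412, 789563412, 74958672431, 21598672413, 587694321, 54978563421,
     687945231, 53978564321, 7978563412, 29958372641, 18698271534, 38978654321, 120978653412,
     937654821, 13978654321, 113948763251, 124948673512, 57298367415, 27398167425, 124398167425,
     281634597, 94591873624, 587694321, 123489765213, 10389756124, 33479862531, 947658321,
     81579864312, 117579863421, 50739864521, 62579863421, 67729863541, 15839765421])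
    (by decide +kernel)

/-- The support of `d gamma7` lies among the expansions of the 46 graphs. There an odd symmetry or
one of the 124 equations forces the coefficient to vanish. -/
theorem d_gamma7 : d gamma7 = 0 := by
  refine d_eq_zero_of_expansions (n := 8) (by norm_num) (table8.take 46) ?_
    (fun _ _ => exists_of_coeff_gamma7_ne_zero) ?_ ?_
  · exact List.all_eq_true.1 (by decide +kernel :
      ((table8.take 46).all (·.all (validCode 8))) = true)
  · exact List.all_eq_true.1 (by decide +kernel :
      ((table8.take 46).all (hasMinDegree 8 3)) = true)
  · intro T hT s hs hv
    obtain ⟨q, hq⟩ := exists_vanishTest_expansions s (List.mem_flatMap.2 ⟨T, hT, hs⟩)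
    refine coeff_eq_zero_of_vanishTest hq hv fun T' hT' => ?_
    obtain ⟨p, hp, rfl⟩ := List.mem_map.1 hT'
    exact coeff_d_gamma7 hp

end HeptagonWheelCocycle

/-! ### Graphs from codes, and isomorphisms as permutations of edge lists. -/

section CodeGraph

variable {n k : ℕ}

/-- The edge-ordered graph with a given list of codes. -/
def codeGraph [NeZero n] (hn : n < 10) (l : List ℕ) (hl : isGraph n l = true) (hk : l.length = k) :
    OrderedGraph (Fin n) k where
  edge i := dec n (l.get (Fin.cast hk.symm i))
  injective := by
    subst hk
    intro i j hij
    have := List.nodup_iff_injective_get.1 (nodup_map_dec hn hl)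
    have h := @this (Fin.cast (List.length_map _).symm i) (Fin.cast (List.length_map _).symm j)
      (by simpa using hij)
    simpa [Fin.ext_iff] using h
  loopless i := not_isDiag_dec ((isGraph_iff.1 hl).1 _ (List.get_mem _ _)).1

theorem ofFn_codeGraph [NeZero n] (hn : n < 10) (l : List ℕ) (hl : isGraph n l = true)
    (hk : l.length = k) : List.ofFn (codeGraph hn l hl hk).edge = l.map (dec n) := by
  subst hk
  refine List.ext_getElem (by simp) fun i _ _ => ?_
  simp [codeGraph]

theorem map_ofFn_edge_perm {V W : Type} {g : OrderedGraph V k} {g' : OrderedGraph W k}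
    (ψ : g.toSimpleGraph ≃g g'.toSimpleGraph) :
    ((List.ofFn g.edge).map (Sym2.map ψ)).Perm (List.ofFn g'.edge) := by
  rw [List.perm_ext_iff_of_nodup ((List.nodup_ofFn.2 g.injective).map (Sym2.map.injective ψ.injective))
    (List.nodup_ofFn.2 g'.injective)]
  intro e
  induction e with | _ a b =>
  obtain ⟨a, rfl⟩ := ψ.surjective a
  obtain ⟨b, rfl⟩ := ψ.surjective b
  rw [← Sym2.map_mk, List.mem_map_of_injective (Sym2.map.injective ψ.injective),
    ← toSimpleGraph_adj, Sym2.map_mk, ← toSimpleGraph_adj]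
  exact ψ.map_rel_iff.symm

theorem nonempty_iso_of_perm {V : Type} {g g' : OrderedGraph V k} {φ : V ≃ V}
    (h : ((List.ofFn g.edge).map (Sym2.map φ)).Perm (List.ofFn g'.edge)) :
    Nonempty (g.toSimpleGraph ≃g g'.toSimpleGraph) :=
  ⟨⟨φ, fun {a b} => by
    rw [toSimpleGraph_adj, toSimpleGraph_adj, mem_iff_of_map_perm h]⟩⟩

end CodeGraph

/-! ### The 35 independent coboundaries. -/

section Coboundaries

/-- The connected graphs with 7 vertices and 13 edges without odd symmetries. -/
def table7 : List (List ℕ) :=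
  List.map (unpack 100 13)
    [67574645373635272624171514, 67575646453736342725171412, 67575646453736342725241713,
     67575647463534272523161413, 67575647463635342725241713, 67575647463735262423151413,
     67575647463735342625241312, 67575647453736342625241716, 67575647463735342625241713,
     67575647463735342625241716, 67574746453736352726251413, 67575647453736352726241614,
     67575647463735342725161412, 67575647463735342726151412, 67575647463736352724151412,
     67575647464537362725231413, 67575647463736272524161513, 67575647463736352725241614,
     67575647464537362725161312, 67575647464537362725231614, 67575647464537363527241612,
     67575647464537363527241613, 67575647464537363527242316, 67575647463736352726241514,
     67575647464537363527261412, 67575647464537363527261413, 67575647464537363527262413,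
     67575647464537363527261514, 67575647464537363527262415, 67575647463736342725171512,
     67575647463736352725241714, 67575647464537362725231714, 67575647464537362725231716,
     67575647464537362726231715, 67575647464537363527261714]

/-- The indices of graphs whose coefficients determine a coboundary. -/
def freeIndices7 : List ℕ := freeIndices8.tail

/-- The graphs with the indices `freeIndices7`, with certificates that express the value of the
differential at these graphs by the coefficients of the graphs in `table7`. -/
def equations7 : List (ℕ × ℕ) :=
  [(7868675848453735262524171613, 2056472713015064753172000000000000000000000000000000000000000000000000000000000000),
   (7868574746453836352827161512, 13046757312000000000000000000000000000000000000013064573712000000000000000000000000001054762317001045673217006056342177),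
   (7868585756474638362827141312, 19076546231019075646321000000000000000000000000000000000000000000000000001075634214000007124356000001634527),
   (7868675856484736342725181312, 7614325000007314625000007651324000002651374000007632541014075623414014076532144),
   (7868675756484738362824151312, 2075642314000001652347000006753421),
   (7868575647463837282624181513, 5672341017065772143019067527341000000000000000000000000000000000000000000000000000000000000000000000000000000000000015075461326000000000000),
   (7867575648473836282625181413, 17065721743000006753421000000000000000000000000000000000000000000000000000000000000),
   (7868675848464537352625171312, 2065473712015064753172000007564321000000000000000000000000004056732144),
   (7868585756484738372624161312, 13075436261000000000000013075432616000000000000),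
   (7868675857484745382623161312, 30076543721000000000000000000000000000000000000000000000000000000000000),
   (7868675756484745383635281412, 3076543271003076543213003076543211),
   (7868675857474645383635281412, 5076543271005076543213005076543211),
   (7868675857484645373635241312, 7067542321007076543212007076543211),
   (7868675856484745373635281712, 8076543271008076543216008076543211),
   (7868675857484645373635281412, 9076543271009076543213009076543211),
   (7868675857484645373635281712, 10076543271010076543216010076543211),
   (7868675857564847463534281712, 7456321000007564321026067543162026076543126026067543122),
   (7868585756484746383736251412, 11076534231011076543213011076543211),
   (7868675856484746383735271512, 12076543261012076543214012076543211),
   (7868675857564847383634251412, 16076543241016076543213016076543211),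
   (7868675857484746383635271512, 18076543261018076543214018076543211),
   (7868675857564847383634271512, 20076543261020076543214020076543211),
   (7868675857564847463835271312, 21076543261021076543212021076543211),
   (7868675857564847463835271412, 22076543261022076543213022076543211),
   (7868675857484746383735261512, 24067543251024067543214024067543211),
   (7868675857564847463837251312, 25067543241025067543212025067543211),
   (7868675857564847463837261512, 28067543251028067543214028067543211),
   (7868675857484746383635281512, 31076543271031076543214031076543211),
   (7868675857564847383634281512, 32076543271032076543214032076543211),
   (7868675857564847383634281712, 33076543271033076543216033076543211),
   (7868675857564847383734281612, 34076543271034076543215034076543211),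
   (7868675857564847463837281512, 35076543271035076543214035076543211),
   (7868675857564847463835342712, 23076543261000000000000),
   (7868675857564847463837352412, 27067543231000000000000),
   (7868675857564847463837352612, 29067543251000000000000)]

/-- The order in which the equations determine the coefficients of the graphs in `table7`. -/
def steps7 : List (ℕ × List (ℤ × ℕ)) :=
  [(29, [(1, 9)]), (25, [(1, 16)]), (27, [(1, 26)]), (21, [(1, 23)]), (12, [(1, 8)]),
   (1, [(1, 4)]), (16, [(1, 6)]), (13, [(1, 3)]), (11, [(1, 18)]), (17, [(1, 20)]),
   (19, [(1, 21)]), (34, [(1, 31)]), (24, [(1, 25)]), (20, [(1, 22)]), (31, [(1, 28)]),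
   (32, [(1, 29)]), (6, [(1, 12)]), (4, [(1, 11)]), (9, [(1, 15)]), (8, [(1, 14)]),
   (30, [(1, 27)]), (23, [(1, 24)]), (2, [(1, 10)]), (33, [(1, 30)]), (15, [(1, 19)]),
   (10, [(1, 17)]), (7, [(1, 13)]), (22, [(1, 32)]), (26, [(1, 33)]), (28, [(1, 34)]),
   (14, [(1, 0)]), (18, [(1, 5)]), (3, [(1, 7)]), (0, [(1, 2)]), (5, [(1, 1)])]

/-- The numbers of symmetries of the graphs in `table7`. -/
def symmetryCounts7 : List ℕ :=
  [2, 1, 1, 2, 2, 2, 4, 1, 2, 4, 4, 1, 1, 2, 1, 1, 2, 1, 1, 1, 1, 2, 2, 4, 2, 4, 2, 2, 2, 8, 1, 2,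
   1, 2, 1]

/-- No variable is assumed known, and each step uses one equation of its own. So after reordering,
the 35 by 35 matrix is triangular with nonzero diagonal entries. -/
theorem eliminates_steps7 : eliminates table7 7 14 equations7 [] steps7 = true := by
  decide +kernel

theorem isGraph_table7 (j : Fin 35) :
    isGraph 7 (table7.getD j []) = true ∧ (table7.getD j []).length = 13 := by
  revert j
  decide +kernel

/-- The `j`-th graph in `table7`. -/
def graph7 (j : Fin 35) : OrderedGraph (Fin 7) 13 :=
  codeGraph (by norm_num) (table7.getD j []) (isGraph_table7 j).1 (isGraph_table7 j).2

theorem connected_graph7 (j : Fin 35) : (graph7 j).toSimpleGraph.Connected := by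
  refine connected_of_isConnected (all_validCode_of_isGraph (isGraph_table7 j).1) ?_
    (ofFn_codeGraph _ _ _ _)
  revert j
  decide +kernel

theorem coeff_graph7_self (j : Fin 35) :
    coeff (graph7 j).cls ((table7.getD j []).map (dec 7)) = (symmetryCounts7.getD j 0 : ℕ) := by
  refine coeff_cls_self (by norm_num) (isGraph_table7 j).1 ?_ (ofFn_codeGraph _ _ _ _)
  revert j
  decide +kernel

theorem coeff_graph7_of_ne {i j : Fin 35} (h : i ≠ j) :
    coeff (graph7 i).cls ((table7.getD j []).map (dec 7)) = 0 := by
  refine coeff_cls_eq_zero_of_isos (by norm_num) (isGraph_table7 j).1 (isGraph_table7 i).1 ?_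
    (ofFn_codeGraph _ _ _ _)
  revert i j
  decide +kernel

/-- The linear combinations of the graphs in `table7`. -/
noncomputable def combination7 : (Fin 35 → ℝ) →ₗ[ℝ] GraphSpace :=
  Fintype.linearCombination ℝ fun j => (graph7 j).cls

theorem combination7_mem (a : Fin 35 → ℝ) : combination7 a ∈ connectedPart 7 13 := by
  rw [combination7, Fintype.linearCombination_apply]
  exact Submodule.sum_mem _ fun j _ => Submodule.smul_mem _ _
    (Submodule.subset_span ⟨graph7 j, connected_graph7 j, rfl⟩)

theorem coeff_combination7 (a : Fin 35 → ℝ) (j : Fin 35) :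
    coeff (combination7 a) ((table7.getD j []).map (dec 7)) =
      a j * (symmetryCounts7.getD j 0 : ℕ) := by
  rw [combination7, Fintype.linearCombination_apply, coeff_sum,
    Finset.sum_eq_single j (fun i _ hi => by rw [coeff_smul, coeff_graph7_of_ne hi, mul_zero])
      (by simp), coeff_smul, coeff_graph7_self]

/-- The coefficients at the graphs with the indices `freeIndices7`. -/
noncomputable def freeCoeffs : GraphSpace →ₗ[ℝ] Fin 35 → ℝ :=
  LinearMap.pi fun i => pairing ((table8.getD (freeIndices7.getD i 0) []).map (dec 8)).get

theorem coeff_of_freeCoeffs_eq_zero {x : GraphSpace} (h : freeCoeffs x = 0) {i : ℕ}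
    (hi : i ∈ freeIndices7) : coeff x ((table8.getD i []).map (dec 8)) = 0 := by
  obtain ⟨j, hj, rfl⟩ := List.mem_iff_getElem.1 hi
  rw [← List.getD_eq_getElem _ 0 hj]
  exact congrFun h ⟨j, hj⟩

/-- If the free coefficients of `d` of a combination vanish, the elimination gives zero coefficients
at all graphs in `table7`. These are the given scalars times numbers of symmetries. Both sides have
dimension 35, so the map is bijective. -/
theorem combination7_injective : Function.Injective (freeCoeffs ∘ₗ d ∘ₗ combination7) := by
  rw [← LinearMap.ker_eq_bot, LinearMap.ker_eq_bot']
  intro a ha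
  have hx : ∀ p ∈ equations7, coeff (d (combination7 a)) ((unpack 100 14 p.1).map (dec 8)) = 0 := by
    intro p hp
    obtain ⟨i, hi, h⟩ : ∃ i ∈ freeIndices7, table8.getD i [] = unpack 100 14 p.1 := by
      revert p
      decide +kernel
    rw [← h]
    exact coeff_of_freeCoeffs_eq_zero ha hi
  have hz := coeff_eq_zero_of_eliminates eliminates_steps7 hx (by simp)
  funext j
  have hj := hz j (by
    revert j
    decide +kernel)
  rw [coeff_combination7] at hj
  have key : ∀ j : Fin 35, symmetryCounts7.getD j 0 ≠ 0 := by
    decide +kernel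
  exact (mul_eq_zero.1 hj).resolve_right (Nat.cast_ne_zero.2 (key j))

/-- Every edge of the wheel lies in a triangle, so each contraction produces a double edge.
Accordingly all certificates are 0 and the resulting linear form is empty. -/
theorem coeff_wheel_of_mem_coboundaries {y : GraphSpace} (hy : y ∈ coboundaries 7 13) :
    coeff y ((table8.getD 0 []).map (dec 8)) = 0 := by
  obtain ⟨x, -, rfl⟩ := hy
  have h : ∃ N, unpack 100 14 N = table8.getD 0 [] ∧ equationRow table7 7 14 (N, 0) = some [] :=
    ⟨7868585748463834282523181716, by decide +kernel, by decide +kernel⟩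
  obtain ⟨N, hN, hrow⟩ := h
  rw [← hN, coeff_d_of_equationRow hrow]
  simp [rowSum]

theorem eq_zero_of_freeCoeffs {x : GraphSpace} (hx : x ∈ connectedPart 8 14) (hdx : d x = 0)
    (h₀ : coeff x ((table8.getD 0 []).map (dec 8)) = 0) (h : freeCoeffs x = 0) : x = 0 := by
  refine eq_zero_of_coeff_free hx hdx fun i hi => ?_
  have hfree : freeIndices8 = 0 :: freeIndices7 := rfl
  rw [hfree, List.mem_cons] at hi
  rcases hi with rfl | hi
  · exact h₀
  · exact coeff_of_freeCoeffs_eq_zero h hi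

theorem d_eq_zero_of_mem_coboundaries {y : GraphSpace} (hy : y ∈ coboundaries 7 13) : d y = 0 := by
  obtain ⟨x, -, rfl⟩ := hy
  exact d_d x

theorem exists_mem_coboundaries (a : Fin 35 → ℝ) : ∃ y ∈ coboundaries 7 13, freeCoeffs y = a := by
  obtain ⟨b, rfl⟩ := LinearMap.surjective_of_injective combination7_injective a
  exact ⟨_, ⟨_, combination7_mem b, rfl⟩, rfl⟩

/-- The free coefficients are coordinates. They are injective because a coboundary is a cocycle
without wheel, and surjective already on the combinations of the 35 graphs. An enumeration of all
connected graphs with 7 vertices is thereby avoided. -/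
theorem finrank_coboundaries : Module.finrank ℝ (coboundaries 7 13) = 35 := by
  have hbij : Function.Bijective (freeCoeffs.domRestrict (coboundaries 7 13)) := by
    constructor
    · rw [← LinearMap.ker_eq_bot, LinearMap.ker_eq_bot']
      rintro ⟨y, hy⟩ h
      exact Subtype.ext (eq_zero_of_freeCoeffs (coboundaries_le hy)
        (d_eq_zero_of_mem_coboundaries hy) (coeff_wheel_of_mem_coboundaries hy) h)
    · intro a
      obtain ⟨y, hy, rfl⟩ := exists_mem_coboundaries a
      exact ⟨⟨y, hy⟩, rfl⟩
  rw [(LinearEquiv.ofBijective _ hbij).finrank_eq, Module.finrank_fin_fun]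

end Coboundaries

/-! ### Normalisation at the heptagon wheel, and the space of solutions. -/

section Wheel

theorem coeff_wheel_of_mem_nonWheelPart {x : GraphSpace} (hx : x ∈ nonWheelPart) :
    coeff x ((table8.getD 0 []).map (dec 8)) = 0 := by
  by_contra h
  obtain ⟨_, ⟨g, -, hg, rfl⟩, hs⟩ := exists_mem_coeff_ne_zero hx h
  obtain ⟨φ, hφ⟩ := exists_equiv_of_coeff_cls_ne_zero hs
  obtain ⟨ψ⟩ := nonempty_iso_wheel
  obtain ⟨χ⟩ := nonempty_iso_of_perm (g := gamma7Graph 0) (g' := g) (φ := φ)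
    (by rw [ofFn_gamma7Graph]; exact hφ)
  exact hg.false (χ.symm.trans ψ)

/-- By `mem_of_coeff` only graphs with nonzero coefficient are needed to express `x`. A copy of the
wheel is not among them, because its coefficient is up to sign the one at the reference wheel. -/
theorem mem_nonWheelPart {x : GraphSpace} (hx : x ∈ connectedPart 8 14)
    (h : coeff x ((table8.getD 0 []).map (dec 8)) = 0) : x ∈ nonWheelPart := by
  refine mem_of_coeff fun n k g hg => ?_
  obtain ⟨⟨φ⟩, hk, hcon⟩ := coeff_ne_zero_of_mem_connectedPart hx hg
  obtain rfl : n = 8 := by simpa using Fintype.card_congr φ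
  rw [List.length_ofFn] at hk
  subst hk
  refine Submodule.subset_span ⟨g, connected_of_listConnected hcon, ⟨fun ψ => hg ?_⟩, rfl⟩
  obtain ⟨χ⟩ := nonempty_iso_wheel
  have hp := map_ofFn_edge_perm (ψ.trans χ.symm)
  rw [ofFn_gamma7Graph] at hp
  rw [← coeff_map_equiv x (ψ.trans χ.symm).toEquiv]
  exact (coeff_perm_eq_zero x hp).2 h

theorem coeff_gamma7_wheel : coeff gamma7 ((table8.getD 0 []).map (dec 8)) = 14 := by
  have h := coeff_gamma7 (i := 0) (by norm_num)
  rw [show weights.getD 0 0 = 224 from rfl] at h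
  push_cast at h
  linarith

theorem coeff_gamma7Graph_wheel :
    coeff (gamma7Graph 0).cls ((table8.getD 0 []).map (dec 8)) = 14 := by
  have h := coeff_gamma7Graph_self 0
  rw [show symmetryCounts.getD (0 : Fin 46) 0 = 14 from rfl] at h
  exact_mod_cast h

theorem gamma7_notMem_coboundaries : gamma7 ∉ coboundaries 7 13 := by
  intro h
  have := coeff_wheel_of_mem_coboundaries h
  rw [coeff_gamma7_wheel] at this
  norm_num at this

theorem wheelGraph_mem_connectedPart : (gamma7Graph 0).cls ∈ connectedPart 8 14 :=
  Submodule.subset_span ⟨gamma7Graph 0, connected_gamma7Graph 0, rfl⟩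

/-- The wheel has 14 symmetries, so the coefficient 1 appears as the value 14 of the pairing. -/
theorem sub_mem_nonWheelPart_iff {x : GraphSpace} (hx : x ∈ connectedPart 8 14) :
    x - (gamma7Graph 0).cls ∈ nonWheelPart ↔ coeff x ((table8.getD 0 []).map (dec 8)) = 14 := by
  have h : coeff (x - (gamma7Graph 0).cls) ((table8.getD 0 []).map (dec 8)) = 0 ↔
      coeff x ((table8.getD 0 []).map (dec 8)) = 14 := by
    rw [coeff_sub, coeff_gamma7Graph_wheel, sub_eq_zero]
  rw [← h]
  exact ⟨coeff_wheel_of_mem_nonWheelPart,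
    mem_nonWheelPart (Submodule.sub_mem _ hx wheelGraph_mem_connectedPart)⟩

theorem cocycles_eq : {x | x ∈ connectedPart 8 14 ∧ d x = 0 ∧ x - (gamma7Graph 0).cls ∈ nonWheelPart}
    = {x | ∃ y ∈ coboundaries 7 13, x = gamma7 + y} := by
  ext x
  constructor
  · rintro ⟨hx, hdx, hw⟩
    rw [sub_mem_nonWheelPart_iff hx] at hw
    -- The coboundary is chosen to match the 35 free coefficients of `x - gamma7`. The wheel
    -- coefficient of that difference vanishes by the normalisation, so all 36 determining
    -- coefficients of `x - gamma7 - y` are zero.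
    obtain ⟨y, hy, hyx⟩ := exists_mem_coboundaries (freeCoeffs (x - gamma7))
    refine ⟨y, hy, ?_⟩
    have hz : x - gamma7 - y = 0 := by
      refine eq_zero_of_freeCoeffs (Submodule.sub_mem _ (Submodule.sub_mem _ hx
        gamma7_mem_connectedPart) (coboundaries_le hy)) ?_ ?_ ?_
      · rw [map_sub, map_sub, hdx, d_gamma7, d_eq_zero_of_mem_coboundaries hy, sub_zero, sub_zero]
      · rw [coeff_sub, coeff_sub, hw, coeff_gamma7_wheel, coeff_wheel_of_mem_coboundaries hy]
        norm_num
      · rw [map_sub, hyx, sub_self]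
    rw [← sub_eq_zero, ← hz]
    abel
  · rintro ⟨y, hy, rfl⟩
    have hx := Submodule.add_mem _ gamma7_mem_connectedPart (coboundaries_le hy)
    refine ⟨hx, ?_, (sub_mem_nonWheelPart_iff hx).2 ?_⟩
    · rw [map_add, d_gamma7, d_eq_zero_of_mem_coboundaries hy, add_zero]
    · rw [coeff_add, coeff_gamma7_wheel, coeff_wheel_of_mem_coboundaries hy, add_zero]

end Wheel

end GraphComplex

theorem mainTheorem1 :
    -- the 46 graphs are connected, are not zero graphs, and are pairwise non-isomorphic;
    -- all their coefficients are nonzero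
    (∀ r, (gamma7Graph r).toSimpleGraph.Connected ∧ ¬ (gamma7Graph r).IsZeroGraph ∧
      gamma7Coeff r ≠ 0) ∧
    (∀ r s, r ≠ s → IsEmpty ((gamma7Graph r).toSimpleGraph ≃g (gamma7Graph s).toSimpleGraph)) ∧
    -- the first graph is the heptagon wheel, and its coefficient is 1
    Nonempty ((gamma7Graph 0).toSimpleGraph ≃g wheel 7) ∧ gamma7Coeff 0 = 1 ∧
    -- the sum is a cocycle, and not a coboundary
    d gamma7 = 0 ∧ gamma7 ∉ coboundaries 7 13 ∧
    -- the cocycles on connected graphs in which the heptagon wheel has coefficient 1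
    -- are exactly the sums of `γ₇` and a coboundary, and there are 35 free parameters
    {x | x ∈ connectedPart 8 14 ∧ d x = 0 ∧ x - (gamma7Graph 0).cls ∈ nonWheelPart}
      = {x | ∃ y ∈ coboundaries 7 13, x = gamma7 + y} ∧
    Module.finrank ℝ (coboundaries 7 13) = 35 := by
  exact ⟨fun r => ⟨connected_gamma7Graph r, not_isZeroGraph_gamma7Graph r, gamma7Coeff_ne_zero r⟩,
    fun _ _ h => isEmpty_iso_gamma7Graph h, nonempty_iso_wheel, rfl, d_gamma7,
    gamma7_notMem_coboundaries, cocycles_eq, finrank_coboundaries⟩
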